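/- All logarithms are to base $2$. **Setting.** Let $\mathcal M=(S,\mathbf P,\mu)$ be a finite-state Markov chain with labelling $L:S\to 2^{Ap}$, let $\mathsf p_{\min}$ be its smallest positive transition probability, let $\varphi$ be an $\omega$-regular property (for example one given by an LTL formula), and let $\mathsf p_\varphi$ be the probability that the label sequence of a run of $\mathcal M$ satisfies $\varphi$. Let $\mathcal A$ be a deterministic Rabin automaton with finite state set $Q$, transition function $\gamma$, initial state $q_0$ and set $Acc$ of Rabin pairs, accepting exactly the words that satisfy $\varphi$; a word is accepted if for some $(E,F)\in Acc$ the run of $\mathcal A$ on it visits $E$ finitely often and $F$ infinitely often. The product $\mathcal M\otimes\mathcal A$ is the Markov chain on $S\times Q$ that moves from $(s,q)$ to $(s',\gamma(q,L(s')))$ with probability $\mathbf P(s,s')$ and starts in $(s,\gamma(q_0,L(s)))$ with probability $\mu(s)$. Let $n=|S\times Q|$ be the number of states of $\mathcal M\otimes\mathcal A$, and $\mathsf{mxsc}$ the maximal number of states of a strongly connected component (SCC) of its graph. **Candidates.** Let $\pi$ be a finite path of $\mathcal M\otimes\mathcal A$, and let $G_\pi$ be the graph of the states and transitions occurring in $\pi$.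 If the set of states of some suffix of $\pi$ is a bottom SCC of $G_\pi$ (where a single state without a self-loop is not an SCC), this set, which is then unique, is the candidate $K(\pi)$; otherwise $K(\pi)=\bot$. A candidate $K$ is good if some $(E,F)\in Acc$ satisfies $K\cap(S\times E)=\emptyset$ and $K\cap(S\times F)\ne\emptyset$, and bad otherwise. The strength of $\pi$ is $0$ if $K(\pi)=\bot$. Otherwise write $\pi=\pi'\,s\,\kappa$ with $\pi'$ the shortest prefix such that $K(\pi's)=K(\pi)$; the strength is the largest $k$ such that every state of $K(\pi)$ occurs at least $k$ times in $s\,\kappa$ and the last element of $s\,\kappa$ occurs in it at least $k+1$ times. Let $i(\pi)$ be the length of the sequence of the values of $K$ on the prefixes of $\pi$, after deletion of all $\bot$ and of repetitions of consecutive elements. **The monitor.** For real $\alpha,\varepsilon$, $\textsc{BoldMonitor}_{\alpha,\varepsilon}$ starts with the empty path and extends it step by step with random states of $\mathcal M\otimes\mathcal A$ (the first state is drawn from the initial distribution, the others from the transition probabilities). Whenever $K(\pi)$ is defined and bad and the strength of the current path $\pi$ is at least $\alpha\,(i(\pi)-\log\varepsilon)$, it resets to the empty path and starts anew. Let $T$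 be the number of steps (extensions and resets) until the last reset has been carried out, with $T=0$ if there is no reset and $T=\infty$ if there are infinitely many. **Theorem.** Suppose $\mathsf p_\varphi>0$, $0<\varepsilon<1$ and $\alpha\ge\alpha_0:=\max\{1,-1/\log(1-\mathsf p_{\min})\}$ (where $-1/\log 0:=0$). Then $$\mathbb E(T)\;\le\;\frac{1}{\mathsf p_\varphi(1-\varepsilon)}\cdot 2\,n\,\alpha\,(n-\log\varepsilon)\,\mathsf{mxsc}\left(\frac1{\mathsf p_{\min}}\right)^{\mathsf{mxsc}} .$$ -/

import Mathlib

open MeasureTheory ProbabilityTheory Filter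
open scoped ENNReal

namespace BoldMonitor

noncomputable section

/-! ### Directed graphs given by an edge relation -/

section Graphs

variable {V : Type*}

/-- The subgraph induced by `C` is strongly connected: any two vertices `u`, `v` of `C` (possibly
equal) are joined by a nonempty path that stays in `C`. In particular a single vertex without a
self-loop is not strongly connected. -/
def StronglyConnectedOn (E : V → V → Prop) (C : Set V) : Prop :=
  ∀ u ∈ C, ∀ v ∈ C, Relation.TransGen (fun a b => a ∈ C ∧ b ∈ C ∧ E a b) u v

/-- Strongly connected components, represented by their vertex sets. (By maximality an SCC
contains all edges of the graph between its vertices, so that it is determined by them.) -/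
def IsSCC (E : V → V → Prop) (C : Set V) : Prop :=
  C.Nonempty ∧ Maximal (StronglyConnectedOn E) C

/-- Bottom strongly connected components. -/
def IsBSCC (E : V → V → Prop) (C : Set V) : Prop :=
  IsSCC E C ∧ ∀ u ∈ C, ∀ v, E u v → v ∈ C

/-- The maximal number of vertices of an SCC of a finite graph. -/
def maxSCCSize (E : V → V → Prop) : ℕ :=
  sSup {m | ∃ C, IsSCC E C ∧ C.ncard = m}

end Graphs

/-! ### Markov chains -/

/-- A (time-homogeneous, discrete-time) Markov chain on the state space `X`: the initial
distribution, and for each state the distribution of its successor, i.e. the row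
`P(x, ·)` of the transition matrix. -/
structure MarkovChain (X : Type*) where
  init : PMF X
  step : X → PMF X

namespace MarkovChain

variable {X : Type*}

/-- The graph of a Markov chain. -/
def Edge (M : MarkovChain X) (x y : X) : Prop := M.step x y ≠ 0

/-- The smallest positive transition probability (a minimum if `X` is finite). -/
def pmin (M : MarkovChain X) : ℝ :=
  sInf {p : ℝ | 0 < p ∧ ∃ x y, p = (M.step x y).toReal}

/-- The σ-algebra on `ℕ → X` generated by the coordinates, where `X` is discrete. For countable `X`
it is generated by the cones of finite paths. -/
abbrev runSpace (X : Type*) : MeasurableSpace (ℕ → X) :=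
  @MeasurableSpace.pi ℕ (fun _ => X) (fun _ => ⊤)

/-- The transition kernel of the chain, as a kernel from the histories `x 0, …, x k` to the next
state `x (k + 1)`. It depends on `x k` only. -/
def historyKernel (M : MarkovChain X) (k : ℕ) :
    @Kernel (∀ _ : Finset.Iic k, X) X (@MeasurableSpace.pi _ (fun _ => X) (fun _ => ⊤)) ⊤ :=
  letI : MeasurableSpace X := ⊤
  { toFun := fun h => (M.step (h ⟨k, Finset.mem_Iic.2 le_rfl⟩)).toMeasure
    measurable' :=
      (show Measurable (fun x : X => (M.step x).toMeasure) from measurable_from_top).comp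
        (measurable_pi_apply _) }

instance (M : MarkovChain X) (k : ℕ) :
    @IsMarkovKernel _ _ (@MeasurableSpace.pi _ (fun _ => X) (fun _ => ⊤)) ⊤
      (M.historyKernel k) :=
  letI : MeasurableSpace X := ⊤
  ⟨fun h => PMF.toMeasure.isProbabilityMeasure (M.step (h ⟨k, Finset.mem_Iic.2 le_rfl⟩))⟩

/-- The law of the chain: the probability measure on the sequences of states under which the cone
of the finite path `s₀ s₁ … s_k` has probability `init s₀ * ∏ i < k, step s_i s_{i+1}`. -/
def law (M : MarkovChain X) : @Measure (ℕ → X) (runSpace X) :=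
  letI : MeasurableSpace X := ⊤
  Kernel.trajMeasure (X := fun _ => X) M.init.toMeasure M.historyKernel

end MarkovChain

/-! ### Deterministic Rabin automata and the product chain -/

/-- Deterministic Rabin automata with states `Q` over the alphabet `A`; the acceptance condition is
a set of pairs `(E, F)`. -/
structure DRA (A Q : Type*) where
  start : Q
  next : Q → A → Q
  acc : Set (Set Q × Set Q)

namespace DRA

variable {A Q : Type*}

/-- `D.state w i` is the state reached after reading the letters `w 0, …, w i`. -/
def state (D : DRA A Q) (w : ℕ → A) : ℕ → Q
  | 0 => D.next D.start (w 0)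
  | i + 1 => D.next (D.state w i) (w (i + 1))

/-- Rabin acceptance: for some pair `(E, F)`, the run on `w` visits `E` only finitely often and `F`
infinitely often. -/
def Accepts (D : DRA A Q) (w : ℕ → A) : Prop :=
  ∃ p ∈ D.acc, (∀ᶠ i in atTop, D.state w i ∉ p.1) ∧ ∃ᶠ i in atTop, D.state w i ∈ p.2

end DRA

/-- The product of a Markov chain with labelling `L` and a deterministic Rabin automaton. -/
def product {S A Q : Type*} (M : MarkovChain S) (L : S → A) (D : DRA A Q) :
    MarkovChain (S × Q) where
  init := M.init.map fun s => (s, D.next D.start (L s))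
  step := fun x => (M.step x.1).map fun s => (s, D.next x.2 (L s))

/-! ### Candidates and their strength -/

section Paths

variable {V : Type*}

/-- The edges of the graph of a finite path: the pairs of consecutive elements. -/
def pathEdge (π : List V) (u v : V) : Prop := [u, v] <:+: π

/-- `C` is the candidate of `π`: it is the set of states of a suffix of `π`, and a bottom SCC of
the graph of `π`. -/
def IsCandidate (π : List V) (C : Set V) : Prop :=
  (∃ κ, κ <:+ π ∧ {v | v ∈ κ} = C) ∧ IsBSCC (pathEdge π) C

open scoped Classical in
/-- `K(π)`, the candidate of `π`, if there is one (it is unique, since every such set is the SCC of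
the last element of `π`). -/
def candidate (π : List V) : Option (Set V) :=
  if h : ∃ C, IsCandidate π C then some h.choose else none

open scoped Classical in
/-- The part `s κ` of `π = π' s κ`, where `π'` is the shortest prefix such that `K(π' s) = K(π)`. -/
def sinceBirth (π : List V) : List V :=
  π.drop (sInf {j | j < π.length ∧ candidate (π.take (j + 1)) = candidate π})

open scoped Classical in
/-- The strength of a path: `0` if there is no candidate, and otherwise the largest `k` such that
every state of the candidate occurs at least `k` times in `s κ` and the last element of `s κ`
occurs at least `k + 1` times in it. -/
def strength (π : List V) : ℕ :=
  match candidate π with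
  | none => 0
  | some C => sSup {k | (∀ v ∈ C, k ≤ (sinceBirth π).count v) ∧
      ∀ x ∈ (sinceBirth π).getLast?, k + 1 ≤ (sinceBirth π).count x}

open scoped Classical in
/-- The number of candidates seen along `π`: the length of the sequence of the candidates of the
prefixes of `π` (by increasing length) without undefined elements and without repetition of
consecutive elements. -/
def candidateCount (π : List V) : ℕ :=
  ((π.inits.filterMap candidate).destutter (· ≠ ·)).length

end Paths

/-- A set of states of the product is good if for some Rabin pair `(E, F)` it contains no state
with automaton component in `E` and some state with automaton component in `F`. -/
def Good {S A Q : Type*} (D : DRA A Q) (C : Set (S × Q)) : Prop :=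
  ∃ p ∈ D.acc, (∀ x ∈ C, x.2 ∉ p.1) ∧ ∃ x ∈ C, x.2 ∈ p.2

/-- A path of the product is bad if it has a candidate, and this candidate is bad. -/
def BadPath {S A Q : Type*} (D : DRA A Q) (π : List (S × Q)) : Prop :=
  ∃ C, candidate π = some C ∧ ¬ Good D C

/-! ### The bold monitor -/

/-- The condition under which the bold monitor aborts the path `π`: it is bad, and the strength of
its candidate, the `i`-th one, is at least `α (i - log₂ ε)`. -/
def Aborts {S A Q : Type*} (D : DRA A Q) (α ε : ℝ) (π : List (S × Q)) : Prop :=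
  BadPath D π ∧ α * ((candidateCount π : ℝ) - Real.logb 2 ε) ≤ (strength π : ℝ)

open scoped Classical in
/-- The Markov chain of the bold monitor. Its states are the pairs of the current path of the
product chain and the number of resets so far; it starts with the empty path and no reset. A path
that satisfies the abortion condition is reset to the empty path; any other path is extended by the
next state of the product chain. -/
def monitorChain {S A Q : Type*} (M : MarkovChain S) (L : S → A) (D : DRA A Q) (α ε : ℝ) :
    MarkovChain (List (S × Q) × ℕ) where
  init := PMF.pure ([], 0)
  step := fun c =>
    if Aborts D α ε c.1 then PMF.pure ([], c.2 + 1)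
    else match c.1.getLast? with
      | none => (product M L D).init.map fun x => ([x], c.2)
      | some y => ((product M L D).step y).map fun x => (c.1 ++ [x], c.2)

/-- The number of steps of a run of the monitor until its last reset: `∞` if there are infinitely
many resets, `0` if there is none. The resets are counted as steps as well. -/
def stepsToLastReset {P : Type*} (ρ : ℕ → P × ℕ) : ℝ≥0∞ :=
  ⨆ (k : ℕ) (_ : (ρ (k + 1)).2 ≠ (ρ k).2), ((k + 1 : ℕ) : ℝ≥0∞)

end

end BoldMonitor

/-! ### Integrals over the runs of a Markov chain -/
namespace BoldMonitor

noncomputable section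

namespace MarkovChain

variable {X : Type*}

/-! All estimates are made with supersolutions: functions of the current path whose expectation does
not increase in a step. Runs need not be cut into attempts, and nothing is conditioned on.

`T` is at most the number of `k` such that a reset happens in step `k + 1` or later. If `U` bounds
the probability of a further reset, then `E T ≤ ∑ₖ E U(πₖ)`. Let `C` satisfy `U + E C(next) ≤ C`
inside an attempt and `C ≥ 1` where the monitor aborts. With `B = C [] / (1 - U [])`, the function
`W = C + U·B` satisfies `U + E W(next) ≤ W`, even across resets, as `W [] = B`. Hence `E T ≤ B`
(`lintegral_stepsToLastReset_monitorChain_le`).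

Resets. Let `h` be the probability of reaching a good bottom SCC; its initial mean is at least `p_φ`
(`measure_accepts_le`). A candidate that can be left contains a state `s` with `∑_{y ∈ K} P(s,y)
h(y) ≤ (1 - p_min) h(s)` (`exists_exit_state`). So, weighted by success, each visit of `s` stays in
`K` with probability at most `1 - p_min`. Aborting the `i`-th candidate needs at least `α (i - log
ε)` such visits, of weight at most `ε 2^(-i)`. On bad bottom SCCs `h = 0`. Summing over `i` gives `U
[] = 1 - p_φ (1 - ε)` (`exists_reset_potential`).

Duration. A step that yields no candidate visits a new state. A candidate with `m` states is left or
visited `k` times over after about `k m` hitting times, each at most `p^(-1) + … + p^(-(m-1))`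
(`exists_coverage_potential`). There are at most `2n - 1` candidates, because each new one merges
classes of mutually reachable states or is a single state with a new self-loop (`fresh_cases`). The
thresholds `α (j - log ε)`, `1 ≤ j < 2n`, have mean `α (n - log ε)`, so one of the `2n` terms of the
claimed bound is left for the additive and rounding errors (`exists_budget`). -/

lemma lintegral_toMeasure_top [Countable X] (p : PMF X) (f : X → ℝ≥0∞) :
    @lintegral X ⊤ (@PMF.toMeasure X ⊤ p) f = ∑' y, p y * f y := by
  let _ : MeasurableSpace X := ⊤
  rw [lintegral_countable']
  refine tsum_congr fun y => ?_
  rw [PMF.toMeasure_apply_singleton _ _ (measurableSet_singleton y), mul_comm]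

/-- Such a function factors through a countable discrete space of histories, on which everything is
measurable. -/
lemma measurable_of_depends [Countable X] {β : Type*} [MeasurableSpace β] (k : ℕ)
    (F : (ℕ → X) → β) (hF : ∀ ρ ρ', (∀ i ≤ k, ρ i = ρ' i) → F ρ = F ρ') :
    @Measurable _ _ (runSpace X) _ F := by
  let _ : MeasurableSpace X := ⊤
  rcases isEmpty_or_nonempty X with hX | ⟨⟨x₀⟩⟩
  · have : IsEmpty (ℕ → X) := ⟨fun f => hX.elim (f 0)⟩
    exact measurable_of_empty F
  let g : (Finset.Iic k → X) → (ℕ → X) := fun h i =>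
    if hi : i ≤ k then h ⟨i, Finset.mem_Iic.2 hi⟩ else x₀
  have : F = (fun h => F (g h)) ∘ (fun ρ : ℕ → X => fun i : Finset.Iic k => ρ i) := by
    funext ρ
    refine hF _ _ fun i hi => ?_
    simp [g, hi]
  rw [this]
  exact (measurable_of_countable _).comp (measurable_pi_lambda _ fun i => measurable_pi_apply _)

lemma lintegral_law_zero [Countable X] (C : MarkovChain X) (f : X → ℝ≥0∞) :
    @lintegral _ (runSpace X) C.law (fun ρ => f (ρ 0)) = ∑' y, C.init y * f y := by
  let _ : MeasurableSpace X := ⊤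
  have : IsProbabilityMeasure C.init.toMeasure := PMF.toMeasure.isProbabilityMeasure _
  rw [← lintegral_toMeasure_top]
  have hf : Measurable f := measurable_from_top
  have key : C.law.map (Preorder.frestrictLe (π := fun _ => X) 0) =
      C.init.toMeasure.map
        (MeasurableEquiv.piUnique (fun _ : Finset.Iic (0 : ℕ) => X)).symm := by
    rw [law, Kernel.trajMeasure, Measure.map_comp _ _ (by fun_prop),
      Kernel.traj_map_frestrictLe, Kernel.partialTraj_self, Measure.id_comp]
  have h2 := congrArg
    (fun μ => ∫⁻ z, f (z ⟨0, Finset.mem_Iic.2 le_rfl⟩) ∂μ) key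
  rw [lintegral_map (by fun_prop) (by fun_prop), lintegral_map (by fun_prop) (by fun_prop)] at h2
  exact h2

/-- The Markov property: given the history up to time `k`, the next state is integrated out.
Together with the initial distribution, this is all that is used of the construction of the measure.
-/
lemma lintegral_law_succ [Countable X] (C : MarkovChain X) (k : ℕ) (F : (ℕ → X) → X → ℝ≥0∞)
    (hF : ∀ ρ ρ' y, (∀ i ≤ k, ρ i = ρ' i) → F ρ y = F ρ' y) :
    @lintegral _ (runSpace X) C.law (fun ρ => F ρ (ρ (k + 1))) =
      @lintegral _ (runSpace X) C.law (fun ρ => ∑' y, C.step (ρ k) y * F ρ y) := by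
  let _ : MeasurableSpace X := ⊤
  have : IsProbabilityMeasure C.init.toMeasure := PMF.toMeasure.isProbabilityMeasure _
  rcases isEmpty_or_nonempty X with hX | ⟨⟨x₀⟩⟩
  · have : IsEmpty (ℕ → X) := ⟨fun f => hX.elim (f 0)⟩
    simp [Measure.eq_zero_of_isEmpty]
  -- Histories are completed by the irrelevant value `x₀`.
  let g : (Finset.Iic k → X) → (ℕ → X) := fun h i =>
    if hi : i ≤ k then h ⟨i, Finset.mem_Iic.2 hi⟩ else x₀
  have key := Kernel.map_frestrictLe_trajMeasure_compProd_eq_map_trajMeasure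
    (X := fun _ => X) (μ₀ := C.init.toMeasure) (κ := C.historyKernel) (a := k)
  let f : (Finset.Iic k → X) × X → ℝ≥0∞ := fun z => F (g z.1) z.2
  have hf : Measurable f := measurable_of_countable _
  have h1 : ∀ ρ : ℕ → X, ∀ y, F ρ y = f (Preorder.frestrictLe k ρ, y) := by
    intro ρ y
    refine hF _ _ _ fun i hi => ?_
    simp [g, hi]
  have h0 : (fun ρ : ℕ → X => F ρ (ρ (k + 1))) =
      fun ρ => f (Preorder.frestrictLe k ρ, ρ (k + 1)) := funext fun ρ => h1 ρ _
  have h0' : (fun ρ : ℕ → X => ∑' y, C.step (ρ k) y * F ρ y) =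
      fun ρ => ∑' y, C.step (ρ k) y * f (Preorder.frestrictLe k ρ, y) :=
    funext fun ρ => tsum_congr fun y => by rw [h1]
  rw [h0, h0']
  have h2 := congrArg (fun μ => ∫⁻ z, f z ∂μ) key
  rw [lintegral_map hf (by fun_prop), Measure.lintegral_compProd hf,
    lintegral_map hf.lintegral_kernel_prod_right' (by fun_prop)] at h2
  refine h2.symm.trans ?_
  refine lintegral_congr fun ρ => ?_
  exact lintegral_toMeasure_top _ _

/-- The initial distribution and the transition probabilities of `C` describe the process of the
coordinates under `ν`. -/
structure IsLaw (C : MarkovChain X) (ν : @Measure (ℕ → X) (runSpace X)) : Prop where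
  zero : ∀ f : X → ℝ≥0∞, @lintegral _ (runSpace X) ν (fun ρ => f (ρ 0)) = ∑' y, C.init y * f y
  succ : ∀ (k : ℕ) (F : (ℕ → X) → X → ℝ≥0∞),
    (∀ ρ ρ' y, (∀ i ≤ k, ρ i = ρ' i) → F ρ y = F ρ' y) →
    @lintegral _ (runSpace X) ν (fun ρ => F ρ (ρ (k + 1))) =
      @lintegral _ (runSpace X) ν (fun ρ => ∑' y, C.step (ρ k) y * F ρ y)

lemma isLaw_law [Countable X] (C : MarkovChain X) : IsLaw C C.law :=
  ⟨lintegral_law_zero C, lintegral_law_succ C⟩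

/-- A nonnegative process that is adapted and decreases in expectation in each step from time `k₀`
on has decreasing expectations. -/
lemma IsLaw.lintegral_le_of_supersolution {C : MarkovChain X}
    {ν : @Measure (ℕ → X) (runSpace X)} (hν : IsLaw C ν) (k₀ : ℕ) (Z : ℕ → (ℕ → X) → ℝ≥0∞)
    (hZ : ∀ k, k₀ ≤ k → ∀ ρ ρ', (∀ i ≤ k, ρ i = ρ' i) → Z k ρ = Z k ρ')
    (hstep : ∀ k, k₀ ≤ k → ∀ ρ,
      ∑' y, C.step (ρ k) y * Z (k + 1) (Function.update ρ (k + 1) y) ≤ Z k ρ)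
    {k : ℕ} (hk : k₀ ≤ k) :
    @lintegral _ (runSpace X) ν (Z k) ≤ @lintegral _ (runSpace X) ν (Z k₀) := by
  let _ : MeasurableSpace X := ⊤
  induction k, hk using Nat.le_induction with
  | base => exact le_rfl
  | succ k hk ih =>
    refine le_trans ?_ ih
    have h1 : (fun ρ => Z (k + 1) ρ) =
        fun ρ => (fun ρ y => Z (k + 1) (Function.update ρ (k + 1) y)) ρ (ρ (k + 1)) := by
      funext ρ
      simp
    change ∫⁻ ρ, (fun ρ => Z (k + 1) ρ) ρ ∂ν ≤ _
    rw [h1, hν.succ k (fun ρ y => Z (k + 1) (Function.update ρ (k + 1) y))]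
    · exact lintegral_mono fun ρ => hstep k hk ρ
    · intro ρ ρ' y h
      refine hZ _ (by omega) _ _ fun i hi => ?_
      by_cases hik : i = k + 1
      · subst hik; simp
      · simp [hik, h i (by omega)]

end MarkovChain

open MarkovChain

variable {P : Type*}

/-- A reset between times `j` and `j + 1` makes the `j + 1` summands `k = 0, …, j` equal to 1. -/
lemma stepsToLastReset_le_tsum (ρ : ℕ → P × ℕ) :
    stepsToLastReset ρ ≤
      ∑' k : ℕ, Set.indicator {ρ : ℕ → P × ℕ | ∃ j, k ≤ j ∧ (ρ (j + 1)).2 ≠ (ρ j).2} 1 ρ := by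
  refine iSup₂_le fun j hj => ?_
  refine le_trans ?_ (ENNReal.sum_le_tsum (Finset.range (j + 1)))
  rw [Finset.sum_congr rfl (g := fun _ => 1)]
  · simp
  · intro k hk
    rw [Finset.mem_range] at hk
    exact Set.indicator_of_mem (s := {ρ : ℕ → P × ℕ | ∃ j, k ≤ j ∧ (ρ (j + 1)).2 ≠ (ρ j).2})
      ⟨j, by omega, hj⟩ _

/-- The process that equals `U` of the current path and is frozen at 1 after the first reset from
time `k` on decreases in expectation. At time `J` it dominates the indicator of a reset between `k`
and `J`; then `J` tends to infinity. -/
lemma measure_exists_reset_le [Countable P] (C : MarkovChain (P × ℕ)) (U : P → ℝ≥0∞)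
    (hU1 : ∀ c : P × ℕ, ∑' c', C.step c c' * (if c'.2 ≠ c.2 then 1 else U c'.1) ≤ U c.1)
    (k : ℕ) :
    C.law {ρ : ℕ → P × ℕ | ∃ j, k ≤ j ∧ (ρ (j + 1)).2 ≠ (ρ j).2} ≤
      @lintegral _ (runSpace _) C.law (fun ρ => U (ρ k).1) := by
  classical
  let _ : MeasurableSpace (P × ℕ) := ⊤
  let A : ℕ → Set (ℕ → P × ℕ) := fun J => {ρ | ∃ j, k ≤ j ∧ j < J ∧ (ρ (j + 1)).2 ≠ (ρ j).2}
  have hA : {ρ : ℕ → P × ℕ | ∃ j, k ≤ j ∧ (ρ (j + 1)).2 ≠ (ρ j).2} = ⋃ J, A J := by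
    ext ρ
    simp only [Set.mem_ofPred_eq, Set.mem_iUnion, A]
    constructor
    · rintro ⟨j, h1, h2⟩
      exact ⟨j + 1, j, h1, by omega, h2⟩
    · rintro ⟨J, j, h1, h2, h3⟩
      exact ⟨j, h1, h3⟩
  have hmono : Monotone A := by
    rintro J J' hJ ρ ⟨j, h1, h2, h3⟩
    exact ⟨j, h1, by omega, h3⟩
  have hdep : ∀ J ρ ρ', (∀ i ≤ J, ρ i = ρ' i) → (ρ ∈ A J ↔ ρ' ∈ A J) := by
    intro J ρ ρ' h
    simp only [A, Set.mem_ofPred_eq]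
    refine exists_congr fun j => and_congr_right fun _ => and_congr_right fun hj => ?_
    rw [h _ (by omega), h _ (by omega)]
  let Z : ℕ → (ℕ → P × ℕ) → ℝ≥0∞ := fun J ρ => if ρ ∈ A J then 1 else U (ρ J).1
  have hZ : ∀ J, ∀ ρ ρ', (∀ i ≤ J, ρ i = ρ' i) → Z J ρ = Z J ρ' := by
    intro J ρ ρ' h
    simp only [Z, hdep J ρ ρ' h, h J le_rfl]
  have hstep : ∀ J, k ≤ J → ∀ ρ, ∑' y, C.step (ρ J) y * Z (J + 1) (Function.update ρ (J + 1) y)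
      ≤ Z J ρ := by
    intro J hJ ρ
    have hu : ∀ y, Z (J + 1) (Function.update ρ (J + 1) y) =
        if ρ ∈ A J then 1 else if y.2 ≠ (ρ J).2 then 1 else U y.1 := by
      intro y
      have h1 : Function.update ρ (J + 1) y ∈ A (J + 1) ↔ ρ ∈ A J ∨ y.2 ≠ (ρ J).2 := by
        have h2 := hdep J (Function.update ρ (J + 1) y) ρ
          (fun i hi => by rw [Function.update_of_ne (by omega)])
        rw [← h2]
        constructor
        · rintro ⟨j, h1, h2, h3⟩
          rcases Nat.lt_succ_iff_lt_or_eq.1 h2 with h | rfl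
          · exact Or.inl ⟨j, h1, h, h3⟩
          · right
            simpa using h3
        · rintro (⟨j, h1, h2, h3⟩ | h)
          · exact ⟨j, h1, by omega, h3⟩
          · exact ⟨J, hJ, by omega, by simpa using h⟩
      simp only [Z, h1]
      by_cases hρ : ρ ∈ A J <;> by_cases hy : y.2 = (ρ J).2 <;> simp [hρ, hy]
    simp only [hu]
    by_cases hρ : ρ ∈ A J
    · simp [hρ, Z, (C.step (ρ J)).tsum_coe]
    · simp only [hρ, if_false, Z]
      exact hU1 (ρ J)
  rw [hA, hmono.measure_iUnion]
  refine iSup_le fun J => ?_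
  rcases le_total J k with hJ | hJ
  · have : A J = ∅ := by
      ext ρ
      simp only [A, Set.mem_ofPred_eq, Set.mem_empty_iff_false, iff_false]
      rintro ⟨j, h1, h2, -⟩
      omega
    simp [this]
  · have hm : MeasurableSet (A J) := by
      have := measurable_of_depends J (fun ρ => ρ ∈ A J) (fun ρ ρ' h => propext (hdep J ρ ρ' h))
      exact measurableSet_setOfPred.2 this
    have h1 := C.isLaw_law.lintegral_le_of_supersolution k Z (fun J _ => hZ J) hstep hJ
    have h2 : C.law (A J) ≤ ∫⁻ ρ, Z J ρ ∂C.law := by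
      rw [← lintegral_indicator_one hm]
      refine lintegral_mono fun ρ => ?_
      by_cases hρ : ρ ∈ A J <;> simp [hρ, Z]
    refine h2.trans (h1.trans (lintegral_mono fun ρ => ?_))
    have : ρ ∉ A k := by
      rintro ⟨j, h1, h2, -⟩
      omega
    simp [this]

/-- A bound for the expected number of steps until the last reset from a bound `U` for the
probability of another reset and a bound `W` for the expected sum of the values of `U`. -/
theorem lintegral_stepsToLastReset_le [Countable P] (C : MarkovChain (P × ℕ)) (U W : P → ℝ≥0∞)
    (hU : ∀ c : P × ℕ, ∑' c', C.step c c' * (if c'.2 ≠ c.2 then 1 else U c'.1) ≤ U c.1)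
    (hW : ∀ c : P × ℕ, U c.1 + ∑' c', C.step c c' * W c'.1 ≤ W c.1) :
    @lintegral _ (runSpace _) C.law stepsToLastReset ≤ ∑' c, C.init c * W c.1 := by
  let _ : MeasurableSpace (P × ℕ) := ⊤
  have hUm : ∀ k, Measurable fun ρ : ℕ → P × ℕ => U (ρ k).1 := fun k =>
    measurable_of_depends k _ fun ρ ρ' h => by rw [h k le_rfl]
  have hWm : ∀ k, Measurable fun ρ : ℕ → P × ℕ => W (ρ k).1 := fun k =>
    measurable_of_depends k _ fun ρ ρ' h => by rw [h k le_rfl]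
  have hm : ∀ k, MeasurableSet {ρ : ℕ → P × ℕ | ∃ j, k ≤ j ∧ (ρ (j + 1)).2 ≠ (ρ j).2} := by
    intro k
    have : {ρ : ℕ → P × ℕ | ∃ j, k ≤ j ∧ (ρ (j + 1)).2 ≠ (ρ j).2} =
        ⋃ j, {ρ | k ≤ j ∧ (ρ (j + 1)).2 ≠ (ρ j).2} := by
      ext; simp
    rw [this]
    refine MeasurableSet.iUnion fun j => ?_
    have := measurable_of_depends (j + 1)
      (fun ρ : ℕ → P × ℕ => k ≤ j ∧ (ρ (j + 1)).2 ≠ (ρ j).2)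
      (fun ρ ρ' h => by simp only [h (j + 1) le_rfl, h j (by omega)])
    exact measurableSet_setOfPred.2 this
  -- Integrating `hW` at time `K` telescopes.
  have hpart : ∀ K, (∑ k ∈ Finset.range K, ∫⁻ ρ, U (ρ k).1 ∂C.law) + ∫⁻ ρ, W (ρ K).1 ∂C.law ≤
      ∫⁻ ρ, W (ρ 0).1 ∂C.law := by
    intro K
    induction K with
    | zero => simp
    | succ K ih =>
      refine le_trans ?_ ih
      rw [Finset.sum_range_succ, add_assoc]
      gcongr
      rw [lintegral_law_succ C K (fun _ y => W y.1) (fun _ _ _ _ => rfl),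
        ← lintegral_add_left (hUm K)]
      exact lintegral_mono fun ρ => hW (ρ K)
  calc ∫⁻ ρ, stepsToLastReset ρ ∂C.law
      ≤ ∫⁻ ρ, ∑' k : ℕ, Set.indicator
          {ρ : ℕ → P × ℕ | ∃ j, k ≤ j ∧ (ρ (j + 1)).2 ≠ (ρ j).2} 1 ρ ∂C.law :=
        lintegral_mono stepsToLastReset_le_tsum
    _ = ∑' k : ℕ, C.law {ρ : ℕ → P × ℕ | ∃ j, k ≤ j ∧ (ρ (j + 1)).2 ≠ (ρ j).2} := by
        rw [lintegral_tsum fun k => (measurable_one.indicator (hm k)).aemeasurable]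
        exact tsum_congr fun k => lintegral_indicator_one (hm k)
    _ ≤ ∑' k : ℕ, ∫⁻ ρ, U (ρ k).1 ∂C.law :=
        ENNReal.tsum_le_tsum fun k => measure_exists_reset_le C U hU k
    _ ≤ ∫⁻ ρ, W (ρ 0).1 ∂C.law := by
        rw [ENNReal.tsum_eq_iSup_nat]
        exact iSup_le fun K => le_self_add.trans (hpart K)
    _ = ∑' c, C.init c * W c.1 := lintegral_law_zero C fun c => W c.1

/-! ### A criterion for the bold monitor -/

open MarkovChain

lemma tsum_map_mul {X Y : Type*} [Countable X] [Countable Y] (p : PMF X) (f : X → Y)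
    (g : Y → ℝ≥0∞) : ∑' y, (p.map f) y * g y = ∑' x, p x * g (f x) := by
  let _ : MeasurableSpace X := ⊤
  let _ : MeasurableSpace Y := ⊤
  have hf : Measurable f := measurable_from_top
  have hg : Measurable g := measurable_from_top
  rw [← lintegral_toMeasure_top, ← PMF.toMeasure_map _ p hf, lintegral_map hg hf,
    ← lintegral_toMeasure_top]

lemma tsum_pure_mul {Y : Type*} (y : Y) (g : Y → ℝ≥0∞) : ∑' z, (PMF.pure y) z * g z = g y := by
  rw [tsum_eq_single y]
  · simp
  · intro z hz
    simp [hz]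

/-- A sum of products with the weights of a distribution, as a real number. -/
lemma tsum_mul_ofReal_le {X : Type*} [Fintype X] (p : PMF X) (f : X → ℝ≥0∞) (g : X → ℝ)
    (hfg : ∀ x, p x ≠ 0 → 0 ≤ g x ∧ f x = ENNReal.ofReal (g x)) {b : ℝ}
    (hb : ∑ x, (p x).toReal * g x ≤ b) : ∑' x, p x * f x ≤ ENNReal.ofReal b := by
  rw [tsum_fintype]
  have h : ∀ x, p x * f x = ENNReal.ofReal ((p x).toReal * g x) := by
    intro x
    by_cases hx : p x = 0
    · simp [hx]
    · rw [(hfg x hx).2, ENNReal.ofReal_mul ENNReal.toReal_nonneg,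
        ENNReal.ofReal_toReal (p.apply_ne_top x)]
  simp only [h]
  rw [← ENNReal.ofReal_sum_of_nonneg]
  · exact ENNReal.ofReal_le_ofReal hb
  · intro x _
    by_cases hx : p x = 0
    · simp [hx]
    · exact mul_nonneg ENNReal.toReal_nonneg (hfg x hx).1

variable {S Q A : Type*} [Fintype S] [Fintype Q]

open scoped Classical in
/-- A bound for the expected number of steps of the monitor from potential functions `U`, for the
probability of a reset, and `C`, for the expected number of steps of one attempt. -/
theorem lintegral_stepsToLastReset_monitorChain_le (M : MarkovChain S) (L : S → A) (D : DRA A Q)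
    (α ε : ℝ) (Inv : List (S × Q) → Prop) (U C : List (S × Q) → ℝ)
    (hInv0 : Inv [])
    (hInv1 : ∀ x, (product M L D).init x ≠ 0 → Inv [x])
    (hInv2 : ∀ π x y, Inv π → π.getLast? = some x → (product M L D).step x y ≠ 0 →
      Inv (π ++ [y]))
    (hU0 : ∀ π, Inv π → 0 ≤ U π) (hC0 : ∀ π, Inv π → 0 ≤ C π)
    (hUa : ∀ π, Inv π → Aborts D α ε π → U π = 1)
    (hCa : ∀ π, Inv π → Aborts D α ε π → 1 ≤ C π)
    (hUi : ∑ x, ((product M L D).init x).toReal * U [x] ≤ U [])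
    (hCi : U [] + ∑ x, ((product M L D).init x).toReal * C [x] ≤ C [])
    (hUs : ∀ π x, Inv π → ¬ Aborts D α ε π → π.getLast? = some x →
      ∑ y, ((product M L D).step x y).toReal * U (π ++ [y]) ≤ U π)
    (hCs : ∀ π x, Inv π → ¬ Aborts D α ε π → π.getLast? = some x →
      U π + ∑ y, ((product M L D).step x y).toReal * C (π ++ [y]) ≤ C π)
    (hU1 : U [] < 1) :
    ∫⁻ ρ, stepsToLastReset ρ ∂(monitorChain M L D α ε).law ≤
      ENNReal.ofReal (C [] / (1 - U [])) := by
  -- The solution of `B = C [] + U [] * B`: one attempt, and then a fresh start with probability at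
  -- most `U []`.
  set B : ℝ := C [] / (1 - U []) with hB
  have hB0 : 0 ≤ B := div_nonneg (hC0 _ hInv0) (by linarith)
  have hBeq : C [] + U [] * B = B := by
    rw [hB]; field_simp [sub_ne_zero.2 hU1.ne']; ring
  -- The value `⊤` makes the inequalities trivial outside the invariant; transitions of positive
  -- probability do not leave the invariant.
  let U' : List (S × Q) → ℝ≥0∞ := fun π => if Inv π then ENNReal.ofReal (U π) else ⊤
  let W' : List (S × Q) → ℝ≥0∞ := fun π => if Inv π then ENNReal.ofReal (C π + U π * B) else ⊤
  have key := lintegral_stepsToLastReset_le (monitorChain M L D α ε) U' W' ?_ ?_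
  · refine key.trans ?_
    simp only [monitorChain, tsum_pure_mul, W', hInv0, if_true, hBeq, le_refl]
  · rintro ⟨π, r⟩
    by_cases hI : Inv π
    swap
    · simp [U', hI]
    by_cases ha : Aborts D α ε π
    · simp only [monitorChain, ha, if_true, tsum_pure_mul, U', hI]
      simp [hUa π hI ha]
    · simp only [monitorChain, ha, if_false]
      rcases hl : π.getLast? with _ | x
      · obtain rfl : π = [] := by simpa using hl
        simp only [tsum_map_mul, ne_eq, not_true_eq_false, if_false]
        simp only [U', hI, if_true]
        exact tsum_mul_ofReal_le _ _ (fun x => U [x])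
          (fun x hx => ⟨hU0 _ (hInv1 x hx), by simp [hInv1 x hx]⟩) hUi
      · simp only [tsum_map_mul, ne_eq, not_true_eq_false, if_false]
        simp only [U', hI, if_true]
        exact tsum_mul_ofReal_le _ _ (fun y => U (π ++ [y]))
          (fun y hy => ⟨hU0 _ (hInv2 π x y hI hl hy), by simp [hInv2 π x y hI hl hy]⟩)
          (hUs π x hI ha hl)
  · have hWnn : ∀ π, Inv π → 0 ≤ C π + U π * B := fun π hI =>
      add_nonneg (hC0 π hI) (mul_nonneg (hU0 π hI) hB0)
    have aux : ∀ (p : PMF (S × Q)) (g : S × Q → List (S × Q)) (π : List (S × Q)),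
        (∀ x, p x ≠ 0 → Inv (g x)) → Inv π →
        U π + ∑ x, (p x).toReal * C (g x) ≤ C π → ∑ x, (p x).toReal * U (g x) ≤ U π →
        ENNReal.ofReal (U π) + ∑' x, p x * W' (g x) ≤ ENNReal.ofReal (C π + U π * B) := by
      intro p g π hg hI h1 h2
      have h3 : ∑ x, (p x).toReal * (C (g x) + U (g x) * B) ≤ C π + U π * B - U π := by
        have : ∑ x, (p x).toReal * (C (g x) + U (g x) * B) =
            ∑ x, (p x).toReal * C (g x) + (∑ x, (p x).toReal * U (g x)) * B := by
          rw [Finset.sum_mul, ← Finset.sum_add_distrib]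
          exact Finset.sum_congr rfl fun x _ => by ring
        rw [this]
        have := mul_le_mul_of_nonneg_right h2 hB0
        linarith
      have h4 := tsum_mul_ofReal_le p (fun x => W' (g x)) _
        (fun x hx => ⟨hWnn _ (hg x hx), by simp [W', hg x hx]⟩) h3
      have h5 : 0 ≤ C π + U π * B - U π := by
        refine le_trans (Finset.sum_nonneg fun x _ => ?_) h3
        by_cases hx : p x = 0
        · simp [hx]
        · exact mul_nonneg ENNReal.toReal_nonneg (hWnn _ (hg x hx))
      calc _ ≤ ENNReal.ofReal (U π) + ENNReal.ofReal (C π + U π * B - U π) := by gcongr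
        _ = _ := by rw [← ENNReal.ofReal_add (hU0 π hI) h5]; congr 1; ring
    rintro ⟨π, r⟩
    by_cases hI : Inv π
    swap
    · simp [W', hI]
    by_cases ha : Aborts D α ε π
    · simp only [monitorChain, ha, if_true, tsum_pure_mul, U', W', hI, hInv0, hBeq]
      -- The reset step is paid by `1 ≤ C π` and the fresh start by `U π * B = B`.
      rw [hUa π hI ha, ← ENNReal.ofReal_add zero_le_one hB0]
      exact ENNReal.ofReal_le_ofReal (by linarith [hCa π hI ha])
    · simp only [monitorChain, ha, if_false]
      rcases hl : π.getLast? with _ | x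
      · obtain rfl : π = [] := by simpa using hl
        simp only [tsum_map_mul]
        have := aux (product M L D).init (fun x => [x]) [] hInv1 hI hCi hUi
        simpa [U', W', hI] using this
      · simp only [tsum_map_mul]
        have := aux ((product M L D).step x) (fun y => π ++ [y]) π
          (fun y hy => hInv2 π x y hI hl hy) hI (hCs π x hI ha hl) (hUs π x hI ha hl)
        simpa [U', W', hI] using this

/-! ### Candidates of a path that is extended by one state -/

section Candidates

variable {V : Type*}

/-- The vertices that can be reached from `x` by a nonempty path in the graph of `π`. -/
def reach (π : List V) (x : V) : Set V := {v | Relation.TransGen (pathEdge π) x v}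

lemma not_pathEdge_nil (u v : V) : ¬ pathEdge [] u v := by
  simp [pathEdge]

lemma pathEdge_concat {π : List V} {y u v : V} :
    pathEdge (π ++ [y]) u v ↔ pathEdge π u v ∨ (π.getLast? = some u ∧ v = y) := by
  unfold pathEdge
  rw [List.infix_concat_iff, or_comm]
  refine or_congr_right ?_
  constructor
  · rintro ⟨t, ht⟩
    have ht' : (t ++ [u]) ++ [v] = π ++ [y] := by simpa using ht
    obtain ⟨h1, h2⟩ := List.append_inj' ht' rfl
    subst h1
    simpa using h2
  · rintro ⟨h, rfl⟩
    obtain ⟨t, rfl⟩ := List.getLast?_eq_some_iff.1 h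
    exact ⟨t, by simp⟩

lemma pathEdge.mem_left {π : List V} {u v : V} (e : pathEdge π u v) : u ∈ π :=
  List.IsInfix.subset e (by simp)

lemma pathEdge.mem_right {π : List V} {u v : V} (e : pathEdge π u v) : v ∈ π :=
  List.IsInfix.subset e (by simp)

lemma pathEdge_concat_of_pathEdge {π : List V} {y u v : V} (e : pathEdge π u v) :
    pathEdge (π ++ [y]) u v := pathEdge_concat.2 (Or.inl e)

lemma mem_of_mem_reach {π : List V} {x v : V} (h : v ∈ reach π x) : v ∈ π := by
  obtain ⟨w, -, hw⟩ := Relation.TransGen.tail'_iff.1 h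
  exact hw.mem_right

lemma reach_last (π : List V) {x v : V} (hx : π.getLast? = some x) (hv : v ∈ π) :
    Relation.ReflTransGen (pathEdge π) v x := by
  induction π using List.reverseRecOn generalizing x v with
  | nil => simp at hv
  | append_singleton π y ih =>
    obtain rfl : y = x := by simpa using hx
    rw [List.mem_append, List.mem_singleton] at hv
    rcases hv with hv | rfl
    · have hne : π ≠ [] := by rintro rfl; simp at hv
      have hz := List.getLast?_eq_some_getLast hne
      exact (Relation.ReflTransGen.mono (fun _ _ => pathEdge_concat_of_pathEdge) _ _ (ih hz hv)).tail
        (pathEdge_concat.2 (Or.inr ⟨hz, rfl⟩))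
    · exact Relation.ReflTransGen.refl

lemma mem_of_pathEdge_last {π : List V} {x v : V} (h : pathEdge (π ++ [x]) x v) : x ∈ π := by
  rcases pathEdge_concat.1 h with h | ⟨h, -⟩
  · exact h.mem_left
  · exact List.mem_of_getLast? h

lemma self_mem_reach {π : List V} {x : V} (hx : x ∈ π) : x ∈ reach (π ++ [x]) x := by
  have hne : π ≠ [] := by rintro rfl; simp at hx
  have hz := List.getLast?_eq_some_getLast hne
  exact Relation.TransGen.tail'
    (Relation.ReflTransGen.mono (fun _ _ => pathEdge_concat_of_pathEdge) _ _ (reach_last π hz hx))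
    (pathEdge_concat.2 (Or.inr ⟨hz, rfl⟩))

lemma reach_closed {π : List V} {x u v : V} (hu : u ∈ reach π x) (e : pathEdge π u v) :
    v ∈ reach π x := Relation.TransGen.tail hu e

lemma TransGen_mem_of_closed {E : V → V → Prop} {R : Set V} (hR : ∀ u ∈ R, ∀ v, E u v → v ∈ R)
    {u v : V} (hu : u ∈ R) (h : Relation.TransGen E u v) :
    v ∈ R ∧ Relation.TransGen (fun a b => a ∈ R ∧ b ∈ R ∧ E a b) u v := by
  induction h with
  | single h => exact ⟨hR _ hu _ h, Relation.TransGen.single ⟨hu, hR _ hu _ h, h⟩⟩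
  | tail _ h ih => exact ⟨hR _ ih.1 _ h, ih.2.tail ⟨ih.1, hR _ ih.1 _ h, h⟩⟩

/-- A path that has entered a closed set stays in it, so its elements in the set form a suffix. -/
lemma exists_suffix_of_closed (π : List V) (R : Set V)
    (hR : ∀ u ∈ R, ∀ v, pathEdge π u v → v ∈ R) :
    ∃ κ, κ <:+ π ∧ (∀ v ∈ κ, v ∈ R) ∧ ∀ v ∈ π, v ∈ R → v ∈ κ := by
  induction π using List.reverseRecOn with
  | nil => exact ⟨[], by simp⟩
  | append_singleton π y ih =>
    obtain ⟨κ, ⟨t, rfl⟩, h2, h3⟩ := ih fun u hu v e => hR u hu v (pathEdge_concat_of_pathEdge e)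
    by_cases hy : y ∈ R
    · refine ⟨κ ++ [y], ⟨t, by simp⟩, ?_, ?_⟩
      · intro v hv
        rcases List.mem_append.1 hv with h | h
        · exact h2 v h
        · rw [List.mem_singleton.1 h]; exact hy
      · intro v hv hvR
        rcases List.mem_append.1 hv with h | h
        · exact List.mem_append_left _ (h3 v h hvR)
        · exact List.mem_append_right _ h
    · rcases List.eq_nil_or_concat' κ with rfl | ⟨κ', z, rfl⟩
      · refine ⟨[], by simp, by simp, ?_⟩
        intro v hv hvR
        rcases List.mem_append.1 hv with h | h
        · exact h3 v h hvR
        · rw [List.mem_singleton.1 h] at hvR; exact absurd hvR hy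
      · refine absurd (hR z (h2 z (by simp)) y (pathEdge_concat.2 (Or.inr ⟨by simp, rfl⟩))) hy

/-- Every vertex of a path leads to the last one, `x`. Hence the set reachable from `x`, which is
closed, is strongly connected, and it contains `x` exactly if `x` has occurred before. The later
facts on candidates rest on this description. -/
lemma isCandidate_concat {π : List V} {x : V} {C : Set V} :
    IsCandidate (π ++ [x]) C ↔ x ∈ π ∧ C = reach (π ++ [x]) x := by
  constructor
  · rintro ⟨⟨κ, hκ, rfl⟩, ⟨⟨hne, hmax⟩, hbot⟩⟩
    have hx : x ∈ {v | v ∈ κ} := by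
      rcases List.suffix_concat_iff.1 hκ with rfl | ⟨t, rfl, -⟩
      · obtain ⟨v, hv⟩ := hne
        simp at hv
      · simp
    have hsub : {v | v ∈ κ} ⊆ reach (π ++ [x]) x := fun v hv =>
      Relation.TransGen.mono (fun _ _ h => h.2.2) _ _ (hmax.prop x hx v hv)
    refine ⟨?_, hsub.antisymm fun v hv => (TransGen_mem_of_closed hbot hx hv).1⟩
    obtain ⟨w, hw, -⟩ := Relation.TransGen.head'_iff.1 (hsub hx)
    exact mem_of_pathEdge_last hw
  · rintro ⟨hx, rfl⟩
    have hcl : ∀ u ∈ reach (π ++ [x]) x, ∀ v, pathEdge (π ++ [x]) u v → v ∈ reach (π ++ [x]) x :=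
      fun u hu v e => reach_closed hu e
    have hsc : StronglyConnectedOn (pathEdge (π ++ [x])) (reach (π ++ [x]) x) := by
      intro u hu v hv
      refine (TransGen_mem_of_closed hcl hu ?_).2
      exact Relation.TransGen.trans_right (reach_last _ (by simp) (mem_of_mem_reach hu)) hv
    refine ⟨?_, ⟨⟨x, self_mem_reach hx⟩, ⟨hsc, ?_⟩⟩, hcl⟩
    · obtain ⟨κ, h1, h2, h3⟩ := exists_suffix_of_closed _ _ hcl
      exact ⟨κ, h1, Set.ext fun v => ⟨h2 v, fun hv => h3 v (mem_of_mem_reach hv) hv⟩⟩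
    · intro D hD hle v hv
      exact Relation.TransGen.mono (fun _ _ h => h.2.2) _ _ (hD x (hle (self_mem_reach hx)) v hv)

lemma candidate_nil : candidate ([] : List V) = none := by
  rw [candidate, dif_neg]
  rintro ⟨C, -, ⟨⟨⟨x, hx⟩, hmax⟩, -⟩⟩
  obtain ⟨w, hw, -⟩ := Relation.TransGen.head'_iff.1 (hmax.prop x hx x hx)
  exact not_pathEdge_nil _ _ hw.2.2

open scoped Classical in
lemma candidate_concat (π : List V) (x : V) :
    candidate (π ++ [x]) = if x ∈ π then some (reach (π ++ [x]) x) else none := by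
  by_cases hx : x ∈ π
  · have h : ∃ C, IsCandidate (π ++ [x]) C := ⟨_, isCandidate_concat.2 ⟨hx, rfl⟩⟩
    rw [candidate, dif_pos h, if_pos hx]
    exact congrArg some (isCandidate_concat.1 h.choose_spec).2
  · rw [candidate, dif_neg, if_neg hx]
    rintro ⟨C, hC⟩
    exact hx (isCandidate_concat.1 hC).1

lemma candidate_concat_eq_none {π : List V} {x : V} :
    candidate (π ++ [x]) = none ↔ x ∉ π := by
  classical
  rw [candidate_concat]
  split_ifs with h <;> simp [h]

lemma candidate_concat_eq_some {π : List V} {x : V} {K : Set V} :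
    candidate (π ++ [x]) = some K ↔ x ∈ π ∧ K = reach (π ++ [x]) x := by
  classical
  rw [candidate_concat]
  split_ifs with h <;> simp [h, eq_comm]

lemma exists_concat_of_candidate {π : List V} {K : Set V} (h : candidate π = some K) :
    ∃ π' x, π = π' ++ [x] ∧ x ∈ π' ∧ K = reach π x := by
  rcases List.eq_nil_or_concat' π with rfl | ⟨π', x, rfl⟩
  · rw [candidate_nil] at h; cases h
  · obtain ⟨h1, h2⟩ := candidate_concat_eq_some.1 h
    exact ⟨π', x, rfl, h1, h2⟩

lemma isCandidate_of_candidate {π : List V} {K : Set V} (h : candidate π = some K) :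
    IsCandidate π K := by
  obtain ⟨π', x, rfl, hx, rfl⟩ := exists_concat_of_candidate h
  exact isCandidate_concat.2 ⟨hx, rfl⟩

lemma last_mem_candidate {π : List V} {K : Set V} (h : candidate π = some K) {x : V}
    (hx : π.getLast? = some x) : x ∈ K := by
  obtain ⟨π', x', rfl, hx', rfl⟩ := exists_concat_of_candidate h
  obtain rfl : x' = x := by simpa using hx
  exact self_mem_reach hx'

lemma candidate_closed {π : List V} {K : Set V} (h : candidate π = some K) :
    ∀ u ∈ K, ∀ v, pathEdge π u v → v ∈ K := (isCandidate_of_candidate h).2.2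

lemma candidate_stronglyConnectedOn {π : List V} {K : Set V} (h : candidate π = some K) :
    StronglyConnectedOn (pathEdge π) K := (isCandidate_of_candidate h).2.1.2.prop

/-- The new edge starts and ends in `K`, so `K` stays closed, and it is still what can be reached
from the last state. -/
lemma candidate_concat_of_mem {π : List V} {K : Set V} (h : candidate π = some K) {y : V}
    (hy : y ∈ K) : candidate (π ++ [y]) = some K := by
  obtain ⟨π', x, hπ, hx, rfl⟩ := exists_concat_of_candidate h
  have hlast : π.getLast? = some x := by simp [hπ]
  have hyπ : y ∈ π := mem_of_mem_reach hy
  rw [candidate_concat_eq_some]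
  refine ⟨hyπ, Set.Subset.antisymm ?_ ?_⟩
  · intro v hv
    exact Relation.TransGen.mono (fun _ _ => pathEdge_concat_of_pathEdge) _ _
      (Relation.TransGen.trans_right (reach_last π hlast hyπ) hv)
  · intro v hv
    refine (TransGen_mem_of_closed (R := reach π x) ?_ hy hv).1
    intro u hu w e
    rcases pathEdge_concat.1 e with e | ⟨-, rfl⟩
    · exact reach_closed hu e
    · exact hy

lemma candidate_append_of_mem {π τ : List V} {K : Set V} (h : candidate π = some K)
    (hτ : ∀ v ∈ τ, v ∈ K) : candidate (π ++ τ) = some K := by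
  induction τ using List.reverseRecOn with
  | nil => simpa using h
  | append_singleton τ y ih =>
    rw [← List.append_assoc]
    exact candidate_concat_of_mem (ih fun v hv => hτ v (by simp [hv])) (hτ y (by simp))

lemma mem_of_closed_append {π τ : List V} {K : Set V} {x : V} (hx : π.getLast? = some x)
    (hxK : x ∈ K) (hK : ∀ u ∈ K, ∀ v, pathEdge (π ++ τ) u v → v ∈ K) : ∀ v ∈ τ, v ∈ K := by
  induction τ using List.reverseRecOn with
  | nil => simp
  | append_singleton τ y ih =>
    rw [← List.append_assoc] at hK
    have ih' := ih fun u hu v e => hK u hu v (pathEdge_concat_of_pathEdge e)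
    have hy : y ∈ K := by
      rcases List.eq_nil_or_concat' τ with rfl | ⟨τ', z, rfl⟩
      · exact hK x hxK y (pathEdge_concat.2 (Or.inr ⟨by simpa using hx, rfl⟩))
      · exact hK z (ih' z (by simp)) y
          (pathEdge_concat.2 (Or.inr ⟨by simp, rfl⟩))
    intro v hv
    rcases List.mem_append.1 hv with h | h
    · exact ih' v h
    · rw [List.mem_singleton.1 h]; exact hy

/-- A candidate that is replaced by something else does not come back. -/
lemma candidate_prefix_ne {π ρ : List V} {y : V} {K : Set V} (h : candidate (π ++ [y]) = some K)
    (hπ : candidate π ≠ some K) (hρ : ρ <+: π) : candidate ρ ≠ some K := by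
  rintro hc
  obtain ⟨τ, rfl⟩ := hρ
  obtain ⟨ρ', x, hρ', -, -⟩ := exists_concat_of_candidate hc
  have hx : ρ.getLast? = some x := by simp [hρ']
  -- `K` is closed even in the graph of the longer path, so after `ρ` the path never left `K`, and
  -- `K` would still be the candidate of `π`.
  refine hπ (candidate_append_of_mem hc ?_)
  refine mem_of_closed_append hx (last_mem_candidate hc hx) ?_
  exact fun u hu v e => candidate_closed h u hu v (pathEdge_concat_of_pathEdge e)

/-! #### The part since the birth of the candidate -/

/-- By `candidate_prefix_ne` no shorter prefix has the candidate `K`. -/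
lemma sinceBirth_concat_of_fresh {π : List V} {y : V} {K : Set V}
    (h : candidate (π ++ [y]) = some K) (hπ : candidate π ≠ some K) :
    sinceBirth (π ++ [y]) = [y] := by
  have : sInf {j | j < (π ++ [y]).length ∧
      candidate ((π ++ [y]).take (j + 1)) = candidate (π ++ [y])} = π.length := by
    refine le_antisymm (Nat.sInf_le ⟨by simp, by rw [List.take_of_length_le (by simp)]⟩) ?_
    refine le_csInf ⟨π.length, by simp, by rw [List.take_of_length_le (by simp)]⟩ ?_
    rintro j ⟨-, hj2⟩
    by_contra hlt
    rw [List.take_append_of_le_length (by omega), h] at hj2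
    exact candidate_prefix_ne h hπ (List.take_prefix _ _) hj2
  rw [sinceBirth, this]
  simp

lemma sinceBirth_concat_of_mem {π : List V} {y : V} {K : Set V}
    (h : candidate π = some K) (hy : y ∈ K) :
    sinceBirth (π ++ [y]) = sinceBirth π ++ [y] := by
  have h' := candidate_concat_of_mem h hy
  have hne : π ≠ [] := by rintro rfl; rw [candidate_nil] at h; cases h
  have hlen : 0 < π.length := List.length_pos_of_ne_nil hne
  set s := {j | j < π.length ∧ candidate (π.take (j + 1)) = candidate π} with hs
  have hmem : π.length - 1 ∈ s := ⟨by omega, by rw [List.take_of_length_le (by omega)]⟩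
  have hinf := Nat.sInf_mem ⟨_, hmem⟩
  have : sInf {j | j < (π ++ [y]).length ∧
      candidate ((π ++ [y]).take (j + 1)) = candidate (π ++ [y])} = sInf s := by
    refine le_antisymm (Nat.sInf_le ?_) (le_csInf ?_ ?_)
    · refine ⟨by simpa using hinf.1.trans (Nat.lt_succ_self _), ?_⟩
      have := hinf.1
      rw [List.take_append_of_le_length (by omega), hinf.2, h, h']
    · exact ⟨π.length, by simp, by rw [List.take_of_length_le (by simp)]⟩
    · rintro j ⟨-, hj⟩
      by_cases hjl : j < π.length
      · refine Nat.sInf_le ⟨hjl, ?_⟩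
        rwa [List.take_append_of_le_length (by omega), h', ← h] at hj
      · exact (Nat.sInf_le hmem).trans (by omega)
  rw [sinceBirth, this, sinceBirth, List.drop_append_of_le_length hinf.1.le]

/-! #### The number of candidates -/

lemma length_destutter'_concat {β : Type*} [DecidableEq β]
    [DecidableRel fun a b : β => a ≠ b] (l : List β) (a c : β) :
    ((l ++ [c]).destutter' (· ≠ ·) a).length =
      (l.destutter' (· ≠ ·) a).length + if (a :: l).getLast? = some c then 0 else 1 := by
  induction l generalizing a with
  | nil => by_cases h : a = c <;> simp [h, List.destutter']
  | cons b l ih =>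
    by_cases h : a = b
    · subst h
      simp only [List.cons_append, List.destutter'_cons, ne_eq, not_true_eq_false, if_false]
      rw [ih]
      simp [List.getLast?_cons_cons]
    · simp only [List.cons_append, List.destutter'_cons, ne_eq, h, not_false_eq_true, if_true,
        List.length_cons]
      rw [ih]
      simp [List.getLast?_cons_cons]
      omega

lemma length_destutter_concat {β : Type*} [DecidableEq β]
    [DecidableRel fun a b : β => a ≠ b] (l : List β) (c : β) :
    ((l ++ [c]).destutter (· ≠ ·)).length =
      (l.destutter (· ≠ ·)).length + if l.getLast? = some c then 0 else 1 := by
  cases l with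
  | nil => simp
  | cons a l => exact length_destutter'_concat l a c

lemma filterMap_inits_concat {β : Type*} (f : List V → Option β) (π : List V) (y : V) :
    (π ++ [y]).inits.filterMap f = π.inits.filterMap f ++ (f (π ++ [y])).toList := by
  rw [List.inits_append]
  cases h : f (π ++ [y]) <;> simp [h]

lemma candidateCount_concat_of_none {π : List V} {y : V} (h : candidate (π ++ [y]) = none) :
    candidateCount (π ++ [y]) = candidateCount π := by
  simp [candidateCount, h]

lemma candidateCount_concat_of_mem {π : List V} {y : V} {K : Set V}
    (h : candidate π = some K) (hy : y ∈ K) :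
    candidateCount (π ++ [y]) = candidateCount π := by
  obtain ⟨π', x, hπ, -, -⟩ := exists_concat_of_candidate h
  classical
  rw [candidateCount, filterMap_inits_concat, candidate_concat_of_mem h hy, candidateCount]
  rw [Option.toList_some, length_destutter_concat, if_pos, add_zero]
  subst hπ
  simp [h]

lemma candidateCount_concat_of_fresh {π : List V} {y : V} {K : Set V}
    (h : candidate (π ++ [y]) = some K) (hπ : candidate π ≠ some K) :
    candidateCount (π ++ [y]) = candidateCount π + 1 := by
  classical
  rw [candidateCount, filterMap_inits_concat, h, candidateCount]
  rw [Option.toList_some, length_destutter_concat, if_neg]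
  intro hl
  obtain ⟨ρ, hρ, hρK⟩ := List.mem_filterMap.1 (List.mem_of_getLast? hl)
  exact candidate_prefix_ne h hπ ((List.mem_inits _ _).1 hρ) hρK

lemma candidateCount_nil : candidateCount ([] : List V) = 0 := by
  simp [candidateCount, candidate_nil]

/-! #### Strongly connected classes, self-loops and unvisited vertices -/

/-- Mutual reachability in the graph of a path. -/
def mutualReach (π : List V) : Setoid V where
  r u v := Relation.ReflTransGen (pathEdge π) u v ∧ Relation.ReflTransGen (pathEdge π) v u
  iseqv := ⟨fun _ => ⟨.refl, .refl⟩, fun h => ⟨h.2, h.1⟩,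
    fun h h' => ⟨h.1.trans h'.1, h'.2.trans h.2⟩⟩

/-- The number of classes of mutually reachable vertices. -/
def classCount (π : List V) : ℕ := Nat.card (Quotient (mutualReach π))

/-- The number of vertices with a self-loop. -/
def loopCount (π : List V) : ℕ := {v | pathEdge π v v}.ncard

/-- The number of vertices that do not occur in the path. -/
def unvisited (π : List V) : ℕ := {v | v ∉ π}.ncard

lemma mutualReach_le_concat (π : List V) (y : V) : mutualReach π ≤ mutualReach (π ++ [y]) :=
  fun _ _ h => ⟨Relation.ReflTransGen.mono (fun _ _ => pathEdge_concat_of_pathEdge) _ _ h.1,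
    Relation.ReflTransGen.mono (fun _ _ => pathEdge_concat_of_pathEdge) _ _ h.2⟩

lemma card_quotient_le_of_le [Finite V] {r s : Setoid V} (h : r ≤ s) :
    Nat.card (Quotient s) ≤ Nat.card (Quotient r) :=
  Nat.card_le_card_of_surjective (Quotient.map' id h)
    fun q => Quotient.inductionOn' q fun v => ⟨Quotient.mk'' v, rfl⟩

lemma card_quotient_lt_of_le [Finite V] {r s : Setoid V} (h : r ≤ s) {u v : V} (h1 : s u v)
    (h2 : ¬ r u v) : Nat.card (Quotient s) < Nat.card (Quotient r) := by
  classical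
  have := Fintype.ofFinite (Quotient r)
  have := Fintype.ofFinite (Quotient s)
  rw [Nat.card_eq_fintype_card, Nat.card_eq_fintype_card]
  refine Fintype.card_lt_of_surjective_not_injective (Quotient.map' id h)
    (fun q => Quotient.inductionOn' q fun v => ⟨Quotient.mk'' v, rfl⟩) fun hinj => h2 ?_
  exact Quotient.exact (hinj (a₁ := Quotient.mk'' u) (a₂ := Quotient.mk'' v) (Quotient.sound h1))

lemma classCount_concat_le [Finite V] (π : List V) (y : V) : classCount (π ++ [y]) ≤ classCount π :=
  card_quotient_le_of_le (mutualReach_le_concat π y)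

lemma loopCount_le_concat [Finite V] (π : List V) (y : V) : loopCount π ≤ loopCount (π ++ [y]) :=
  Set.ncard_le_ncard (fun _ h => pathEdge_concat_of_pathEdge h) (Set.toFinite _)

lemma loopCount_le [Finite V] (π : List V) : loopCount π ≤ Nat.card V := Set.ncard_le_card _

lemma unvisited_concat_le [Finite V] (π : List V) (y : V) : unvisited (π ++ [y]) ≤ unvisited π :=
  Set.ncard_le_ncard (fun v (hv : v ∉ π ++ [y]) (h : v ∈ π) => hv (by simp [h])) (Set.toFinite _)

lemma unvisited_concat_of_notMem [Finite V] {π : List V} {y : V} (hy : y ∉ π) :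
    unvisited (π ++ [y]) + 1 = unvisited π := by
  have : {v | v ∉ π} = insert y {v | v ∉ π ++ [y]} := by
    ext v
    by_cases h : v = y
    · subst h; simpa using hy
    · simp [h]
  rw [unvisited, unvisited, this, Set.ncard_insert_of_notMem (by simp) (Set.toFinite _)]

lemma unvisited_nil : unvisited ([] : List V) = Nat.card V := by
  simp [unvisited, Set.ncard_univ]

lemma classCount_nil : classCount ([] : List V) = Nat.card V := by
  refine Nat.card_congr (Equiv.ofBijective (Quotient.mk _) ⟨fun u v h => ?_, ?_⟩).symm
  · have := (Quotient.exact h).1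
    rcases Relation.ReflTransGen.cases_head this with h | ⟨w, hw, -⟩
    · exact h
    · exact absurd hw (not_pathEdge_nil _ _)
  · exact Quotient.mk_surjective

lemma classCount_pos [Finite V] [Nonempty V] (π : List V) : 1 ≤ classCount π := by
  have : Nonempty (Quotient (mutualReach π)) := Nonempty.map (Quotient.mk _) inferInstance
  exact Nat.card_pos

/-- A new candidate either merges classes or is a single vertex with a new self-loop. -/
lemma fresh_cases [Finite V] {π : List V} {y : V} {K : Set V}
    (h : candidate (π ++ [y]) = some K) (hπ : candidate π ≠ some K) :
    classCount (π ++ [y]) < classCount π ∨ (K = {y} ∧ loopCount π < loopCount (π ++ [y])) := by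
  obtain ⟨hyπ, hK⟩ := candidate_concat_eq_some.1 h
  rcases List.eq_nil_or_concat' π with rfl | ⟨π', x, hπ'⟩
  · simp at hyπ
  have hlast : π.getLast? = some x := by simp [hπ']
  -- An earlier edge out of `x` means that `x` has occurred before, so that `reach π x` is the
  -- candidate of `π`; if it contained `y`, it would survive the step.
  have hnotcl : ∀ w, pathEdge π x w → y ∉ reach π x := by
    intro w hw hy
    have hx : x ∈ π' := by rw [hπ'] at hw; exact mem_of_pathEdge_last hw
    have hc : candidate π = some (reach π x) := by
      subst hπ'; exact candidate_concat_eq_some.2 ⟨hx, rfl⟩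
    have h2 := candidate_concat_of_mem hc hy
    rw [h] at h2
    rw [hc] at hπ
    exact hπ h2.symm
  have hnew : pathEdge (π ++ [y]) x y := pathEdge_concat.2 (Or.inr ⟨hlast, rfl⟩)
  by_cases hxy : x = y
  · subst hxy
    right
    have hx : ∀ w, ¬ pathEdge π x w := by
      intro w hw
      refine hnotcl w hw ?_
      have hx : x ∈ π' := by rw [hπ'] at hw; exact mem_of_pathEdge_last hw
      rw [hπ']; exact self_mem_reach hx
    refine ⟨?_, ?_⟩
    · rw [hK]
      refine Set.Subset.antisymm ?_ ?_
      · intro v hv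
        refine (TransGen_mem_of_closed (R := {x}) ?_ rfl hv).1
        rintro u rfl w e
        rcases pathEdge_concat.1 e with e | ⟨-, rfl⟩
        · exact absurd e (hx w)
        · rfl
      · rintro v rfl
        exact Relation.TransGen.single hnew
    · refine Set.ncard_lt_ncard ⟨fun _ h => pathEdge_concat_of_pathEdge h, fun hsub => ?_⟩
        (Set.toFinite _)
      exact hx x (hsub hnew)
  · left
    -- The edge from `x` to `y` closes a cycle, because `y` has occurred before and the path leads
    -- from it to `x`.
    refine card_quotient_lt_of_le (mutualReach_le_concat π y) (u := x) (v := y) ?_ ?_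
    · exact ⟨.single hnew,
        Relation.ReflTransGen.mono (fun _ _ => pathEdge_concat_of_pathEdge) _ _ (reach_last π hlast hyπ)⟩
    · rintro ⟨h1, -⟩
      rcases Relation.reflTransGen_iff_eq_or_transGen.1 h1 with rfl | h1
      · exact hxy rfl
      · obtain ⟨w, hw, -⟩ := Relation.TransGen.head'_iff.1 h1
        exact hnotcl w hw h1

lemma fresh_or_mem_or_new (π : List V) (y : V) :
    (∃ K, candidate π = some K ∧ y ∈ K) ∨ (candidate (π ++ [y]) = none ∧ y ∉ π) ∨
      ∃ K, candidate (π ++ [y]) = some K ∧ candidate π ≠ some K := by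
  rcases hc : candidate (π ++ [y]) with _ | K
  · exact Or.inr (Or.inl ⟨rfl, candidate_concat_eq_none.1 hc⟩)
  · by_cases h : candidate π = some K
    · exact Or.inl ⟨K, h, last_mem_candidate hc (by simp)⟩
    · exact Or.inr (Or.inr ⟨K, rfl, h⟩)

/-- A new candidate lowers the number of classes or raises the number of loops, and neither number
ever moves the other way. As there is at least one class and there are at most `|V|` loops, at most
`2|V| - 1` candidates occur. -/
lemma candidateCount_add_classCount_le [Finite V] (π : List V) :
    candidateCount π + classCount π ≤ Nat.card V + loopCount π := by
  induction π using List.reverseRecOn with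
  | nil => simp [candidateCount_nil, classCount_nil]
  | append_singleton π y ih =>
    have h1 := classCount_concat_le π y
    have h2 := loopCount_le_concat π y
    rcases fresh_or_mem_or_new π y with ⟨K, hK, hy⟩ | ⟨h, -⟩ | ⟨K, hK, hπ⟩
    · rw [candidateCount_concat_of_mem hK hy]; omega
    · rw [candidateCount_concat_of_none h]; omega
    · rw [candidateCount_concat_of_fresh hK hπ]
      rcases fresh_cases hK hπ with h | ⟨-, h⟩ <;> omega

lemma candidateCount_lt [Finite V] [Nonempty V] (π : List V) : candidateCount π + 1 ≤ 2 * Nat.card V := by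
  have h1 := candidateCount_add_classCount_le π
  have h2 := classCount_pos π
  have h3 := loopCount_le π
  omega

end Candidates

/-! ### Expected hitting times in finite Markov chains -/

namespace MarkovChain

variable {V : Type*}

/-- The transition probabilities as real numbers. -/
def prob (M : MarkovChain V) (x y : V) : ℝ := (M.step x y).toReal

lemma prob_nonneg (M : MarkovChain V) (x y : V) : 0 ≤ M.prob x y := ENNReal.toReal_nonneg

lemma prob_eq_zero_iff (M : MarkovChain V) {x y : V} : M.prob x y = 0 ↔ ¬ M.Edge x y := by
  simp [prob, Edge, ENNReal.toReal_eq_zero_iff, (M.step x).apply_ne_top y]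

lemma sum_toReal_eq_one [Fintype V] (p : PMF V) : ∑ y, (p y).toReal = 1 := by
  rw [← ENNReal.toReal_sum fun y _ => p.apply_ne_top y, ← tsum_fintype (L := .unconditional V),
    p.tsum_coe, ENNReal.toReal_one]

lemma sum_prob [Fintype V] (M : MarkovChain V) (x : V) : ∑ y, M.prob x y = 1 :=
  sum_toReal_eq_one (M.step x)

lemma exists_edge (M : MarkovChain V) (x : V) : ∃ y, M.Edge x y := by
  obtain ⟨y, hy⟩ := (M.step x).support_nonempty
  exact ⟨y, (PMF.mem_support_iff _ _).1 hy⟩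

lemma prob_le_one (M : MarkovChain V) (x y : V) : M.prob x y ≤ 1 :=
  ENNReal.toReal_le_of_le_ofReal zero_le_one (by simpa using (M.step x).coe_le_one y)

end MarkovChain

/-- `∑ j ∈ [1, r], p ^ (-j)`. -/
def invGeomSum (p : ℝ) (r : ℕ) : ℝ := ∑ j ∈ Finset.range r, (1 / p) ^ (j + 1)

lemma invGeomSum_zero (p : ℝ) : invGeomSum p 0 = 0 := by simp [invGeomSum]

/-- `invGeomSum p r` is the expected waiting time for `r` successes in a row, each of probability
`p`; this is the recursion for these times. -/
lemma mul_invGeomSum_succ {p : ℝ} (hp : 0 < p) (r : ℕ) :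
    p * invGeomSum p (r + 1) = 1 + invGeomSum p r := by
  rw [invGeomSum, Finset.sum_range_succ', mul_add, Finset.mul_sum, invGeomSum, add_comm]
  congr 1
  · simp [hp.ne']
  · refine Finset.sum_congr rfl fun j _ => ?_
    rw [pow_succ (1 / p) (j + 1)]
    field_simp

lemma invGeomSum_mono {p : ℝ} (hp : 0 < p) : Monotone (invGeomSum p) := by
  refine monotone_nat_of_le_succ fun r => ?_
  rw [invGeomSum, invGeomSum, Finset.sum_range_succ]
  have : 0 < (1 / p) ^ (r + 1) := by positivity
  linarith

lemma invGeomSum_nonneg {p : ℝ} (hp : 0 < p) (r : ℕ) : 0 ≤ invGeomSum p r := by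
  rw [← invGeomSum_zero p]
  exact invGeomSum_mono hp (Nat.zero_le r)

/-- If every nonempty subset of `A` can be left, then there is a rank function for leaving `A`. -/
lemma exists_rank {V : Type*} (E : V → V → Prop) (A : Finset V)
    (h : ∀ B ⊆ A, B.Nonempty → ∃ x ∈ B, ∃ y, y ∉ B ∧ E x y) :
    ∃ d : V → ℕ, (∀ x ∈ A, 1 ≤ d x ∧ d x ≤ A.card) ∧
      ∀ x ∈ A, ∃ y, E x y ∧ (y ∉ A ∨ d y < d x) := by
  classical
  induction hn : A.card generalizing A with
  | zero =>
    rw [Finset.card_eq_zero] at hn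
    subst hn
    exact ⟨0, by simp⟩
  | succ n ih =>
    -- A state with an edge out of `A` gets rank 1, and the ranks for the rest of `A` are shifted by
    -- one.
    obtain ⟨x, hx, y, hy, hxy⟩ := h A (Finset.Subset.refl _) (Finset.card_pos.1 (by omega))
    obtain ⟨d, h1, h2⟩ := ih (A.erase x) (fun B hB => h B (hB.trans (Finset.erase_subset _ _)))
      (by rw [Finset.card_erase_of_mem hx]; omega)
    refine ⟨fun z => if z = x then 1 else d z + 1, ?_, ?_⟩
    · intro z hz
      by_cases hzx : z = x
      · simp [hzx]
      · have := h1 z (Finset.mem_erase.2 ⟨hzx, hz⟩)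
        simp only [hzx, if_false]
        omega
    · intro z hz
      by_cases hzx : z = x
      · subst hzx
        exact ⟨y, hxy, Or.inl hy⟩
      · have hz' := Finset.mem_erase.2 ⟨hzx, hz⟩
        obtain ⟨w, hw, hw'⟩ := h2 z hz'
        refine ⟨w, hw, ?_⟩
        by_cases hwx : w = x
        · right
          have := (h1 z hz').1
          simp only [hwx, hzx, if_true, if_false]
          omega
        · rcases hw' with hw' | hw'
          · left
            exact fun hwA => hw' (Finset.mem_erase.2 ⟨hwx, hwA⟩)
          · right
            simp only [hwx, hzx, if_false]
            omega

/-- Otherwise `B` would be closed inside `K`, and strong connectivity would put `t` into it. -/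
lemma exists_leaving_edge {V : Type*} {E : V → V → Prop} {K : Set V} (hK : StronglyConnectedOn E K)
    {B : Set V} (hBK : B ⊆ K) (hB : B.Nonempty) {t : V} (ht : t ∈ K) (htB : t ∉ B) :
    ∃ x ∈ B, ∃ y, y ∉ B ∧ y ∈ K ∧ E x y := by
  by_contra! hcon
  obtain ⟨u, hu⟩ := hB
  refine htB ?_
  exact (TransGen_mem_of_closed (E := fun a b => a ∈ K ∧ b ∈ K ∧ E a b) (R := B)
    (fun a ha b hab => by_contra fun hb => hcon a ha b hb hab.2.1 hab.2.2) hu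
    (hK u (hBK hu) t ht)).1

variable {V : Type*} [Fintype V]

/-- A bound for the expected time until `A` is left. -/
lemma exists_exit_potential (M : MarkovChain V) {p : ℝ} (hp : 0 < p)
    (hM : ∀ x y, M.Edge x y → p ≤ M.prob x y) (A : Finset V)
    (h : ∀ B ⊆ A, B.Nonempty → ∃ x ∈ B, ∃ y, y ∉ B ∧ M.Edge x y) :
    ∃ H : V → ℝ, (∀ x, 0 ≤ H x) ∧ (∀ x, H x ≤ invGeomSum p A.card) ∧ (∀ x, x ∉ A → H x = 0) ∧
      ∀ x ∈ A, 1 + ∑ y, M.prob x y * H y ≤ H x := by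
  classical
  obtain ⟨d, h1, h2⟩ := exists_rank M.Edge A h
  set D := A.card
  -- The value at rank `r`: the expected time to `D` successes in a row when `D - r` of them have
  -- been achieved.
  let g : ℕ → ℝ := fun r => invGeomSum p D - invGeomSum p (D - r)
  have hg0 : ∀ r, 0 ≤ g r := fun r => sub_nonneg.2 (invGeomSum_mono hp (Nat.sub_le _ _))
  have hg1 : ∀ r, g r ≤ invGeomSum p D := fun r => sub_le_self _ (invGeomSum_nonneg hp _)
  let H : V → ℝ := fun x => if x ∈ A then g (d x) else 0
  have hH1 : ∀ x, H x ≤ invGeomSum p D := by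
    intro x
    by_cases hx : x ∈ A
    · simpa [H, hx] using hg1 _
    · simpa [H, hx] using invGeomSum_nonneg hp _
  refine ⟨H, ?_, hH1, ?_, ?_⟩
  · intro x
    by_cases hx : x ∈ A
    · simpa [H, hx] using hg0 _
    · simp [H, hx]
  · intro x hx
    simp [H, hx]
  · intro x hx
    obtain ⟨y, hxy, hy⟩ := h2 x hx
    have hd := h1 x hx
    have hHy : H y ≤ g (d x - 1) := by
      by_cases hyA : y ∈ A
      · have hlt : d y < d x := hy.resolve_left (not_not.2 hyA)
        simp only [H, hyA, if_true, g]
        have := invGeomSum_mono hp (show D - (d x - 1) ≤ D - d y by omega)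
        linarith
      · simpa [H, hyA] using hg0 _
    -- Only the successor `y` of lower rank is estimated individually; all others get the maximal
    -- value, as after a failure.
    have hsum : ∑ z, M.prob x z * H z ≤
        invGeomSum p D - M.prob x y * (invGeomSum p D - g (d x - 1)) := by
      have h3 : ∑ z, M.prob x z * (invGeomSum p D - H z) ≥
          M.prob x y * (invGeomSum p D - H y) :=
        Finset.single_le_sum (f := fun z => M.prob x z * (invGeomSum p D - H z))
          (fun z _ => mul_nonneg (M.prob_nonneg _ _) (sub_nonneg.2 (hH1 z))) (Finset.mem_univ y)
      have h4 : ∑ z, M.prob x z * (invGeomSum p D - H z) =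
          invGeomSum p D - ∑ z, M.prob x z * H z := by
        simp only [mul_sub, Finset.sum_sub_distrib, ← Finset.sum_mul, M.sum_prob, one_mul]
      have h5 : M.prob x y * (invGeomSum p D - g (d x - 1)) ≤
          M.prob x y * (invGeomSum p D - H y) :=
        mul_le_mul_of_nonneg_left (by linarith) (M.prob_nonneg _ _)
      linarith
    have h6 : invGeomSum p D - g (d x - 1) = invGeomSum p (D - d x + 1) := by
      simp only [g, sub_sub_cancel]
      congr 1
      omega
    have h7 : p * invGeomSum p (D - d x + 1) ≤ M.prob x y * invGeomSum p (D - d x + 1) :=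
      mul_le_mul_of_nonneg_right (hM x y hxy) (invGeomSum_nonneg hp _)
    rw [mul_invGeomSum_succ hp] at h7
    rw [h6] at hsum
    simp only [H, hx, if_true, g]
    linarith

/-- Hitting `t` or leaving `K` is leaving `K \ {t}`, and by strong connectivity each nonempty subset
of it has an outgoing edge. -/
lemma exists_hitting_potential (M : MarkovChain V) {p : ℝ} (hp : 0 < p)
    (hM : ∀ x y, M.Edge x y → p ≤ M.prob x y) {K : Set V} (hK : StronglyConnectedOn M.Edge K)
    {t : V} (ht : t ∈ K) :
    ∃ H : V → ℝ, (∀ x, 0 ≤ H x) ∧ (∀ x, H x ≤ invGeomSum p (K.ncard - 1)) ∧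
      (∀ x, x ∉ K ∨ x = t → H x = 0) ∧
      ∀ x ∈ K, x ≠ t → 1 + ∑ y, M.prob x y * H y ≤ H x := by
  classical
  have hcard : (K \ {t}).toFinset.card = K.ncard - 1 := by
    rw [← Set.ncard_eq_toFinset_card', Set.ncard_sdiff_singleton_of_mem ht]
  have hleave : ∀ B ⊆ (K \ {t}).toFinset, B.Nonempty → ∃ x ∈ B, ∃ y, y ∉ B ∧ M.Edge x y := by
    intro B hB hne
    have hB' : (B : Set V) ⊆ K \ {t} := fun x hx => by simpa using hB hx
    obtain ⟨x, hx, y, hy, -, hxy⟩ := exists_leaving_edge hK (B := (B : Set V))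
      (fun x hx => (hB' hx).1) (by simpa using hne) ht (fun h => (hB' h).2 rfl)
    exact ⟨x, hx, y, hy, hxy⟩
  obtain ⟨H, h1, h2, h3, h4⟩ := exists_exit_potential M hp hM (K \ {t}).toFinset hleave
  rw [hcard] at h2
  refine ⟨H, h1, h2, fun x hx => h3 x ?_, fun x hx hxt => h4 x (by simp [hx, hxt])⟩
  rcases hx with hx | hx <;> simp [hx]

/-- Proper subsets of `K` have outgoing edges by strong connectivity, and `K` itself has one by
hypothesis. -/
lemma exists_exit_potential_of_not_closed (M : MarkovChain V) {p : ℝ} (hp : 0 < p)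
    (hM : ∀ x y, M.Edge x y → p ≤ M.prob x y) {K : Set V} (hK : StronglyConnectedOn M.Edge K)
    (hnc : ∃ u ∈ K, ∃ v, v ∉ K ∧ M.Edge u v) :
    ∃ H : V → ℝ, (∀ x, 0 ≤ H x) ∧ (∀ x, H x ≤ invGeomSum p K.ncard) ∧
      (∀ x, x ∉ K → H x = 0) ∧ ∀ x ∈ K, 1 + ∑ y, M.prob x y * H y ≤ H x := by
  classical
  have hleave : ∀ B ⊆ K.toFinset, B.Nonempty → ∃ x ∈ B, ∃ y, y ∉ B ∧ M.Edge x y := by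
    intro B hB hne
    have hB' : (B : Set V) ⊆ K := fun x hx => by simpa using hB hx
    by_cases hBK : (B : Set V) = K
    · obtain ⟨u, hu, v, hv, e⟩ := hnc
      rw [← hBK] at hu hv
      exact ⟨u, hu, v, hv, e⟩
    · obtain ⟨t, ht, htB⟩ := Set.exists_of_ssubset (hB'.ssubset_of_ne hBK)
      obtain ⟨x, hx, y, hy, -, hxy⟩ := exists_leaving_edge hK (B := (B : Set V)) hB'
        (by simpa using hne) ht htB
      exact ⟨x, hx, y, hy, hxy⟩
  obtain ⟨H, h1, h2, h3, h4⟩ := exists_exit_potential M hp hM K.toFinset hleave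
  rw [← Set.ncard_eq_toFinset_card'] at h2
  exact ⟨H, h1, h2, fun x hx => h3 x (by simpa using hx), fun x hx => h4 x (by simpa using hx)⟩

/-- In a strongly connected set that can be left there is a state at which the part of a harmonic
function that stays inside the set is reduced by the factor `1 - p`. -/
lemma exists_exit_state (M : MarkovChain V) {p : ℝ}
    (hM : ∀ x y, M.Edge x y → p ≤ M.prob x y) (h : V → ℝ) (h0 : ∀ x, 0 ≤ h x)
    (hh : ∀ x, h x = ∑ y, M.prob x y * h y) {K : Set V} (hK : StronglyConnectedOn M.Edge K)
    (hnc : ∃ u ∈ K, ∃ v, v ∉ K ∧ M.Edge u v) :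
    ∃ s ∈ K, ∑ y, M.prob s y * K.indicator h y ≤ (1 - p) * h s := by
  classical
  obtain ⟨u, hu, v, hv, huv⟩ := hnc
  -- `t` maximises `h` among the successors outside `K`, and `s` is any predecessor of it in `K`.
  obtain ⟨t, ⟨⟨s, hs, hst⟩, htK⟩, htmax⟩ := Set.exists_max_image
    {t | (∃ s ∈ K, M.Edge s t) ∧ t ∉ K} h (Set.toFinite _) ⟨v, ⟨u, hu, huv⟩, hv⟩
  obtain ⟨z, hz, hzmax⟩ := Set.exists_max_image K h (Set.toFinite _) ⟨u, hu⟩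
  -- Maximum principle: otherwise the states of `K` at which `h` is maximal would be closed under
  -- all edges. By strong connectivity `s` would be among them, and then `t` too, which is outside
  -- `K`.
  have hzt : h z ≤ h t := by
    by_contra! hlt
    have hle : ∀ x ∈ K, ∀ y, M.Edge x y → h y ≤ h z := by
      intro x hx y hxy
      by_cases hy : y ∈ K
      · exact hzmax y hy
      · exact (htmax y ⟨⟨x, hx, hxy⟩, hy⟩).trans hlt.le
    have hB : ∀ x ∈ {x | x ∈ K ∧ h x = h z}, ∀ y, M.Edge x y → y ∈ {x | x ∈ K ∧ h x = h z} := by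
      rintro x ⟨hx, hxz⟩ y hxy
      have hterm : ∀ w, 0 ≤ M.prob x w * (h z - h w) := by
        intro w
        by_cases hw : M.Edge x w
        · exact mul_nonneg (M.prob_nonneg _ _) (sub_nonneg.2 (hle x hx w hw))
        · rw [M.prob_eq_zero_iff.2 hw, zero_mul]
      have hsum : ∑ w, M.prob x w * (h z - h w) = 0 := by
        simp only [mul_sub, Finset.sum_sub_distrib, ← Finset.sum_mul, M.sum_prob, one_mul]
        rw [← hh x, hxz, sub_self]
      have hy := (Finset.sum_eq_zero_iff_of_nonneg fun w _ => hterm w).1 hsum y (Finset.mem_univ y)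
      have hyz : h y = h z := by
        rcases mul_eq_zero.1 hy with h' | h'
        · exact absurd hxy (M.prob_eq_zero_iff.1 h')
        · linarith
      refine ⟨?_, hyz⟩
      by_contra hyK
      have := htmax y ⟨⟨x, hx, hxy⟩, hyK⟩
      linarith
    have hsB : s ∈ {x | x ∈ K ∧ h x = h z} :=
      (TransGen_mem_of_closed hB (⟨hz, rfl⟩ : z ∈ {x | x ∈ K ∧ h x = h z})
        (Relation.TransGen.mono (fun _ _ h => h.2.2) _ _ (hK z hz s hs))).1
    exact htK (hB s hsB t hst).1
  refine ⟨s, hs, ?_⟩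
  have h1 : ∑ y, M.prob s y * K.indicator h y + M.prob s t * h t ≤ h s := by
    rw [hh s, ← Finset.add_sum_erase _ _ (Finset.mem_univ t),
      ← Finset.add_sum_erase _ (fun y => M.prob s y * h y) (Finset.mem_univ t)]
    rw [Set.indicator_of_notMem htK, mul_zero, zero_add, add_comm]
    refine add_le_add_right (Finset.sum_le_sum fun y _ => ?_) _
    exact mul_le_mul_of_nonneg_left (Set.indicator_le_self' (fun x _ => h0 x) y)
      (M.prob_nonneg _ _)
  have h2 : p * h s ≤ M.prob s t * h t :=
    mul_le_mul (hM s t hst) ((hzmax s hs).trans hzt) (h0 s) (M.prob_nonneg _ _)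
  linarith

/-! ### Visiting all states of a strongly connected set several times -/

section RoundRobin

variable {V : Type*}

/-- An enumeration of a finite set `K`, repeated periodically, in which each period ends with
`b`. -/
lemma exists_round_robin [Finite V] {K : Set V} {b : V} (hb : b ∈ K) :
    ∃ tgt : ℕ → V, (∀ j, tgt j ∈ K) ∧ (K.ncard ≠ 1 → tgt 0 ≠ b ∧ ∀ j, tgt (j + 1) ≠ tgt j) ∧
      (∀ k, 1 ≤ k → tgt (k * K.ncard - 1) = b) ∧
      ∀ v ∈ K, ∀ k, ∃ s : Finset ℕ, s.card = k ∧ ∀ j ∈ s, j < k * K.ncard ∧ tgt j = v := by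
  classical
  set m := K.ncard with hm
  have hmpos : 0 < m := (Set.ncard_pos (Set.toFinite K)).2 ⟨b, hb⟩
  -- An arbitrary enumeration is composed with a swap that puts `b` at the end.
  obtain ⟨e, he⟩ : ∃ e : Fin m ≃ K, e ⟨m - 1, by omega⟩ = ⟨b, hb⟩ := by
    let e₀ : Fin m ≃ K := (Finite.equivFinOfCardEq (Nat.card_coe_set_eq K)).symm
    exact ⟨e₀.trans (Equiv.swap (e₀ ⟨m - 1, by omega⟩) ⟨b, hb⟩), by simp⟩
  let tgt : ℕ → V := fun j => e ⟨j % m, Nat.mod_lt _ hmpos⟩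
  have htgt : ∀ i j, tgt i = tgt j → i % m = j % m := by
    intro i j h
    have := e.injective (Subtype.ext h)
    simpa using this
  have hlast : ∀ j, j % m = m - 1 → tgt j = b := by
    intro j hj
    have : e ⟨j % m, Nat.mod_lt _ hmpos⟩ = ⟨b, hb⟩ := by rw [← he]; congr
    simp only [tgt, this]
  refine ⟨tgt, fun j => (e _).2, fun hm1 => ⟨fun h0 => ?_, fun j h => ?_⟩, fun k hk => ?_, ?_⟩
  · have := htgt 0 (m - 1) (h0.trans (hlast (m - 1) (Nat.mod_eq_of_lt (by omega))).symm)
    rw [Nat.mod_eq_of_lt (by omega), Nat.mod_eq_of_lt (by omega)] at this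
    omega
  · have h1 := Nat.sub_mod_eq_zero_of_mod_eq (htgt _ _ h)
    rw [Nat.add_sub_cancel_left] at h1
    have := Nat.le_of_dvd one_pos (Nat.dvd_of_mod_eq_zero h1)
    omega
  · refine hlast _ ?_
    obtain ⟨k, rfl⟩ := Nat.exists_eq_add_of_le' hk
    rw [Nat.add_mul, one_mul, Nat.add_sub_assoc hmpos, add_comm, Nat.add_mul_mod_self_right,
      Nat.mod_eq_of_lt (by omega)]
  · intro v hv k
    obtain ⟨r, hr⟩ := e.surjective ⟨v, hv⟩
    refine ⟨(Finset.range k).image fun i => i * m + r, ?_, ?_⟩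
    · rw [Finset.card_image_of_injective, Finset.card_range]
      intro i i' h
      exact Nat.eq_of_mul_eq_mul_right hmpos (Nat.add_right_cancel h)
    · intro j hj
      obtain ⟨i, hi, rfl⟩ := Finset.mem_image.1 hj
      rw [Finset.mem_range] at hi
      refine ⟨?_, ?_⟩
      · calc i * m + r < i * m + m := by have := r.2; omega
          _ = (i + 1) * m := by ring
          _ ≤ k * m := Nat.mul_le_mul_right _ hi
      · have : (⟨(i * m + r) % m, Nat.mod_lt _ hmpos⟩ : Fin m) = r := by
          ext
          simp [Nat.mod_eq_of_lt r.2]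
        simp only [tgt, this, hr]

open scoped Classical in
/-- The number of targets reached when the targets are waited for one after the other. -/
def pointer (tgt : ℕ → V) (l : List V) : ℕ :=
  l.foldl (fun j v => if v = tgt j then j + 1 else j) 0

open scoped Classical in
lemma pointer_concat (tgt : ℕ → V) (l : List V) (y : V) :
    pointer tgt (l ++ [y]) = if y = tgt (pointer tgt l) then pointer tgt l + 1
      else pointer tgt l := by
  rw [pointer, List.foldl_append]
  rfl

-- Different targets are reached at different positions of the list.
open scoped Classical in
lemma card_le_count_of_lt_pointer (tgt : ℕ → V) (l : List V) (v : V) (s : Finset ℕ)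
    (hs : ∀ j ∈ s, j < pointer tgt l ∧ tgt j = v) : s.card ≤ l.count v := by
  induction l using List.reverseRecOn generalizing s with
  | nil =>
    rw [Finset.card_eq_zero.2 (Finset.eq_empty_of_forall_notMem fun j hj => ?_)]
    · simp
    · simpa [pointer] using (hs j hj).1
  | append_singleton l y ih =>
    rw [pointer_concat] at hs
    rw [List.count_append]
    by_cases hy : y = tgt (pointer tgt l)
    · have h1 := ih (s.erase (pointer tgt l)) fun j hj => by
        obtain ⟨hj1, hj2⟩ := Finset.mem_erase.1 hj
        obtain ⟨h3, h4⟩ := hs j hj2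
        rw [if_pos hy] at h3
        exact ⟨by omega, h4⟩
      by_cases hmem : pointer tgt l ∈ s
      · rw [Finset.card_erase_of_mem hmem] at h1
        have hyv : y = v := hy.trans (hs _ hmem).2
        subst hyv
        simp only [List.count_singleton_self]
        omega
      · rw [Finset.erase_eq_of_notMem hmem] at h1
        omega
    · rw [if_neg hy] at hs
      have := ih s hs
      omega

-- This is why each period ends with `b`, the state in front of `l`. If the last step reaches the
-- last target, it leads to `b`, whose occurrence in front is the additional one. If the last target
-- was reached before, every state has `k` occurrences before the last step, which adds one more.
open scoped Classical in
lemma counts_of_le_pointer {K : Set V} {b : V} {tgt : ℕ → V} {k m : ℕ} (hk : 1 ≤ k) (hm : 1 ≤ m)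
    (hlast : tgt (k * m - 1) = b)
    (hcount : ∀ v ∈ K, ∃ s : Finset ℕ, s.card = k ∧ ∀ j ∈ s, j < k * m ∧ tgt j = v)
    (l : List V) (hl : ∀ v ∈ l, v ∈ K) (hb : b ∈ K) (hp : k * m ≤ pointer tgt l) :
    (∀ v ∈ K, k ≤ (b :: l).count v) ∧
      ∀ x ∈ (b :: l).getLast?, k + 1 ≤ (b :: l).count x := by
  have hcnt : ∀ v ∈ K, ∀ l : List V, k * m ≤ pointer tgt l → k ≤ l.count v := by
    intro v hv l hp
    obtain ⟨s, rfl, hs2⟩ := hcount v hv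
    exact card_le_count_of_lt_pointer tgt l v s fun j hj =>
      ⟨(hs2 j hj).1.trans_le hp, (hs2 j hj).2⟩
  refine ⟨fun v hv => (hcnt v hv l hp).trans (List.count_le_count_cons), ?_⟩
  have hkm : 1 ≤ k * m := Nat.mul_pos hk hm
  rcases List.eq_nil_or_concat' l with rfl | ⟨l, y, rfl⟩
  · simp [pointer] at hp
    omega
  · rintro x hx
    obtain rfl : y = x := by
      rw [← List.cons_append, List.getLast?_concat] at hx
      exact Option.some_injective _ hx
    by_cases hpl : k * m ≤ pointer tgt l
    · have := hcnt y (hl y (by simp)) l hpl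
      rw [← List.cons_append, List.count_append, List.count_singleton_self]
      have := List.count_le_count_cons (a := y) (b := b) (l := l)
      omega
    · rw [pointer_concat] at hp
      by_cases hy : y = tgt (pointer tgt l)
      · rw [if_pos hy] at hp
        have : pointer tgt l = k * m - 1 := by omega
        rw [this, hlast] at hy
        subst hy
        rw [List.count_cons_self]
        have := hcnt y hb (l ++ [y]) (by rw [pointer_concat, if_pos (by rwa [this, eq_comm])]; omega)
        omega
      · rw [if_neg hy] at hp
        omega

/-- A hitting potential satisfies its inequality only away from its target, so the current state
must not be the current target. -/
lemma target_ne_last {b : V} {tgt : ℕ → V} (h0 : tgt 0 ≠ b) (h1 : ∀ j, tgt (j + 1) ≠ tgt j)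
    (l : List V) : ∀ x ∈ (b :: l).getLast?, x ≠ tgt (pointer tgt l) := by
  classical
  rcases List.eq_nil_or_concat' l with rfl | ⟨l, y, rfl⟩
  · simpa [pointer] using h0.symm
  · intro x hx
    obtain rfl : y = x := by
      rw [← List.cons_append, List.getLast?_concat] at hx
      exact Option.some_injective _ hx
    rw [pointer_concat]
    split_ifs with hy
    · rw [hy]; exact fun h => h1 _ (by rw [← hy] at h ⊢; exact h.symm)
    · exact hy

end RoundRobin

variable {V : Type*} [Fintype V]

open scoped Classical in
/-- A bound for the expected time until all states of `K` are visited `k` times or `K` is left. -/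
lemma exists_coverage_potential (M : MarkovChain V) {p : ℝ} (hp : 0 < p)
    (hM : ∀ x y, M.Edge x y → p ≤ M.prob x y) {K : Set V} (hK : StronglyConnectedOn M.Edge K)
    {b : V} (hb : b ∈ K) {k : ℕ} (hk : 1 ≤ k) :
    ∃ Y : List V → ℝ,
      Y [b] ≤ 1 + k * K.ncard * max 1 (invGeomSum p (K.ncard - 1)) ∧ (∀ w, 1 ≤ Y w) ∧
      ∀ l x, (∀ v ∈ l, v ∈ K) → (b :: l).getLast? = some x →
        ¬ ((∀ v ∈ K, k ≤ (b :: l).count v) ∧ ∀ z ∈ (b :: l).getLast?, k + 1 ≤ (b :: l).count z) →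
        1 + ∑ y, M.prob x y * K.indicator (fun y => Y (b :: l ++ [y])) y ≤ Y (b :: l) := by
  obtain ⟨tgt, ht1, ht2, ht3, ht4⟩ := exists_round_robin hb
  set m := K.ncard with hm
  have hmpos : 0 < m := (Set.ncard_pos (Set.toFinite K)).2 ⟨b, hb⟩
  set G := max 1 (invGeomSum p (m - 1)) with hG
  have hG1 : 1 ≤ G := le_max_left _ _
  choose H hH using fun t : K => exists_hitting_potential M hp hM hK t.2
  -- If `K` is a single state, the target is always the current state, and a step must be paid
  -- although the hitting potential is 0. Hence the value 1 here and the `max 1` in the bound.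
  let Hc : ℕ → V → ℝ := fun j x => if x = tgt j then 1 else H ⟨tgt j, ht1 j⟩ x
  have hHc0 : ∀ j x, 0 ≤ Hc j x := by
    intro j x
    simp only [Hc]
    split_ifs
    · exact zero_le_one
    · exact (hH _).1 x
  have hHcG : ∀ j x, Hc j x ≤ G := by
    intro j x
    simp only [Hc]
    split_ifs
    · exact hG1
    · exact ((hH _).2.1 x).trans (le_max_right _ _)
  have hHG : ∀ j x, H ⟨tgt j, ht1 j⟩ x ≤ G := fun j x =>
    ((hH _).2.1 x).trans (le_max_right _ _)
  -- The time to the current target, and `G` for each later one. The leading 1 remains at the end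
  -- and will pay for the reset.
  let Z : ℕ → V → ℝ := fun j x => 1 + (k * m - j - 1 : ℕ) * G + if k * m ≤ j then 0 else Hc j x
  have hZ1 : ∀ j x, 1 ≤ Z j x := by
    intro j x
    have : 0 ≤ ((k * m - j - 1 : ℕ) : ℝ) * G := by positivity
    simp only [Z]
    split_ifs
    · linarith
    · linarith [hHc0 j x]
  have hZ2 : ∀ j x, Z j x ≤ 1 + (k * m - j : ℕ) * G := by
    intro j x
    simp only [Z]
    split_ifs with h
    · rw [Nat.sub_eq_zero_of_le h]; simp
    · have h1 : ((k * m - j : ℕ) : ℝ) = (k * m - j - 1 : ℕ) + 1 := by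
        rw [← Nat.cast_succ]; congr 1; omega
      rw [h1]
      linarith [hHcG j x]
  refine ⟨fun w => Z (pointer tgt w.tail) (w.getLast?.getD b), ?_, fun w => hZ1 _ _, ?_⟩
  · refine (hZ2 _ _).trans ?_
    simp [pointer]
  · intro l x hl hx hcond
    have hptr : pointer tgt l < k * m := by
      by_contra! hge
      exact hcond (counts_of_le_pointer hk hmpos (ht3 k hk) (fun v hv => ht4 v hv k) l hl hb hge)
    set j := pointer tgt l with hj
    have hxK : x ∈ K := by
      rcases List.mem_cons.1 (List.mem_of_getLast? hx) with rfl | h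
      · exact hb
      · exact hl x h
    simp only [List.tail_cons, hx, Option.getD_some, List.cons_append]
    rw [← hj]
    have hZx : Z j x = 1 + (k * m - j - 1 : ℕ) * G + Hc j x := by
      simp only [Z, if_neg (not_le.2 hptr)]
    have hnext : ∀ y, K.indicator
        (fun y => Z (pointer tgt (l ++ [y])) ((b :: (l ++ [y])).getLast?.getD b)) y ≤
        1 + (k * m - j - 1 : ℕ) * G + H ⟨tgt j, ht1 j⟩ y := by
      intro y
      have h0 : 0 ≤ H ⟨tgt j, ht1 j⟩ y := (hH _).1 y
      have h1 : 0 ≤ ((k * m - j - 1 : ℕ) : ℝ) * G := by positivity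
      by_cases hy : y ∈ K
      · rw [Set.indicator_of_mem hy, pointer_concat, ← hj]
        have hlast : (b :: (l ++ [y])).getLast?.getD b = y := by
          rw [← List.cons_append, List.getLast?_concat, Option.getD_some]
        rw [hlast]
        by_cases hyt : y = tgt j
        · rw [if_pos hyt]
          refine (hZ2 _ _).trans ?_
          rw [Nat.sub_add_eq]
          linarith
        · rw [if_neg hyt]
          simp only [Z, if_neg (not_le.2 hptr), Hc, if_neg hyt, le_refl]
      · rw [Set.indicator_of_notMem hy]
        linarith
    have hdrift : 1 + ∑ y, M.prob x y * H ⟨tgt j, ht1 j⟩ y ≤ Hc j x := by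
      by_cases hxt : x = tgt j
      · have hm1 : m = 1 := by
          by_contra hne
          exact target_ne_last (ht2 hne).1 (ht2 hne).2 l x hx hxt
        obtain ⟨a, ha⟩ := Set.ncard_eq_one.1 (hm ▸ hm1)
        have hz : ∀ y, H ⟨tgt j, ht1 j⟩ y = 0 := by
          intro y
          refine (hH ⟨tgt j, ht1 j⟩).2.2.1 y ?_
          by_cases hy : y ∈ K
          · refine Or.inr ?_
            have hta := ht1 j
            rw [ha, Set.mem_singleton_iff] at hy hta
            exact hy.trans hta.symm
          · exact Or.inl hy
        simp [hz, Hc, hxt]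
      · simp only [Hc, if_neg hxt]
        exact (hH ⟨tgt j, ht1 j⟩).2.2.2 x hxK hxt
    have hsum : ∑ y, M.prob x y * K.indicator
        (fun y => Z (pointer tgt (l ++ [y])) ((b :: (l ++ [y])).getLast?.getD b)) y ≤
        ∑ y, M.prob x y * (1 + (k * m - j - 1 : ℕ) * G + H ⟨tgt j, ht1 j⟩ y) :=
      Finset.sum_le_sum fun y _ => mul_le_mul_of_nonneg_left (hnext y) (M.prob_nonneg _ _)
    simp only [mul_add, Finset.sum_add_distrib, ← Finset.sum_mul, M.sum_prob, one_mul, mul_one]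
      at hsum
    rw [hZx]
    linarith

/-! ### Limit behaviour of finite Markov chains -/

open MarkovChain

section Harmonic

variable {V : Type*} [Fintype V]

/-- The probability of reaching a closed set of states. -/
lemma exists_harmonic (M : MarkovChain V) (G : Set V) (hG : ∀ x ∈ G, ∀ y, M.Edge x y → y ∈ G) :
    ∃ h : V → ℝ, (∀ x, 0 ≤ h x) ∧ (∀ x, h x ≤ 1) ∧ (∀ x, h x = ∑ y, M.prob x y * h y) ∧
      (∀ x ∈ G, h x = 1) ∧
      ∀ B : Set V, (∀ x ∈ B, ∀ y, M.Edge x y → y ∈ B) → Disjoint B G → ∀ x ∈ B, h x = 0 := by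
  classical
  -- The probability of being in `G` after `n` steps. It increases with `n` because `G` is closed,
  -- and its limit is the required function.
  let f : ℕ → V → ℝ := fun n =>
    (fun g x => ∑ y, M.prob x y * g y)^[n] (G.indicator 1)
  have hsucc : ∀ n x, f (n + 1) x = ∑ y, M.prob x y * f n y := fun n x => by
    simp only [f, Function.iterate_succ_apply']
  have hzero : ∀ x, f 0 x = G.indicator 1 x := fun x => rfl
  have h01 : ∀ n x, 0 ≤ f n x ∧ f n x ≤ 1 := by
    intro n
    induction n with
    | zero =>
      intro x
      by_cases hx : x ∈ G <;> simp [hzero, hx]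
    | succ n ih =>
      intro x
      rw [hsucc]
      refine ⟨Finset.sum_nonneg fun y _ => mul_nonneg (M.prob_nonneg _ _) (ih y).1, ?_⟩
      rw [← M.sum_prob x]
      exact Finset.sum_le_sum fun y _ =>
        mul_le_of_le_one_right (M.prob_nonneg _ _) (ih y).2
  have hG1 : ∀ n, ∀ x ∈ G, f n x = 1 := by
    intro n
    induction n with
    | zero => intro x hx; simp [hzero, hx]
    | succ n ih =>
      intro x hx
      rw [hsucc, ← M.sum_prob x]
      refine Finset.sum_congr rfl fun y _ => ?_
      by_cases hy : M.Edge x y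
      · rw [ih y (hG x hx y hy), mul_one]
      · rw [M.prob_eq_zero_iff.2 hy, zero_mul]
  have hmono : ∀ n x, f n x ≤ f (n + 1) x := by
    intro n
    induction n with
    | zero =>
      intro x
      by_cases hx : x ∈ G
      · rw [hG1 0 x hx, hG1 1 x hx]
      · rw [hzero, Set.indicator_of_notMem hx]
        exact (h01 1 x).1
    | succ n ih =>
      intro x
      rw [hsucc, hsucc (n + 1)]
      exact Finset.sum_le_sum fun y _ => mul_le_mul_of_nonneg_left (ih y) (M.prob_nonneg _ _)
  have hbdd : ∀ x, BddAbove (Set.range fun n => f n x) := fun x =>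
    ⟨1, by rintro _ ⟨n, rfl⟩; exact (h01 n x).2⟩
  have hlim : ∀ x, Tendsto (fun n => f n x) atTop (nhds (⨆ n, f n x)) := fun x =>
    tendsto_atTop_ciSup (monotone_nat_of_le_succ fun n => hmono n x) (hbdd x)
  refine ⟨fun x => ⨆ n, f n x, ?_, ?_, ?_, ?_, ?_⟩
  · exact fun x => ge_of_tendsto' (hlim x) fun n => (h01 n x).1
  · exact fun x => le_of_tendsto' (hlim x) fun n => (h01 n x).2
  · intro x
    refine tendsto_nhds_unique ((hlim x).comp (tendsto_add_atTop_nat 1)) ?_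
    simp only [Function.comp_def, hsucc]
    exact tendsto_finsetSum _ fun y _ => (hlim y).const_mul _
  · intro x hx
    simp [hG1 _ x hx]
  · intro B hB hd x hx
    have : ∀ n, ∀ x ∈ B, f n x = 0 := by
      intro n
      induction n with
      | zero => intro x hx; simp [hzero, hd.notMem_of_mem_left hx]
      | succ n ih =>
        intro x hx
        rw [hsucc]
        refine Finset.sum_eq_zero fun y _ => ?_
        by_cases hy : M.Edge x y
        · rw [ih y (hB x hx y hy), mul_zero]
        · rw [M.prob_eq_zero_iff.2 hy, zero_mul]
    simp [this _ x hx]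

end Harmonic

/-! ### Bottom SCCs and closed sets -/

section BSCC

variable {V : Type*}

lemma isBSCC_of_closed {E : V → V → Prop} {K : Set V} (hne : K.Nonempty)
    (hsc : StronglyConnectedOn E K) (hcl : ∀ u ∈ K, ∀ v, E u v → v ∈ K) : IsBSCC E K := by
  refine ⟨⟨hne, hsc, fun D hD hle v hv => ?_⟩, hcl⟩
  obtain ⟨u, hu⟩ := hne
  exact (TransGen_mem_of_closed hcl hu
    (Relation.TransGen.mono (fun _ _ h => h.2.2) _ _ (hD u (hle hu) v hv))).1

lemma IsBSCC.subset_of_mem {E : V → V → Prop} {B K : Set V} (hB : IsBSCC E B)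
    (hK : ∀ u ∈ K, ∀ v, E u v → v ∈ K) {x : V} (hxB : x ∈ B) (hxK : x ∈ K) : B ⊆ K := fun v hv =>
  (TransGen_mem_of_closed hK hxK
    (Relation.TransGen.mono (fun _ _ h => h.2.2) _ _ (hB.1.2.prop x hxB v hv))).1

/-- A minimal nonempty closed set is strongly connected: what can be reached from one of its
vertices is again nonempty and closed. -/
lemma exists_isBSCC_subset [Finite V] {E : V → V → Prop} (hE : ∀ u, ∃ v, E u v) {I : Set V}
    (hne : I.Nonempty) (hI : ∀ u ∈ I, ∀ v, E u v → v ∈ I) : ∃ B ⊆ I, IsBSCC E B := by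
  obtain ⟨B, hBI, hB⟩ := Finite.exists_le_minimal
    (p := fun C : Set V => C.Nonempty ∧ ∀ u ∈ C, ∀ v, E u v → v ∈ C) ⟨hne, hI⟩
  refine ⟨B, hBI, isBSCC_of_closed hB.prop.1 ?_ hB.prop.2⟩
  intro u hu v hv
  refine (TransGen_mem_of_closed hB.prop.2 hu ?_).2
  refine hB.le_of_le (y := {w | Relation.TransGen E u w}) ⟨?_, fun w hw z e => hw.tail e⟩ ?_ hv
  · obtain ⟨w, hw⟩ := hE u
    exact ⟨w, .single hw⟩
  · exact fun w hw => (TransGen_mem_of_closed hB.prop.2 hu hw).1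

end BSCC

/-! ### Almost sure long-run behaviour -/

section Limit

variable {V : Type*} {M : MarkovChain V} {ν : @Measure (ℕ → V) (runSpace V)}

lemma MarkovChain.IsLaw.measure_univ (hν : IsLaw M ν) : ν Set.univ = 1 := by
  let _ : MeasurableSpace V := ⊤
  have h := hν.zero fun _ => 1
  simpa only [lintegral_const, one_mul, mul_one, M.init.tsum_coe] using h

variable [Fintype V]

lemma MarkovChain.IsLaw.ae_edge (hν : IsLaw M ν) :
    ∀ᵐ ρ ∂ν, ∀ k, M.Edge (ρ k) (ρ (k + 1)) := by
  classical
  let _ : MeasurableSpace V := ⊤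
  rw [ae_all_iff]
  intro k
  have h := hν.succ k (fun ρ y => if M.Edge (ρ k) y then 0 else 1)
    (fun ρ ρ' y h => by simp only [h k le_rfl])
  have h0 : ∀ ρ : ℕ → V, ∑' y, M.step (ρ k) y * (if M.Edge (ρ k) y then 0 else 1) = 0 := by
    intro ρ
    rw [ENNReal.tsum_eq_zero]
    intro y
    by_cases hy : M.Edge (ρ k) y
    · simp [hy]
    · have : M.step (ρ k) y = 0 := not_not.1 hy
      simp [this]
  simp only [h0, lintegral_zero] at h
  rw [lintegral_eq_zero_iff (measurable_of_depends (k + 1) _ fun ρ ρ' h => by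
    rw [h k (by omega), h (k + 1) le_rfl])] at h
  filter_upwards [h] with ρ hρ
  by_contra hc
  simp [hc] at hρ

lemma tsum_ite_eq_one_sub {X : Type*} [DecidableEq X] (p : PMF X) (y : X) (c : ℝ≥0∞) :
    ∑' z, p z * (if z = y then 0 else c) = (1 - p y) * c := by
  have h : ∑' z, (if z = y then 0 else p z) = 1 - p y := by
    have := ENNReal.tsum_eq_add_tsum_ite (f := p) y
    rw [p.tsum_coe] at this
    rw [this, ENNReal.add_sub_cancel_left (p.apply_ne_top y)]
    exact tsum_congr fun z => by split_ifs <;> rfl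
  rw [← h, ← ENNReal.tsum_mul_right]
  refine tsum_congr fun z => ?_
  split_ifs <;> simp

/-- Each visit of `x` is followed by `y` with probability `P(x,y)`, so `k` visits without `y` have
probability at most `(1 - P(x,y))^k`. The supersolution is `q` to the number of visits missing to
`k`, and 0 once `y` has been hit. -/
lemma MarkovChain.IsLaw.measure_visit_and_avoid (hν : IsLaw M ν) {x y : V} (hxy : M.Edge x y) (N : ℕ) :
    ν {ρ | (∃ᶠ n in atTop, ρ n = x) ∧ ∀ n, N ≤ n → ρ n ≠ y} = 0 := by
  classical
  let _ : MeasurableSpace V := ⊤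
  set q : ℝ≥0∞ := 1 - M.step x y with hq
  have hq1 : q < 1 := ENNReal.sub_lt_self ENNReal.one_ne_top one_ne_zero hxy
  -- Visits strictly before time `n`: a visit counts once the step after it is made.
  let cnt : ℕ → (ℕ → V) → ℕ := fun n ρ => ((Finset.Ico N n).filter fun j => ρ j = x).card
  have hcnt : ∀ n ρ ρ', (∀ i < n, ρ i = ρ' i) → cnt n ρ = cnt n ρ' := by
    intro n ρ ρ' h
    refine congrArg Finset.card (Finset.filter_congr fun j hj => ?_)
    rw [h j (Finset.mem_Ico.1 hj).2]
  have key : ∀ k, ν {ρ | (∃ᶠ n in atTop, ρ n = x) ∧ ∀ n, N ≤ n → ρ n ≠ y} ≤ q ^ k := by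
    intro k
    let Z : ℕ → (ℕ → V) → ℝ≥0∞ := fun n ρ =>
      if ∃ j, N ≤ j ∧ j ≤ n ∧ ρ j = y then 0 else q ^ (k - cnt n ρ)
    have hZ : ∀ n, ∀ ρ ρ', (∀ i ≤ n, ρ i = ρ' i) → Z n ρ = Z n ρ' := by
      intro n ρ ρ' h
      have h1 : (∃ j, N ≤ j ∧ j ≤ n ∧ ρ j = y) ↔ ∃ j, N ≤ j ∧ j ≤ n ∧ ρ' j = y :=
        exists_congr fun j => and_congr_right fun _ => and_congr_right fun hj => by rw [h j hj]
      simp only [Z, h1, hcnt n ρ ρ' fun i hi => h i hi.le]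
    have hstep : ∀ n, N ≤ n → ∀ ρ, ∑' z, M.step (ρ n) z * Z (n + 1) (Function.update ρ (n + 1) z)
        ≤ Z n ρ := by
      intro n hn ρ
      have hc : ∀ z, cnt (n + 1) (Function.update ρ (n + 1) z) =
          cnt n ρ + if ρ n = x then 1 else 0 := by
        intro z
        rw [hcnt (n + 1) _ ρ fun i hi => Function.update_of_ne (by omega) _ _]
        simp only [cnt]
        rw [← Finset.insert_Ico_right_eq_Ico_add_one hn, Finset.filter_insert]
        split_ifs
        · rw [Finset.card_insert_of_notMem (by simp)]
        · rfl
      have he : ∀ z, (∃ j, N ≤ j ∧ j ≤ n + 1 ∧ Function.update ρ (n + 1) z j = y) ↔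
          (∃ j, N ≤ j ∧ j ≤ n ∧ ρ j = y) ∨ z = y := by
        intro z
        constructor
        · rintro ⟨j, h1, h2, h3⟩
          by_cases hj : j = n + 1
          · subst hj
            right
            simpa using h3
          · left
            exact ⟨j, h1, by omega, by rwa [Function.update_of_ne hj] at h3⟩
        · rintro (⟨j, h1, h2, h3⟩ | rfl)
          · exact ⟨j, h1, by omega, by rwa [Function.update_of_ne (by omega)]⟩
          · exact ⟨n + 1, by omega, le_rfl, by simp⟩
      simp only [Z, hc, he]
      by_cases hhit : ∃ j, N ≤ j ∧ j ≤ n ∧ ρ j = y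
      · simp [hhit]
      · simp only [hhit, false_or, if_false]
        rw [tsum_ite_eq_one_sub]
        by_cases hx : ρ n = x
        · rw [if_pos hx, hx, ← hq]
          by_cases hk : cnt n ρ < k
          · rw [← pow_succ']
            exact le_of_eq (congrArg (q ^ ·) (by omega))
          · rw [Nat.sub_eq_zero_of_le (by omega), Nat.sub_eq_zero_of_le (by omega)]
            simpa using hq1.le
        · rw [if_neg hx, add_zero]
          exact mul_le_of_le_one_left zero_le tsub_le_self
    have hbase : ∫⁻ ρ, Z N ρ ∂ν ≤ q ^ k := by
      calc ∫⁻ ρ, Z N ρ ∂ν ≤ ∫⁻ _, q ^ k ∂ν := by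
            refine lintegral_mono fun ρ => ?_
            simp only [Z, cnt, Finset.Ico_self, Finset.filter_empty, Finset.card_empty, Nat.sub_zero]
            split_ifs <;> simp
        _ = q ^ k := by rw [lintegral_const, hν.measure_univ, mul_one]
    let B : ℕ → Set (ℕ → V) := fun n => {ρ | k ≤ cnt n ρ ∧ ∀ m, N ≤ m → ρ m ≠ y}
    have hBmono : Monotone B := by
      intro n n' hn ρ hρ
      refine ⟨hρ.1.trans (Finset.card_le_card ?_), hρ.2⟩
      exact Finset.filter_subset_filter _ (Finset.Ico_subset_Ico_right hn)
    have hsub : {ρ : ℕ → V | (∃ᶠ n in atTop, ρ n = x) ∧ ∀ n, N ≤ n → ρ n ≠ y} ⊆ ⋃ n, B n := by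
      rintro ρ ⟨h1, h2⟩
      have hinf : {j | N ≤ j ∧ ρ j = x}.Infinite := by
        rw [← Nat.frequently_atTop_iff_infinite]
        exact (h1.and_eventually (eventually_ge_atTop N)).mono fun n hn => ⟨hn.2, hn.1⟩
      obtain ⟨t, ht, htc⟩ := hinf.exists_subset_card_eq k
      refine Set.mem_iUnion.2 ⟨t.sup id + 1, ?_, h2⟩
      rw [← htc]
      refine Finset.card_le_card fun j hj => ?_
      have := ht hj
      have h3 : j ≤ t.sup id := Finset.le_sup (f := id) hj
      exact Finset.mem_filter.2 ⟨Finset.mem_Ico.2 ⟨this.1, by omega⟩, this.2⟩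
    refine (measure_mono hsub).trans ?_
    rw [hBmono.measure_iUnion]
    refine iSup_le fun n => ?_
    refine (measure_mono (hBmono (le_max_left n N))).trans ?_
    have hle := (hν.lintegral_le_of_supersolution N Z (fun n _ => hZ n) hstep
      (le_max_right n N)).trans hbase
    refine le_trans ?_ hle
    have hmk := mul_meas_ge_le_lintegral (μ := ν)
      (measurable_of_depends (max n N) _ (hZ (max n N))) 1
    rw [one_mul] at hmk
    refine (measure_mono ?_).trans hmk
    rintro ρ ⟨h1, h2⟩
    change 1 ≤ Z (max n N) ρ
    have : ¬ ∃ j, N ≤ j ∧ j ≤ max n N ∧ ρ j = y := by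
      rintro ⟨j, h3, -, h4⟩
      exact h2 j h3 h4
    simp only [Z, this, if_false, Nat.sub_eq_zero_of_le h1, pow_zero, le_refl]
  refine le_antisymm ?_ zero_le
  exact ge_of_tendsto' (ENNReal.tendsto_pow_atTop_nhds_zero_of_lt_one hq1) key

/-- Almost surely the set of states visited infinitely often is a bottom SCC that is eventually
not left. -/
lemma MarkovChain.IsLaw.ae_exists_isBSCC (hν : IsLaw M ν) :
    ∀ᵐ ρ ∂ν, ∃ B, IsBSCC M.Edge B ∧ (∀ᶠ n in atTop, ρ n ∈ B) ∧
      ∀ x ∈ B, ∃ᶠ n in atTop, ρ n = x := by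
  let _ : MeasurableSpace V := ⊤
  have h2 : ∀ᵐ ρ ∂ν, ∀ x y, M.Edge x y → ∀ N,
      ¬ ((∃ᶠ n in atTop, ρ n = x) ∧ ∀ n, N ≤ n → ρ n ≠ y) := by
    rw [ae_all_iff]; intro x
    rw [ae_all_iff]; intro y
    by_cases hxy : M.Edge x y
    · simp only [hxy, true_imp_iff]
      rw [ae_all_iff]; intro N
      rw [ae_iff]
      simpa using hν.measure_visit_and_avoid hxy N
    · simp [hxy]
  filter_upwards [hν.ae_edge, h2] with ρ h1 h2
  -- The states visited infinitely often form a closed set. It contains a bottom SCC, which is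
  -- visited and then never left.
  let I : Set V := {x | ∃ᶠ n in atTop, ρ n = x}
  have hIne : I.Nonempty := by
    by_contra hemp
    have : ∀ x, ∀ᶠ n in atTop, ρ n ≠ x := by
      intro x
      have : x ∉ I := fun hx => hemp ⟨x, hx⟩
      exact not_frequently.1 this
    obtain ⟨n, hn⟩ := (eventually_all.2 this).exists
    exact hn _ rfl
  have hIcl : ∀ u ∈ I, ∀ v, M.Edge u v → v ∈ I := by
    intro u hu v huv
    by_contra hv
    obtain ⟨N, hN⟩ := eventually_atTop.1 (not_frequently.1 hv)
    exact h2 u v huv N ⟨hu, hN⟩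
  obtain ⟨B, hBI, hB⟩ := exists_isBSCC_subset M.exists_edge hIne hIcl
  refine ⟨B, hB, ?_, fun x hx => hBI hx⟩
  obtain ⟨x, hx⟩ := hB.1.1
  obtain ⟨n, hn⟩ := (hBI hx : ∃ᶠ n in atTop, ρ n = x).exists
  refine eventually_atTop.2 ⟨n, fun m hm => ?_⟩
  induction m, hm using Nat.le_induction with
  | base => rwa [hn]
  | succ m _ ih => exact hB.2 _ ih _ (h1 m)

lemma MarkovChain.IsLaw.measure_exists_mem_le (hν : IsLaw M ν) (G : Set V) (h : V → ℝ≥0∞)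
    (hG : ∀ x ∈ G, 1 ≤ h x) (hh : ∀ x, ∑' y, M.step x y * h y ≤ h x) :
    ν {ρ | ∃ n, ρ n ∈ G} ≤ ∑' x, M.init x * h x := by
  classical
  let _ : MeasurableSpace V := ⊤
  let Z : ℕ → (ℕ → V) → ℝ≥0∞ := fun n ρ => if ∃ j ≤ n, ρ j ∈ G then 1 else h (ρ n)
  have hZ : ∀ n, ∀ ρ ρ', (∀ i ≤ n, ρ i = ρ' i) → Z n ρ = Z n ρ' := by
    intro n ρ ρ' hρ
    have h1 : (∃ j ≤ n, ρ j ∈ G) ↔ ∃ j ≤ n, ρ' j ∈ G :=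
      exists_congr fun j => and_congr_right fun hj => by rw [hρ j hj]
    simp only [Z, h1, hρ n le_rfl]
  have hstep : ∀ n, 0 ≤ n → ∀ ρ, ∑' z, M.step (ρ n) z * Z (n + 1) (Function.update ρ (n + 1) z)
      ≤ Z n ρ := by
    intro n _ ρ
    by_cases hhit : ∃ j ≤ n, ρ j ∈ G
    · simp only [Z, hhit, if_true]
      calc _ ≤ ∑' z, M.step (ρ n) z := ENNReal.tsum_le_tsum fun z => ?_
        _ = 1 := (M.step (ρ n)).tsum_coe
      obtain ⟨j, hj, hjG⟩ := hhit
      rw [if_pos ⟨j, by omega, by rwa [Function.update_of_ne (by omega)]⟩, mul_one]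
    · simp only [Z, hhit, if_false]
      refine le_trans (ENNReal.tsum_le_tsum fun z => ?_) (hh (ρ n))
      gcongr
      split_ifs with hz
      · obtain ⟨j, hj, hjG⟩ := hz
        by_cases hjn : j = n + 1
        · subst hjn
          rw [Function.update_self] at hjG
          exact hG z hjG
        · rw [Function.update_of_ne hjn] at hjG
          exact absurd ⟨j, by omega, hjG⟩ hhit
      · rw [Function.update_self]
  have hmono : Monotone fun n => {ρ : ℕ → V | ∃ j ≤ n, ρ j ∈ G} := by
    rintro n n' hn ρ ⟨j, hj, hjG⟩
    exact ⟨j, hj.trans hn, hjG⟩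
  have hun : {ρ : ℕ → V | ∃ n, ρ n ∈ G} = ⋃ n, {ρ | ∃ j ≤ n, ρ j ∈ G} := by
    ext ρ
    simp only [Set.mem_ofPred_eq, Set.mem_iUnion]
    exact ⟨fun ⟨n, hn⟩ => ⟨n, n, le_rfl, hn⟩, fun ⟨_, j, _, hj⟩ => ⟨j, hj⟩⟩
  rw [hun, hmono.measure_iUnion]
  refine iSup_le fun n => ?_
  have hle := hν.lintegral_le_of_supersolution 0 Z (fun n _ => hZ n) hstep (Nat.zero_le n)
  have hmk := mul_meas_ge_le_lintegral (μ := ν) (measurable_of_depends n _ (hZ n)) 1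
  rw [one_mul] at hmk
  refine (measure_mono ?_).trans (hmk.trans (hle.trans ?_))
  · intro ρ hρ
    exact (if_pos hρ : Z n ρ = 1).ge
  · rw [← hν.zero h]
    refine lintegral_mono fun ρ => ?_
    split_ifs with hz
    · obtain ⟨j, hj, hjG⟩ := hz
      obtain rfl : j = 0 := by omega
      exact hG _ hjG
    · exact le_rfl

end Limit

/-! ### Runs of the product with the automaton -/

section Product

variable {S Q A : Type*} (M : MarkovChain S) (L : S → A) (D : DRA A Q)

/-- The run of the product that belongs to a run of the Markov chain. -/
def productRun (ρ : ℕ → S) (i : ℕ) : S × Q := (ρ i, D.state (fun j => L (ρ j)) i)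

lemma productRun_congr {ρ ρ' : ℕ → S} {k : ℕ} (h : ∀ i ≤ k, ρ i = ρ' i) :
    ∀ i ≤ k, productRun L D ρ i = productRun L D ρ' i := by
  intro i hi
  have : D.state (fun j => L (ρ j)) i = D.state (fun j => L (ρ' j)) i := by
    induction i with
    | zero => simp only [DRA.state, h 0 hi]
    | succ i ih => simp only [DRA.state, ih (by omega), h (i + 1) hi]
  simp only [productRun, h i hi, this]

lemma measurable_productRun [Countable S] :
    @Measurable _ _ (runSpace S) (runSpace (S × Q)) (productRun L D) := by
  let _ : MeasurableSpace S := ⊤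
  let _ : MeasurableSpace (S × Q) := ⊤
  refine measurable_pi_lambda _ fun i => ?_
  exact measurable_of_depends i _ fun ρ ρ' h => productRun_congr L D h i le_rfl

/-- This transfers the limit theorems to the product without identifying the image measure with the
law of the product chain. -/
lemma isLaw_map_productRun [Countable S] [Countable Q] :
    IsLaw (product M L D)
      (@Measure.map _ _ (runSpace S) (runSpace (S × Q)) (productRun L D) M.law) := by
  let _ : MeasurableSpace S := ⊤
  let _ : MeasurableSpace (S × Q) := ⊤
  have hm := measurable_productRun L D
  constructor
  · intro f
    rw [lintegral_map (measurable_of_depends 0 _ fun ρ ρ' h => by rw [h 0 le_rfl]) hm]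
    simp only [product, tsum_map_mul]
    exact M.isLaw_law.zero fun s => f (s, D.next D.start (L s))
  · intro k F hF
    rw [lintegral_map (measurable_of_depends (k + 1) _ fun ρ ρ' h => by
        rw [h (k + 1) le_rfl, hF ρ ρ' _ fun i hi => h i (by omega)]) hm,
      lintegral_map (measurable_of_depends k _ fun ρ ρ' h => by
        rw [h k le_rfl]; exact tsum_congr fun y => by rw [hF ρ ρ' y h]) hm]
    simp only [product, tsum_map_mul]
    exact M.isLaw_law.succ k
      (fun ρ s => F (productRun L D ρ) (s, D.next (productRun L D ρ k).2 (L s)))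
      (fun ρ ρ' s h => by
        rw [productRun_congr L D h k le_rfl, hF _ _ _ (productRun_congr L D h)])

/-- A function that bounds the probability of reaching a good bottom SCC also bounds the probability
of acceptance. -/
lemma measure_accepts_le [Fintype S] [Fintype Q] (h : S × Q → ℝ≥0∞)
    (hG : ∀ B, IsBSCC (product M L D).Edge B → Good D B → ∀ x ∈ B, 1 ≤ h x)
    (hh : ∀ x, ∑' y, (product M L D).step x y * h y ≤ h x) :
    M.law {ρ | D.Accepts fun i => L (ρ i)} ≤ ∑' x, (product M L D).init x * h x := by
  let _ : MeasurableSpace S := ⊤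
  let _ : MeasurableSpace (S × Q) := ⊤
  have hm := measurable_productRun L D
  have hν := isLaw_map_productRun M L D
  let G : Set (S × Q) := {x | ∃ B, IsBSCC (product M L D).Edge B ∧ Good D B ∧ x ∈ B}
  have h1 := hν.measure_exists_mem_le G h
    (fun x ⟨B, hB, hBg, hx⟩ => hG B hB hBg x hx) hh
  refine le_trans ?_ h1
  rw [Measure.map_apply hm]
  · refine measure_mono_ae ?_
    filter_upwards [ae_of_ae_map hm.aemeasurable hν.ae_exists_isBSCC] with ρ ⟨B, hB, hev, hfr⟩
    -- Every state of `B` recurs, so none lies over `E`; the run ends up in `B`, so visits to `F`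
    -- take place there.
    rintro ⟨⟨E, F⟩, hp, hE, hF⟩
    obtain ⟨n, hn⟩ := hev.exists
    refine ⟨n, B, hB, ⟨(E, F), hp, ?_, ?_⟩, hn⟩
    · intro x hx hxE
      obtain ⟨m, hm1, hm2⟩ := ((hfr x hx).and_eventually hE).exists
      exact hm2 (by rw [← hm1] at hxE; exact hxE)
    · obtain ⟨m, hm1, hm2⟩ := (hF.and_eventually hev).exists
      exact ⟨_, hm2, hm1⟩
  · have : {ρ : ℕ → S × Q | ∃ n, ρ n ∈ G} = ⋃ n, {ρ | ρ n ∈ G} := by ext; simp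
    rw [this]
    refine MeasurableSet.iUnion fun n => ?_
    exact measurableSet_setOfPred.2 (measurable_of_depends n (fun ρ : ℕ → S × Q => ρ n ∈ G)
      fun ρ ρ' h => by rw [h n le_rfl])

end Product

/-! ### Potential functions on paths -/

open MarkovChain

section Paths

variable {V : Type*}

open scoped Classical in
/-- Every element of `K` occurs at least `k` times in `w`, and the last element of `w` occurs
`k + 1` times. -/
def Covers (K : Set V) (k : ℕ) (w : List V) : Prop :=
  (∀ v ∈ K, k ≤ w.count v) ∧ ∀ x ∈ w.getLast?, k + 1 ≤ w.count x

lemma sinceBirth_spec {π : List V} {K : Set V} (h : candidate π = some K) :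
    (∀ v ∈ sinceBirth π, v ∈ K) ∧ (sinceBirth π).getLast? = π.getLast? := by
  induction π using List.reverseRecOn with
  | nil => rw [candidate_nil] at h; cases h
  | append_singleton π y ih =>
    have hy : y ∈ K := last_mem_candidate h (by simp)
    by_cases hπ : candidate π = some K
    · rw [sinceBirth_concat_of_mem hπ hy]
      refine ⟨fun v hv => ?_, by simp⟩
      rcases List.mem_append.1 hv with hv | hv
      · exact (ih hπ).1 v hv
      · rw [List.mem_singleton.1 hv]; exact hy
    · rw [sinceBirth_concat_of_fresh h hπ]
      simpa using hy

lemma candidate_nonempty {π : List V} {K : Set V} (h : candidate π = some K) : K.Nonempty :=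
  (isCandidate_of_candidate h).2.1.1

/-- `Covers` passes to smaller `k`, and the supremum is attained. The hypothesis `1 ≤ k` excludes
the default value 0 of an empty supremum. -/
lemma le_strength_iff {π : List V} {K : Set V} (h : candidate π = some K) {k : ℕ} (hk : 1 ≤ k) :
    k ≤ strength π ↔ Covers K k (sinceBirth π) := by
  classical
  have hs : strength π = sSup {k | Covers K k (sinceBirth π)} := by
    simp only [strength, h, Covers]
  obtain ⟨v, hv⟩ := candidate_nonempty h
  have hbdd : BddAbove {k | Covers K k (sinceBirth π)} :=
    ⟨(sinceBirth π).count v, fun j hj => by convert hj.1 v hv⟩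
  rw [hs]
  refine ⟨fun hle => ?_, fun hc => le_csSup hbdd hc⟩
  have hne : {k | Covers K k (sinceBirth π)}.Nonempty := by
    by_contra hemp
    rw [Set.not_nonempty_iff_eq_empty.1 hemp] at hle
    simp at hle
    omega
  have hmem := Nat.sSup_mem hne hbdd
  exact ⟨fun w hw => hle.trans (hmem.1 w hw), fun x hx => le_trans (by omega) (hmem.2 x hx)⟩

lemma aborts_iff {S Q A : Type*} (D : DRA A Q) {α ε : ℝ} {π : List (S × Q)} {K : Set (S × Q)}
    (h : candidate π = some K)
    (hpos : 0 < α * ((candidateCount π : ℝ) - Real.logb 2 ε)) :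
    Aborts D α ε π ↔ ¬ Good D K ∧
      Covers K ⌈α * ((candidateCount π : ℝ) - Real.logb 2 ε)⌉₊ (sinceBirth π) := by
  rw [← le_strength_iff h (Nat.one_le_ceil_iff.2 hpos), Nat.ceil_le, Aborts, BadPath, h]
  simp

lemma not_aborts_of_candidate_eq_none {S Q A : Type*} (D : DRA A Q) {α ε : ℝ} {π : List (S × Q)}
    (h : candidate π = none) : ¬ Aborts D α ε π := by
  rintro ⟨⟨K, hK, -⟩, -⟩
  rw [h] at hK
  cases hK

end Paths

variable {V : Type*}

/-- All edges of the path are edges of the chain. -/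
def PathOf (X : MarkovChain V) (π : List V) : Prop := ∀ u v, pathEdge π u v → X.Edge u v

/-- No edge leaves `K`. -/
def ClosedSet (X : MarkovChain V) (K : Set V) : Prop := ∀ u ∈ K, ∀ v, X.Edge u v → v ∈ K

lemma PathOf.concat {X : MarkovChain V} {π : List V} (h : PathOf X π) {x y : V}
    (hx : π.getLast? = some x) (hxy : X.Edge x y) : PathOf X (π ++ [y]) := by
  intro u v e
  rcases pathEdge_concat.1 e with e | ⟨h1, rfl⟩
  · exact h u v e
  · rw [hx] at h1
    cases h1
    exact hxy

lemma PathOf.stronglyConnectedOn {X : MarkovChain V} {π : List V} (h : PathOf X π) {K : Set V}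
    (hK : candidate π = some K) : StronglyConnectedOn X.Edge K := fun u hu v hv =>
  Relation.TransGen.mono (fun _ _ e => ⟨e.1, e.2.1, h _ _ e.2.2⟩) _ _
    (candidate_stronglyConnectedOn hK u hu v hv)

variable [Fintype V]

lemma sum_prob_mul_le (X : MarkovChain V) (x : V) {f g : V → ℝ}
    (h : ∀ y, X.Edge x y → f y ≤ g y) : ∑ y, X.prob x y * f y ≤ ∑ y, X.prob x y * g y := by
  refine Finset.sum_le_sum fun y _ => ?_
  by_cases hy : X.Edge x y
  · exact mul_le_mul_of_nonneg_left (h y hy) (X.prob_nonneg _ _)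
  · rw [X.prob_eq_zero_iff.2 hy, zero_mul, zero_mul]

lemma sum_prob_mul_const (X : MarkovChain V) (x : V) (c : ℝ) : ∑ y, X.prob x y * c = c := by
  rw [← Finset.sum_mul, X.sum_prob, one_mul]

/-- A bound for the probability of ever resetting. -/
lemma exists_reset_potential (X : MarkovChain V) (good : Set V → Prop) {p : ℝ} (hp1 : p ≤ 1)
    (hX : ∀ x y, X.Edge x y → p ≤ X.prob x y) (hp : 0 < p)
    (h : V → ℝ) (h0 : ∀ x, 0 ≤ h x) (h1 : ∀ x, h x ≤ 1) (hh : ∀ x, h x = ∑ y, X.prob x y * h y)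
    (hbad : ∀ K, IsBSCC X.Edge K → ¬ good K → ∀ x ∈ K, h x = 0)
    {ε : ℝ} (hε0 : 0 < ε) (hε1 : ε < 1) (k : ℕ → ℕ)
    (hk : ∀ i, 1 ≤ i → (1 - p) ^ k i ≤ ε * (1 / 2) ^ i)
    {c : ℝ} (hc0 : 0 ≤ c) (hc1 : c ≤ 1) (hc : c ≤ ∑ x, (X.init x).toReal * h x) :
    ∃ U : List V → ℝ, (∀ π, 0 ≤ U π) ∧ (∀ π, U π ≤ 1) ∧
      (∀ π K, PathOf X π → candidate π = some K → ¬ good K →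
        Covers K (k (candidateCount π)) (sinceBirth π) → U π = 1) ∧
      (∀ π K, candidate π = some K → ClosedSet X K → good K → U π = 0) ∧
      U [] = 1 - c * (1 - ε) ∧
      ∑ x, (X.init x).toReal * U [x] ≤ U [] ∧
      ∀ π x, PathOf X π → π.getLast? = some x → ∑ y, X.prob x y * U (π ++ [y]) ≤ U π := by
  classical
  -- One exit state is fixed for every candidate that can be left; only visits to it will be
  -- counted.
  have hs : ∀ K : Set V, ∃ s, StronglyConnectedOn X.Edge K → ¬ ClosedSet X K →
      s ∈ K ∧ ∑ y, X.prob s y * K.indicator h y ≤ (1 - p) * h s := by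
    intro K
    by_cases hK : StronglyConnectedOn X.Edge K ∧ ¬ ClosedSet X K
    · have hnc : ∃ u ∈ K, ∃ v, v ∉ K ∧ X.Edge u v := by
        have := hK.2
        unfold ClosedSet at this
        push Not at this
        obtain ⟨u, hu, v, hv, hvK⟩ := this
        exact ⟨u, hu, v, hvK, hv⟩
      obtain ⟨s, hs1, hs2⟩ := exists_exit_state X hX h h0 hh hK.1 hnc
      exact ⟨s, fun _ _ => ⟨hs1, hs2⟩⟩
    · obtain ⟨x, -⟩ := X.init.support_nonempty
      exact ⟨x, fun h1 h2 => absurd ⟨h1, h2⟩ hK⟩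
  choose s hs using hs
  set q := 1 - p with hq
  have hq0 : 0 ≤ q := by linarith
  have hq1 : q ≤ 1 := by linarith
  -- The failure probability `∑_{j > i} ε 2^(-j)` granted to the candidates after the `i`-th.
  let a : ℕ → ℝ := fun i => ε * (1 / 2) ^ i
  have ha0 : ∀ i, 0 ≤ a i := fun i => by positivity
  have ha1 : ∀ i, a i ≤ 1 := fun i =>
    mul_le_one₀ hε1.le (by positivity) (pow_le_one₀ (by norm_num) (by norm_num))
  have ha2 : ∀ i, a i = 2 * a (i + 1) := fun i => by simp only [a, pow_succ]; ring
  -- For the empty path the default `c` stands for the initial mean of `h`, which is at least `c`.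
  let hl : List V → ℝ := fun π => (π.getLast?.map h).getD c
  have hl0 : ∀ π, 0 ≤ hl π := by
    intro π
    simp only [hl]
    cases π.getLast? <;> simp [hc0, h0]
  have hl1 : ∀ π, hl π ≤ 1 := by
    intro π
    simp only [hl]
    cases π.getLast? <;> simp [hc1, h1]
  have hlc : ∀ π y, hl (π ++ [y]) = h y := fun π y => by simp [hl]
  -- One factor `q` for each visit of the exit state still missing. The last state is dropped
  -- because the step from it has not been made.
  let r : Set V → List V → ℝ := fun K π =>
    q ^ (k (candidateCount π) - (sinceBirth π).dropLast.count (s K))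
  have hr0 : ∀ K π, 0 ≤ r K π := fun K π => pow_nonneg hq0 _
  -- A failing run, of weight `1 - h`, may always be reset; a successful one, of weight `h`, with
  -- probability at most `a + r`. On closed candidates the outcome is decided.
  let U : List V → ℝ := fun π => match candidate π with
    | none => 1 - hl π * (1 - a (candidateCount π))
    | some K => if ClosedSet X K then (if good K then 0 else 1) else
        min 1 (1 - hl π * (1 - a (candidateCount π) - r K π))
  have hUnone : ∀ π, candidate π = none → U π = 1 - hl π * (1 - a (candidateCount π)) := by
    intro π hπ
    simp only [U, hπ]
  have hUclosed : ∀ π K, candidate π = some K → ClosedSet X K →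
      U π = if good K then 0 else 1 := by
    intro π K hπ hK
    simp only [U, hπ, hK, if_true]
  have hUopen : ∀ π K, candidate π = some K → ¬ ClosedSet X K →
      U π = min 1 (1 - hl π * (1 - a (candidateCount π) - r K π)) := by
    intro π K hπ hK
    simp only [U, hπ, hK, if_false]
  have hU1 : ∀ π, U π ≤ 1 := by
    intro π
    rcases hπ : candidate π with _ | K
    · rw [hUnone π hπ]
      have := mul_nonneg (hl0 π) (sub_nonneg.2 (ha1 (candidateCount π)))
      linarith
    · by_cases hK : ClosedSet X K
      · rw [hUclosed π K hπ hK]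
        split_ifs <;> norm_num
      · rw [hUopen π K hπ hK]
        exact min_le_left _ _
  have hnil : U [] = 1 - c * (1 - ε) := by
    rw [hUnone [] candidate_nil, candidateCount_nil]
    simp [hl, a]
  -- the value after a step that leaves the candidate
  have hoff : ∀ π y, PathOf X (π ++ [y]) → ¬ (∃ K, candidate π = some K ∧ y ∈ K) →
      U (π ++ [y]) ≤ 1 - h y * (1 - a (candidateCount π)) := by
    intro π y hπ hy
    rcases fresh_or_mem_or_new π y with hK | ⟨hK, -⟩ | ⟨K, hK, hne⟩
    · exact absurd hK hy
    · rw [hUnone _ hK, candidateCount_concat_of_none hK, hlc]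
    · have hyK : y ∈ K := last_mem_candidate hK (by simp)
      have hpos := mul_nonneg (h0 y) (sub_nonneg.2 (ha1 (candidateCount π)))
      by_cases hcl : ClosedSet X K
      · rw [hUclosed _ K hK hcl]
        split_ifs with hg
        · have : h y * (1 - a (candidateCount π)) ≤ 1 :=
            mul_le_one₀ (h1 y) (sub_nonneg.2 (ha1 _)) (by linarith [ha0 (candidateCount π)])
          linarith
        · rw [hbad K (isBSCC_of_closed ⟨y, hyK⟩ (hπ.stronglyConnectedOn hK) hcl) hg y hyK]
          simp
      · rw [hUopen _ K hK hcl, hlc, candidateCount_concat_of_fresh hK hne]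
        refine (min_le_right _ _).trans ?_
        -- One half of `a i` goes to the new candidate and the other half to those after it.
        have hr : r K (π ++ [y]) ≤ a (candidateCount π + 1) := by
          simp only [r, candidateCount_concat_of_fresh hK hne, sinceBirth_concat_of_fresh hK hne]
          simp only [List.dropLast_singleton, List.count_nil, Nat.sub_zero]
          exact hk (candidateCount π + 1) (by omega)
        have := mul_le_mul_of_nonneg_left hr (h0 y)
        rw [ha2 (candidateCount π)]
        linarith
  refine ⟨U, ?_, hU1, ?_, ?_, hnil, ?_, ?_⟩
  · intro π
    have key : ∀ t, 0 ≤ t → 0 ≤ 1 - hl π * (1 - a (candidateCount π) - t) := by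
      intro t ht
      have h3 := mul_nonneg (hl0 π) (add_nonneg (ha0 (candidateCount π)) ht)
      linarith [hl1 π]
    rcases hπ : candidate π with _ | K
    · rw [hUnone π hπ]
      simpa using key 0 le_rfl
    · by_cases hK : ClosedSet X K
      · rw [hUclosed π K hπ hK]
        split_ifs <;> norm_num
      · rw [hUopen π K hπ hK]
        exact le_min zero_le_one (key _ (hr0 K π))
  · intro π K hπ hK hbadK hcov
    by_cases hcl : ClosedSet X K
    · rw [hUclosed π K hK hcl, if_neg hbadK]
    · rw [hUopen π K hK hcl]
      have hsK := (hs K (hπ.stronglyConnectedOn hK) hcl).1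
      -- If the last state, which is dropped, is the exit state, the additional occurrence required
      -- by `Covers` makes up for it.
      have hcount : k (candidateCount π) ≤ (sinceBirth π).dropLast.count (s K) := by
        rcases List.eq_nil_or_concat' (sinceBirth π) with hnil | ⟨w, x, hw⟩
        · have := hcov.1 _ hsK
          simpa [hnil] using this
        · have h3 := hcov.1 _ hsK
          have h4 := hcov.2 x (by rw [hw]; simp)
          rw [hw] at h3 h4 ⊢
          rw [List.dropLast_concat]
          rw [List.count_append] at h3 h4
          by_cases hx : x = s K
          · subst hx
            simp only [List.count_singleton_self] at h4
            omega
          · rw [List.count_eq_zero_of_not_mem (a := s K) (l := [x])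
              (by simpa using Ne.symm hx)] at h3
            omega
      have hr1 : r K π = 1 := by
        simp only [r, Nat.sub_eq_zero_of_le hcount, pow_zero]
      rw [hr1]
      have := mul_nonneg (hl0 π) (ha0 (candidateCount π))
      exact min_eq_left (by linarith)
  · intro π K hK hcl hg
    rw [hUclosed π K hK hcl, if_pos hg]
  · have hx : ∀ x, U [x] = 1 - h x * (1 - ε) := by
      intro x
      have hn : candidate ([] ++ [x]) = none := candidate_concat_eq_none.2 (by simp)
      have := hUnone _ hn
      rw [candidateCount_concat_of_none hn, candidateCount_nil, hlc] at this
      simpa [a] using this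
    simp only [hx, hnil, mul_sub, mul_one, Finset.sum_sub_distrib, ← mul_assoc,
      ← Finset.sum_mul, sum_toReal_eq_one]
    have := mul_le_mul_of_nonneg_right hc (sub_nonneg.2 hε1.le)
    linarith
  · intro π x hπ hx
    have hlx : hl π = h x := by simp [hl, hx]
    have hsum : ∀ t, ∑ y, X.prob x y * (1 - h y * t) = 1 - h x * t := by
      intro t
      rw [hh x]
      simp only [mul_sub, mul_one, Finset.sum_sub_distrib, X.sum_prob, ← mul_assoc,
        ← Finset.sum_mul]
    rcases hK : candidate π with _ | K
    · rw [hUnone π hK, hlx, ← hsum]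
      refine sum_prob_mul_le X x fun y hy => hoff π y (hπ.concat hx hy) ?_
      rintro ⟨K, hK', -⟩
      rw [hK] at hK'
      cases hK'
    · have hxK : x ∈ K := last_mem_candidate hK hx
      by_cases hcl : ClosedSet X K
      · rw [← sum_prob_mul_const X x (U π)]
        refine sum_prob_mul_le X x fun y hy => ?_
        rw [hUclosed _ K (candidate_concat_of_mem hK (hcl x hxK y hy)) hcl, hUclosed π K hK hcl]
      · rw [hUopen π K hK hcl]
        refine le_min ?_ ?_
        · rw [← sum_prob_mul_const X x 1]
          exact sum_prob_mul_le X x fun y _ => hU1 _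
        obtain ⟨hsK, hsle⟩ := hs K (hπ.stronglyConnectedOn hK) hcl
        set n := k (candidateCount π) - (sinceBirth π).count (s K) with hn
        have hval : ∀ y, X.Edge x y → U (π ++ [y]) ≤
            (1 - h y * (1 - a (candidateCount π))) + q ^ n * K.indicator h y := by
          intro y hy
          by_cases hyK : y ∈ K
          · rw [hUopen _ K (candidate_concat_of_mem hK hyK) hcl, hlc,
              candidateCount_concat_of_mem hK hyK, Set.indicator_of_mem hyK]
            refine (min_le_right _ _).trans (le_of_eq ?_)
            have : r K (π ++ [y]) = q ^ n := by
              simp only [r, candidateCount_concat_of_mem hK hyK, sinceBirth_concat_of_mem hK hyK,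
                List.dropLast_concat, hn]
            rw [this]
            ring
          · rw [Set.indicator_of_notMem hyK, mul_zero, add_zero]
            refine hoff π y (hπ.concat hx hy) ?_
            rintro ⟨K', hK', hy'⟩
            rw [hK] at hK'
            cases hK'
            exact hyK hy'
        refine (sum_prob_mul_le X x hval).trans ?_
        simp only [mul_add, Finset.sum_add_distrib]
        rw [hsum, hlx]
        have hind : ∑ y, X.prob x y * (q ^ n * K.indicator h y) =
            q ^ n * ∑ y, X.prob x y * K.indicator h y := by
          rw [Finset.mul_sum]
          exact Finset.sum_congr rfl fun y _ => by ring
        have hle : ∑ y, X.prob x y * K.indicator h y ≤ h x := by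
          rw [hh x]
          exact sum_prob_mul_le X x fun y _ => Set.indicator_le_self' (fun z _ => h0 z) y
        -- At the exit state the factor `1 - p` matches the visit that is now counted. Elsewhere the
        -- count is unchanged, and restriction to `K` only lowers the mean of `h`.
        have hmain : q ^ n * ∑ y, X.prob x y * K.indicator h y ≤ h x * r K π := by
          obtain ⟨-, hlastB⟩ := sinceBirth_spec hK
          rw [hx] at hlastB
          obtain ⟨w, hw⟩ := List.getLast?_eq_some_iff.1 hlastB
          simp only [r]
          rw [hn, hw, List.dropLast_concat, List.count_append]
          by_cases hxs : x = s K
          · rw [hxs, List.count_singleton_self]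
            rw [hxs] at hle
            by_cases hlt : w.count (s K) < k (candidateCount π)
            · have : k (candidateCount π) - w.count (s K) =
                  (k (candidateCount π) - (w.count (s K) + 1)) + 1 := by omega
              rw [this, pow_succ]
              have := mul_le_mul_of_nonneg_left hsle
                (pow_nonneg hq0 (k (candidateCount π) - (w.count (s K) + 1)))
              linarith
            · rw [Nat.sub_eq_zero_of_le (by omega), Nat.sub_eq_zero_of_le (by omega)]
              simpa using hle
          · rw [List.count_eq_zero_of_not_mem (a := s K) (l := [x])
              (by simpa using Ne.symm hxs), add_zero, mul_comm]
            exact mul_le_mul_of_nonneg_right hle (pow_nonneg hq0 _)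
        rw [hind]
        linarith

/-! ### The duration of one attempt -/

/-- A bound for the expected time spent with a candidate with `m` states until it is left or, if it
is bad, has strength `k`. -/
def phaseBound (p : ℝ) (k m : ℕ) : ℝ :=
  max (1 + k * m * max 1 (invGeomSum p (m - 1))) (invGeomSum p m)

/-- A good candidate must be left, and it can be, since good closed ones are excluded; a bad one may
also end by being covered. The hypotheses follow the quantifier so that `Y` can be chosen for all
`K` at once. -/
lemma exists_phase_potential (X : MarkovChain V) {p : ℝ} (hp : 0 < p)
    (hX : ∀ x y, X.Edge x y → p ≤ X.prob x y) (g : Prop) (K : Set V) (k : ℕ) :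
    ∃ Y : List V → ℝ, StronglyConnectedOn X.Edge K → ¬ (ClosedSet X K ∧ g) → 1 ≤ k →
      (∀ b ∈ K, Y [b] ≤ phaseBound p k K.ncard) ∧ (∀ w, 0 ≤ Y w) ∧ (¬ g → ∀ w, 1 ≤ Y w) ∧
      ∀ w x, (∀ v ∈ w, v ∈ K) → w.getLast? = some x → ¬ (¬ g ∧ Covers K k w) →
        1 + ∑ y, X.prob x y * K.indicator (fun y => Y (w ++ [y])) y ≤ Y w := by
  classical
  by_cases hK : StronglyConnectedOn X.Edge K ∧ ¬ (ClosedSet X K ∧ g) ∧ 1 ≤ k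
  swap
  · exact ⟨0, fun h1 h2 h3 => absurd ⟨h1, h2, h3⟩ hK⟩
  obtain ⟨hsc, hng, hk⟩ := hK
  by_cases hg : g
  · have hnc : ∃ u ∈ K, ∃ v, v ∉ K ∧ X.Edge u v := by
      by_contra! hcon
      exact hng ⟨fun u hu v e => by_contra fun hv => hcon u hu v hv e, hg⟩
    obtain ⟨H, hH1, hH2, hH3, hH4⟩ := exists_exit_potential_of_not_closed X hp hX hsc hnc
    refine ⟨fun w => (w.getLast?.map H).getD 0, fun _ _ _ => ⟨fun b _ => ?_, fun w => ?_, ?_, ?_⟩⟩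
    · exact (hH2 b).trans (le_max_right _ _)
    · rcases hw : w.getLast? <;> simp [hw, hH1]
    · exact fun h => absurd hg h
    · intro w x hw hx _
      simp only [hx, Option.map_some, Option.getD_some, List.getLast?_concat]
      refine le_trans ?_ (hH4 x (hw x (List.mem_of_getLast? hx)))
      gcongr with y
      · exact X.prob_nonneg _ _
      · exact Set.indicator_le_self' (fun z _ => hH1 z) y
  · choose Y hY using fun b : K => exists_coverage_potential X hp hX hsc b.2 hk
    let Y' : List V → ℝ := fun w => match w with
      | [] => 1
      | b :: l => if hb : b ∈ K then Y ⟨b, hb⟩ (b :: l) else 1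
    have hY' : ∀ (b : K) l, Y' (b :: l) = Y b (b :: l) := fun b l => by simp [Y']
    have hY1 : ∀ w, 1 ≤ Y' w := by
      rintro (_ | ⟨b, l⟩)
      · exact le_rfl
      · simp only [Y']
        split_ifs with hb
        · exact (hY ⟨b, hb⟩).2.1 _
        · exact le_rfl
    refine ⟨Y', fun _ _ _ => ⟨fun b hb => ?_, fun w => zero_le_one.trans (hY1 w),
      fun _ => hY1, ?_⟩⟩
    · rw [hY' ⟨b, hb⟩]
      exact (hY ⟨b, hb⟩).1.trans (le_max_left _ _)
    · intro w x hw hx hcov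
      rcases w with _ | ⟨b, l⟩
      · simp at hx
      have hb : b ∈ K := hw b (by simp)
      have := (hY ⟨b, hb⟩).2.2 l x (fun v hv => hw v (by simp [hv])) hx
        (fun hc => hcov ⟨hg, by simpa only [Covers] using hc⟩)
      rw [hY' ⟨b, hb⟩]
      refine le_trans (le_of_eq ?_) this
      congr 1
      refine Finset.sum_congr rfl fun y _ => ?_
      have : (fun y => Y' (b :: l ++ [y])) = fun y => Y ⟨b, hb⟩ (b :: l ++ [y]) :=
        funext fun y => hY' ⟨b, hb⟩ (l ++ [y])
      rw [this]

/-- A bound for the expected number of steps of one attempt of the monitor, where `b i N` bounds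
the expected time spent with the candidates that are born after the first `i` ones if there are `N`
classes. -/
lemma exists_step_potential (X : MarkovChain V) (good : Set V → Prop) {p : ℝ} (hp : 0 < p)
    (hX : ∀ x y, X.Edge x y → p ≤ X.prob x y) (k : ℕ → ℕ) (hk : ∀ i, 1 ≤ k i)
    (b : ℕ → ℕ → ℝ) (hbmono : ∀ i, Monotone (b i))
    (hb0 : ∀ π, 0 ≤ b (candidateCount π) (classCount (π : List V)))
    (hb : ∀ (π : List V) y K, PathOf X (π ++ [y]) → candidate (π ++ [y]) = some K →
      candidate π ≠ some K → ¬ (ClosedSet X K ∧ good K) →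
      phaseBound p (k (candidateCount π + 1)) K.ncard +
        b (candidateCount π + 1) (classCount (π ++ [y])) ≤
        b (candidateCount π) (classCount π)) :
    ∃ C : List V → ℝ, (∀ π, PathOf X π → 0 ≤ C π) ∧
      (∀ π K, PathOf X π → candidate π = some K → ¬ good K → 1 ≤ C π) ∧
      (∀ π K, candidate π = some K → ClosedSet X K → good K → C π = 0) ∧
      C [] = 1 + Nat.card V + b 0 (Nat.card V) ∧
      1 + ∑ x, (X.init x).toReal * C [x] ≤ C [] ∧
      (∀ π x K, PathOf X π → π.getLast? = some x → candidate π = some K → ClosedSet X K →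
        good K → ∑ y, X.prob x y * C (π ++ [y]) ≤ 0) ∧
      ∀ π x, PathOf X π → π.getLast? = some x →
        (∀ K, candidate π = some K → ¬ (ClosedSet X K ∧ good K) ∧
          ¬ (¬ good K ∧ Covers K (k (candidateCount π)) (sinceBirth π))) →
        1 + ∑ y, X.prob x y * C (π ++ [y]) ≤ C π := by
  classical
  choose Y hY using fun K => exists_phase_potential X hp hX (good K) K
  -- Unvisited states pay for the steps without a candidate, and `b` pays for the candidates yet to
  -- be born.
  let base : List V → ℝ := fun π => unvisited π + b (candidateCount π) (classCount π)
  have hbase0 : ∀ π, 0 ≤ base π := fun π => add_nonneg (Nat.cast_nonneg _) (hb0 π)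
  -- On a good closed candidate no reset will follow, so its steps need not be paid.
  let C : List V → ℝ := fun π => match candidate π with
    | none => 1 + base π
    | some K => if ClosedSet X K ∧ good K then 0 else
        base π + Y K (k (candidateCount π)) (sinceBirth π)
  have hCnone : ∀ π, candidate π = none → C π = 1 + base π := by
    intro π hπ
    simp only [C, hπ]
  have hCgood : ∀ π K, candidate π = some K → ClosedSet X K ∧ good K → C π = 0 := by
    intro π K hπ hK
    simp only [C, hπ, if_pos hK]
  have hCelse : ∀ π K, candidate π = some K → ¬ (ClosedSet X K ∧ good K) →
      C π = base π + Y K (k (candidateCount π)) (sinceBirth π) := by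
    intro π K hπ hK
    simp only [C, hπ, if_neg hK]
  have hnew : ∀ π y, candidate (π ++ [y]) = none → y ∉ π → C (π ++ [y]) ≤ base π := by
    intro π y hc hy
    rw [hCnone _ hc]
    simp only [base, candidateCount_concat_of_none hc, ← unvisited_concat_of_notMem hy]
    have := hbmono (candidateCount π) (classCount_concat_le π y)
    push_cast
    linarith
  have hoff : ∀ π y, PathOf X (π ++ [y]) → ¬ (∃ K, candidate π = some K ∧ y ∈ K) →
      C (π ++ [y]) ≤ base π := by
    intro π y hπ hy
    rcases fresh_or_mem_or_new π y with hK | ⟨hK, hyπ⟩ | ⟨K, hK, hne⟩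
    · exact absurd hK hy
    · exact hnew π y hK hyπ
    · by_cases hg : ClosedSet X K ∧ good K
      · rw [hCgood _ K hK hg]
        exact hbase0 π
      · rw [hCelse _ K hK hg, candidateCount_concat_of_fresh hK hne,
          sinceBirth_concat_of_fresh hK hne]
        have h1 := (hY K (k (candidateCount π + 1)) (hπ.stronglyConnectedOn hK) hg (hk _)).1 y
          (last_mem_candidate hK (by simp))
        have h2 := hb π y K hπ hK hne hg
        have h3 : (unvisited (π ++ [y]) : ℝ) ≤ unvisited π :=
          Nat.cast_le.2 (unvisited_concat_le π y)
        simp only [base, candidateCount_concat_of_fresh hK hne]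
        linarith
  have hnil : C [] = 1 + Nat.card V + b 0 (Nat.card V) := by
    rw [hCnone [] candidate_nil]
    simp only [base, candidateCount_nil, classCount_nil, unvisited_nil]
    ring
  refine ⟨C, ?_, ?_, fun π K hK h1 h2 => hCgood π K hK ⟨h1, h2⟩, hnil, ?_, ?_, ?_⟩
  · intro π hπ
    rcases hK : candidate π with _ | K
    · rw [hCnone π hK]
      linarith [hbase0 π]
    · by_cases hg : ClosedSet X K ∧ good K
      · rw [hCgood π K hK hg]
      · rw [hCelse π K hK hg]
        exact add_nonneg (hbase0 π)
          ((hY K _ (hπ.stronglyConnectedOn hK) hg (hk _)).2.1 _)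
  · intro π K hπ hK hbad
    have hg : ¬ (ClosedSet X K ∧ good K) := fun h => hbad h.2
    rw [hCelse π K hK hg]
    have := (hY K _ (hπ.stronglyConnectedOn hK) hg (hk (candidateCount π))).2.2.1 hbad
      (sinceBirth π)
    linarith [hbase0 π]
  · have hx : ∀ x, C [x] ≤ base [] := fun x =>
      hnew [] x (candidate_concat_eq_none.2 (by simp)) (by simp)
    have h1 : ∑ x, (X.init x).toReal * C [x] ≤ ∑ x, (X.init x).toReal * base [] :=
      Finset.sum_le_sum fun x _ => mul_le_mul_of_nonneg_left (hx x) ENNReal.toReal_nonneg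
    rw [← Finset.sum_mul, sum_toReal_eq_one, one_mul] at h1
    rw [hCnone [] candidate_nil]
    linarith
  · intro π x K hπ hx hK hcl hg
    rw [← sum_prob_mul_const X x 0]
    refine sum_prob_mul_le X x fun y hy => ?_
    rw [hCgood _ K (candidate_concat_of_mem hK (hcl x (last_mem_candidate hK hx) y hy)) ⟨hcl, hg⟩]
  · intro π x hπ hx hreset
    rcases hK : candidate π with _ | K
    · rw [hCnone π hK]
      have : ∑ y, X.prob x y * C (π ++ [y]) ≤ ∑ y, X.prob x y * base π := by
        refine sum_prob_mul_le X x fun y hy => hoff π y (hπ.concat hx hy) ?_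
        rintro ⟨K, hK', -⟩
        rw [hK] at hK'
        cases hK'
      rw [sum_prob_mul_const] at this
      linarith
    · obtain ⟨hg, hcov⟩ := hreset K hK
      rw [hCelse π K hK hg]
      obtain ⟨hwK, hwlast⟩ := sinceBirth_spec hK
      have hphase := (hY K _ (hπ.stronglyConnectedOn hK) hg (hk (candidateCount π))).2.2.2
        (sinceBirth π) x hwK (hwlast.trans hx) hcov
      have : ∑ y, X.prob x y * C (π ++ [y]) ≤ ∑ y, X.prob x y * (base π + K.indicator
          (fun y => Y K (k (candidateCount π)) (sinceBirth π ++ [y])) y) := by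
        refine sum_prob_mul_le X x fun y hy => ?_
        by_cases hyK : y ∈ K
        · rw [hCelse _ K (candidate_concat_of_mem hK hyK) hg, Set.indicator_of_mem hyK,
            candidateCount_concat_of_mem hK hyK, sinceBirth_concat_of_mem hK hyK]
          simp only [base, candidateCount_concat_of_mem hK hyK]
          have h1 : (unvisited (π ++ [y]) : ℝ) ≤ unvisited π :=
            Nat.cast_le.2 (unvisited_concat_le π y)
          have h2 := hbmono (candidateCount π) (classCount_concat_le π y)
          linarith
        · rw [Set.indicator_of_notMem hyK, add_zero]
          refine hoff π y (hπ.concat hx hy) ?_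
          rintro ⟨K', hK', hy'⟩
          rw [hK] at hK'
          cases hK'
          exact hyK hy'
      simp only [mul_add, Finset.sum_add_distrib, sum_prob_mul_const] at this
      linarith

/-! ### The expected number of steps of the bold monitor -/

open MarkovChain

section MinProb

variable {S : Type*}

lemma pmin_le_prob (M : MarkovChain S) {x y : S} (h : M.Edge x y) : M.pmin ≤ M.prob x y :=
  csInf_le ⟨0, fun _ hp => hp.1.le⟩ ⟨lt_of_le_of_ne (M.prob_nonneg x y)
    fun h0 => M.prob_eq_zero_iff.1 h0.symm h, x, y, rfl⟩

lemma pmin_le_prob_product {Q A : Type*} (M : MarkovChain S) (L : S → A) (D : DRA A Q)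
    {x y : S × Q} (h : (product M L D).Edge x y) : M.pmin ≤ (product M L D).prob x y := by
  classical
  obtain ⟨s, hs, rfl⟩ := (PMF.mem_support_map_iff _ _ _).1 ((PMF.mem_support_iff _ _).2 h)
  refine (pmin_le_prob M ((PMF.mem_support_iff _ _).1 hs)).trans ?_
  refine ENNReal.toReal_mono (PMF.apply_ne_top _ _) ?_
  simp only [product, PMF.map_apply]
  refine le_trans (le_of_eq ?_) (ENNReal.le_tsum s)
  simp

variable [Fintype S]

lemma exists_pmin_eq (M : MarkovChain S) : 0 < M.pmin ∧ ∃ x y, M.pmin = M.prob x y := by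
  obtain ⟨x, -⟩ := M.init.support_nonempty
  obtain ⟨y, hy⟩ := M.exists_edge x
  have hfin : {p : ℝ | 0 < p ∧ ∃ x y, p = (M.step x y).toReal}.Finite := by
    refine (Set.finite_range fun z : S × S => (M.step z.1 z.2).toReal).subset ?_
    rintro p ⟨-, x, y, rfl⟩
    exact ⟨(x, y), rfl⟩
  have hne : {p : ℝ | 0 < p ∧ ∃ x y, p = (M.step x y).toReal}.Nonempty :=
    ⟨M.prob x y, lt_of_le_of_ne (M.prob_nonneg x y)
      fun h => M.prob_eq_zero_iff.1 h.symm hy, x, y, rfl⟩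
  exact hne.csInf_mem hfin

lemma pmin_pos (M : MarkovChain S) : 0 < M.pmin := (exists_pmin_eq M).1

lemma pmin_le_one (M : MarkovChain S) : M.pmin ≤ 1 := by
  obtain ⟨-, x, y, h⟩ := exists_pmin_eq M
  rw [h]
  exact M.prob_le_one x y

lemma prob_add_prob_le_one (M : MarkovChain S) {x y z : S} (h : y ≠ z) :
    M.prob x y + M.prob x z ≤ 1 := by
  classical
  rw [← M.sum_prob x, ← Finset.sum_pair h]
  exact Finset.sum_le_sum_of_subset_of_nonneg (Finset.subset_univ _)
    fun w _ _ => M.prob_nonneg x w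

/-- A minimal transition either is the only one from its state or competes with another one that is
at least as likely. -/
lemma pmin_eq_one_or_le_half (M : MarkovChain S) : M.pmin = 1 ∨ M.pmin ≤ 1 / 2 := by
  classical
  obtain ⟨hpos, x, y, h⟩ := exists_pmin_eq M
  by_cases hz : ∃ z, z ≠ y ∧ M.Edge x z
  · right
    obtain ⟨z, hzy, hz⟩ := hz
    have h1 := prob_add_prob_le_one M (x := x) hzy
    have h2 := pmin_le_prob M hz
    linarith
  · left
    push Not at hz
    rw [h, ← M.sum_prob x, Finset.sum_eq_single y]
    · exact fun z _ hzy => M.prob_eq_zero_iff.2 (hz z hzy)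
    · simp

end MinProb

/-- After taking logarithms this is `1 ≤ -α log(1 - p)`, multiplied by `i - log ε`. For `p = 1` the
left side is 0, as the exponent is positive. -/
lemma one_sub_pow_ceil_le {p α ε : ℝ} (hp0 : 0 < p) (hp1 : p ≤ 1) (hε0 : 0 < ε) (hε1 : ε < 1)
    (hα : max 1 (-1 / Real.logb 2 (1 - p)) ≤ α) (i : ℕ) (hi : 1 ≤ i) :
    (1 - p) ^ ⌈α * ((i : ℝ) - Real.logb 2 ε)⌉₊ ≤ ε * (1 / 2) ^ i := by
  have hα1 : 1 ≤ α := (le_max_left _ _).trans hα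
  have hl : Real.logb 2 ε < 0 := Real.logb_neg (by norm_num) hε0 hε1
  have hi' : (1 : ℝ) ≤ i := by exact_mod_cast hi
  have hx : 0 < (i : ℝ) - Real.logb 2 ε := by linarith
  have hpos : 0 < α * ((i : ℝ) - Real.logb 2 ε) := by positivity
  have hε : ε * (1 / 2) ^ i = 2 ^ (-((i : ℝ) - Real.logb 2 ε)) := by
    rw [neg_sub, Real.rpow_sub (by norm_num), Real.rpow_logb (by norm_num) (by norm_num) hε0,
      Real.rpow_natCast]
    simp [div_eq_mul_inv]
  rcases hp1.eq_or_lt with rfl | hlt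
  · rw [sub_self, zero_pow (Nat.ceil_pos.2 hpos).ne']
    positivity
  · have hq0 : 0 < 1 - p := by linarith
    have hlq : Real.logb 2 (1 - p) < 0 := Real.logb_neg (by norm_num) hq0 (by linarith)
    have h1 : 1 ≤ α * -Real.logb 2 (1 - p) := by
      have := (le_max_right _ _).trans hα
      rw [neg_div, ← div_neg, div_le_iff₀ (by linarith)] at this
      exact this
    rw [hε, ← Real.rpow_natCast]
    nth_rewrite 1 [← Real.rpow_logb (b := 2) (by norm_num) (by norm_num) hq0]
    rw [← Real.rpow_mul (by norm_num)]
    refine Real.rpow_le_rpow_of_exponent_le (by norm_num) ?_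
    have h2 := Nat.le_ceil (α * ((i : ℝ) - Real.logb 2 ε))
    have h3 := mul_le_mul_of_nonneg_left h2 (neg_nonneg.2 hlq.le)
    have h4 := mul_le_mul_of_nonneg_right h1 hx.le
    linarith

lemma ncard_le_maxSCCSize {V : Type*} [Fintype V] {E : V → V → Prop} {K : Set V}
    (hne : K.Nonempty) (hK : StronglyConnectedOn E K) : K.ncard ≤ maxSCCSize E := by
  obtain ⟨C, hKC, hC⟩ := Finite.exists_le_maximal hK
  refine (Set.ncard_le_ncard hKC (Set.toFinite _)).trans ?_
  refine le_csSup ⟨Nat.card V, ?_⟩ ⟨C, ⟨hne.mono hKC, hC⟩, rfl⟩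
  rintro m ⟨C, -, rfl⟩
  exact Set.ncard_le_card C

lemma maxSCCSize_le {V : Type*} [Fintype V] (E : V → V → Prop) :
    maxSCCSize E ≤ Nat.card V := by
  unfold maxSCCSize
  rcases Set.eq_empty_or_nonempty {m | ∃ C, IsSCC E C ∧ C.ncard = m} with h | h
  · rw [h]; simp
  · refine csSup_le h ?_
    rintro m ⟨C, -, rfl⟩
    exact Set.ncard_le_card C

/-- A harmonic function that bounds the probability of acceptance. -/
lemma exists_harmonic_of_accepts {S Q A : Type*} [Fintype S] [Fintype Q] (M : MarkovChain S)
    (L : S → A) (D : DRA A Q) :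
    ∃ h : S × Q → ℝ, (∀ x, 0 ≤ h x) ∧ (∀ x, h x ≤ 1) ∧
      (∀ x, h x = ∑ y, (product M L D).prob x y * h y) ∧
      (∀ K, IsBSCC (product M L D).Edge K → ¬ Good D K → ∀ x ∈ K, h x = 0) ∧
      ((¬ ∃ K, IsBSCC (product M L D).Edge K ∧ Good D K) → ∀ x, h x = 0) ∧
      (M.law {ρ | D.Accepts fun i => L (ρ i)}).toReal ≤
        ∑ x, ((product M L D).init x).toReal * h x := by
  set X := product M L D
  obtain ⟨h, h0, h1, hh, hG, hB⟩ := exists_harmonic X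
    {x | ∃ B, IsBSCC X.Edge B ∧ Good D B ∧ x ∈ B} (by
      rintro x ⟨B, hB, hg, hx⟩ y hxy
      exact ⟨B, hB, hg, hB.2 x hx y hxy⟩)
  refine ⟨h, h0, h1, hh, ?_, ?_, ?_⟩
  · intro K hK hbad
    refine hB K hK.2 (Set.disjoint_left.2 ?_)
    rintro x hx ⟨B, hB, hg, hxB⟩
    have : K = B := (hK.subset_of_mem hB.2 hx hxB).antisymm (hB.subset_of_mem hK.2 hxB hx)
    rw [this] at hbad
    exact hbad hg
  · intro hno x
    refine hB Set.univ (fun _ _ _ _ => trivial) (Set.disjoint_left.2 ?_) x trivial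
    rintro x - ⟨B, hB, hg, -⟩
    exact hno ⟨B, hB, hg⟩
  · have hsum : 0 ≤ ∑ x, (X.init x).toReal * h x :=
      Finset.sum_nonneg fun x _ => mul_nonneg ENNReal.toReal_nonneg (h0 x)
    refine ENNReal.toReal_le_of_le_ofReal hsum ?_
    refine (measure_accepts_le M L D (fun x => ENNReal.ofReal (h x)) ?_ ?_).trans ?_
    · intro B hB hg x hx
      rw [hG x ⟨B, hB, hg, hx⟩, ENNReal.ofReal_one]
    · intro x
      exact tsum_mul_ofReal_le _ _ h (fun y _ => ⟨h0 y, rfl⟩) (hh x).ge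
    · exact tsum_mul_ofReal_le _ _ h (fun y _ => ⟨h0 y, rfl⟩) le_rfl

/-- The expected number of steps until the last reset, in terms of a bound `b` for the expected time
spent with candidates. -/
theorem lintegral_stepsToLastReset_le_of_budget {S Q A : Type*} [Fintype S] [Fintype Q]
    (M : MarkovChain S) (L : S → A) (D : DRA A Q) {α ε : ℝ}
    (hα : max 1 (-1 / Real.logb 2 (1 - M.pmin)) ≤ α) (hε0 : 0 < ε) (hε1 : ε < 1)
    {c : ℝ} (hc : c = (M.law {ρ | D.Accepts fun i => L (ρ i)}).toReal) (hpos : 0 < c)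
    (b : ℕ → ℕ → ℝ) (hbmono : ∀ i, Monotone (b i))
    (hb0 : ∀ π : List (S × Q), 0 ≤ b (candidateCount π) (classCount π))
    (hb : ∀ (π : List (S × Q)) y K, PathOf (product M L D) (π ++ [y]) →
      candidate (π ++ [y]) = some K → candidate π ≠ some K →
      ¬ (ClosedSet (product M L D) K ∧ Good D K) →
      phaseBound M.pmin ⌈α * (((candidateCount π + 1 : ℕ) : ℝ) - Real.logb 2 ε)⌉₊ K.ncard +
        b (candidateCount π + 1) (classCount (π ++ [y])) ≤
        b (candidateCount π) (classCount π)) :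
    ∫⁻ ρ, stepsToLastReset ρ ∂(monitorChain M L D α ε).law ≤
      ENNReal.ofReal ((1 + Nat.card (S × Q) + b 0 (Nat.card (S × Q))) / (c * (1 - ε))) := by
  have hα1 : 1 ≤ α := (le_max_left _ _).trans hα
  have hl : Real.logb 2 ε < 0 := Real.logb_neg (by norm_num) hε0 hε1
  have hthr : ∀ i : ℕ, 0 < α * ((i : ℝ) - Real.logb 2 ε) := fun i =>
    mul_pos (by linarith) (by have : (0 : ℝ) ≤ i := Nat.cast_nonneg i; linarith)
  obtain ⟨h, h0, h1, hh, hbad, -, hc'⟩ := exists_harmonic_of_accepts M L D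
  set X := product M L D with hXdef
  have hX : ∀ x y, X.Edge x y → M.pmin ≤ X.prob x y := fun x y => pmin_le_prob_product M L D
  rw [← hc] at hc'
  have hc1 : c ≤ 1 := by
    refine hc'.trans ?_
    rw [← sum_toReal_eq_one X.init]
    exact Finset.sum_le_sum fun x _ => mul_le_of_le_one_right ENNReal.toReal_nonneg (h1 x)
  obtain ⟨U, hU0, hU1, hUa, hUg, hUnil, hUi, hUs⟩ := exists_reset_potential X (Good D)
    (pmin_le_one M) hX (pmin_pos M) h h0 h1 hh hbad hε0 hε1
    (fun i => ⌈α * ((i : ℝ) - Real.logb 2 ε)⌉₊)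
    (one_sub_pow_ceil_le (pmin_pos M) (pmin_le_one M) hε0 hε1 hα) hpos.le hc1 hc'
  obtain ⟨C, hC0, hCa, hCg, hCnil, hCi, hCgs, hCs⟩ := exists_step_potential X (Good D) (pmin_pos M)
    hX (fun i => ⌈α * ((i : ℝ) - Real.logb 2 ε)⌉₊) (fun i => Nat.one_le_ceil_iff.2 (hthr i))
    b hbmono hb0 hb
  have hcε : 0 < c * (1 - ε) := mul_pos hpos (by linarith)
  have key := lintegral_stepsToLastReset_monitorChain_le M L D α ε (PathOf X) U C
    (fun u v e => absurd e (not_pathEdge_nil u v))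
    (fun x _ u v e => by
      rcases pathEdge_concat (π := []).1 e with e | ⟨e, -⟩
      · exact absurd e (not_pathEdge_nil u v)
      · simp at e)
    (fun π x y hπ hx hxy => hπ.concat hx hxy)
    (fun π _ => hU0 π) hC0 ?_ ?_ hUi ?_ (fun π x hπ _ hx => hUs π x hπ hx) ?_ ?_
  · rwa [hCnil, hUnil, sub_sub_cancel] at key
  · intro π hπ ha
    rcases hK : candidate π with _ | K
    · exact absurd ha (not_aborts_of_candidate_eq_none D hK)
    · obtain ⟨hb, hcov⟩ := (aborts_iff D hK (hthr _)).1 ha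
      exact hUa π K hπ hK hb hcov
  · intro π hπ ha
    rcases hK : candidate π with _ | K
    · exact absurd ha (not_aborts_of_candidate_eq_none D hK)
    · exact hCa π K hπ hK ((aborts_iff D hK (hthr _)).1 ha).1
  · linarith [hU1 []]
  · intro π x hπ ha hx
    -- On good closed candidates both potentials vanish; elsewhere `U ≤ 1`, and `C` pays for every
    -- step.
    by_cases hg : ∃ K, candidate π = some K ∧ ClosedSet X K ∧ Good D K
    · obtain ⟨K, hK, hcl, hgK⟩ := hg
      rw [hUg π K hK hcl hgK, hCg π K hK hcl hgK, zero_add]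
      exact hCgs π x K hπ hx hK hcl hgK
    · refine le_trans (add_le_add_left (hU1 π) _) (hCs π x hπ hx fun K hK => ⟨?_, ?_⟩)
      · exact fun h => hg ⟨K, hK, h⟩
      · exact fun h => ha ((aborts_iff D hK (hthr _)).2 h)
  · rw [hUnil]
    linarith

/-! ### Numerical bounds -/

open MarkovChain

lemma invGeomSum_one (p : ℝ) : invGeomSum p 1 = 1 / p := by simp [invGeomSum]

lemma invGeomSum_le {p : ℝ} (hp0 : 0 < p) (hp : p ≤ 1 / 2) (r : ℕ) :
    invGeomSum p r ≤ 2 * (1 / p) ^ r - 2 := by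
  have h2 : 2 ≤ 1 / p := by rw [le_div_iff₀ hp0]; linarith
  induction r with
  | zero => simp [invGeomSum_zero]
  | succ r ih =>
    have h3 : invGeomSum p (r + 1) = invGeomSum p r + (1 / p) ^ (r + 1) := by
      rw [invGeomSum, Finset.sum_range_succ, invGeomSum]
    have h4 : (1 / p) ^ (r + 1) = (1 / p) ^ r * (1 / p) := pow_succ _ _
    have h5 : 0 < (1 / p) ^ r := by positivity
    have h6 := mul_le_mul_of_nonneg_left h2 h5.le
    linarith

lemma invGeomSum_one_left (r : ℕ) : invGeomSum 1 r = r := by simp [invGeomSum]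

lemma phaseBound_mono {p : ℝ} (hp : 0 < p) (k : ℕ) : Monotone (phaseBound p k) := by
  intro m m' h
  have h1 := invGeomSum_mono hp h
  have h2 := invGeomSum_mono hp (Nat.sub_le_sub_right h 1)
  unfold phaseBound
  gcongr

lemma phaseBound_nonneg (p : ℝ) (k m : ℕ) : 0 ≤ phaseBound p k m :=
  le_max_of_le_left (by positivity)

lemma phaseBound_one (p : ℝ) (k : ℕ) : phaseBound p k 1 = max (1 + (k : ℝ)) (1 / p) := by
  simp [phaseBound, invGeomSum_zero, invGeomSum_one]

/-- The ceiling may cost one more round, hence `x + 1`. The slack `-2`, due to `G ≤ P - 2` for the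
hitting bound `G`, helps with the additive terms in the final count. -/
lemma phaseBound_le {p : ℝ} (hp0 : 0 < p) (hp : p ≤ 1 / 2) {k m μ : ℕ} {x : ℝ} (hk1 : 1 ≤ k)
    (hk : (k : ℝ) ≤ x + 1) (hx : 1 ≤ x) (hm : 2 ≤ m) (hμ : m ≤ μ) :
    phaseBound p k m ≤ μ * (1 / p) ^ μ * (x + 1) - 2 := by
  have h2 : 2 ≤ 1 / p := by rw [le_div_iff₀ hp0]; linarith
  have hm' : (2 : ℝ) ≤ m := by exact_mod_cast hm
  have hk1' : (1 : ℝ) ≤ k := by exact_mod_cast hk1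
  set P := (1 / p) ^ m with hP
  have hP4 : 4 ≤ P := by
    calc (4 : ℝ) = 2 ^ 2 := by norm_num
      _ ≤ (1 / p) ^ 2 := by gcongr
      _ ≤ P := pow_le_pow_right₀ (by linarith) hm
  have hM : m * P ≤ μ * (1 / p) ^ μ := by
    have : P ≤ (1 / p) ^ μ := pow_le_pow_right₀ (by linarith) hμ
    gcongr
  have hG : max 1 (invGeomSum p (m - 1)) ≤ P - 2 := by
    refine max_le (by linarith) ((invGeomSum_le hp0 hp _).trans ?_)
    have h3 : P = (1 / p) ^ (m - 1) * (1 / p) := by rw [hP, ← pow_succ]; congr 1; omega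
    have h4 : 0 < (1 / p) ^ (m - 1) := by positivity
    have := mul_le_mul_of_nonneg_left h2 h4.le
    linarith
  have hmk : 2 ≤ (m : ℝ) * k := by nlinarith
  have hmP : 0 ≤ m * P := by positivity
  refine max_le ?_ ?_
  · calc 1 + (k : ℝ) * m * max 1 (invGeomSum p (m - 1)) ≤ 1 + (k : ℝ) * m * (P - 2) := by gcongr
      _ = 1 + (m * P) * k - 2 * (m * k) := by ring
      _ ≤ 1 + (μ * (1 / p) ^ μ) * (x + 1) - 2 * (m * k) := by gcongr
      _ ≤ _ := by linarith
  · refine (invGeomSum_le hp0 hp m).trans ?_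
    have h3 : 2 * P ≤ m * P := by gcongr
    have h4 : (m * P) * 1 ≤ (μ * (1 / p) ^ μ) * (x + 1) := by
      gcongr
      linarith
    linarith

/-- For `μ ≥ 2` the factor `μ p^(-μ) ≥ 4/p` is so generous for a single state that it absorbs the
rounding. -/
lemma phaseBound_one_le {p : ℝ} (hp0 : 0 < p) (hp : p ≤ 1 / 2) {k μ : ℕ} {x : ℝ}
    (hk : (k : ℝ) ≤ x + 1) (hx : 1 ≤ x) (hμ : 2 ≤ μ) :
    phaseBound p k 1 ≤ μ * (1 / p) ^ μ * x - 2 := by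
  have h2 : 2 ≤ 1 / p := by rw [le_div_iff₀ hp0]; linarith
  have hM : 4 * (1 / p) ≤ μ * (1 / p) ^ μ := by
    calc 4 * (1 / p) ≤ 2 * ((1 / p) * (1 / p)) := by nlinarith
      _ = 2 * (1 / p) ^ 2 := by ring
      _ ≤ μ * (1 / p) ^ μ := by
          have h3 : (1 / p) ^ 2 ≤ (1 / p) ^ μ := pow_le_pow_right₀ (by linarith) hμ
          have h4 : (2 : ℝ) ≤ μ := by exact_mod_cast hμ
          gcongr
  have h5 := mul_le_mul_of_nonneg_right hM (zero_le_one.trans hx)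
  have h6 : 4 * (1 / p) * 1 ≤ 4 * (1 / p) * x := by gcongr
  have h7 : 4 * 2 * x ≤ 4 * (1 / p) * x := by gcongr
  rw [phaseBound_one]
  exact max_le (by linarith) (by linarith)

/-- The mean of `1, …, 2n - 1` is `n`. -/
lemma sum_Ico_thresholds (M c α l : ℝ) {n : ℕ} (hn : 1 ≤ n) :
    ∑ j ∈ Finset.Ico 1 (2 * n), (M * (α * ((j : ℝ) - l)) + c) =
      (2 * n - 1) * (M * α * (n - l) + c) := by
  induction n, hn using Nat.le_induction with
  | base => simp; ring
  | succ n hn ih =>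
    rw [show 2 * (n + 1) = 2 * n + 1 + 1 by ring, Finset.sum_Ico_succ_top (by omega),
      Finset.sum_Ico_succ_top (by omega), ih]
    push_cast
    ring

lemma sum_Ico_id {n : ℕ} (hn : 1 ≤ n) :
    ∑ j ∈ Finset.Ico 1 (2 * n), (j : ℝ) = (2 * n - 1) * n := by
  have := sum_Ico_thresholds 1 0 1 0 hn
  simpa using this

/-! ### Chains in which the only random choice is the initial state -/

section Deterministic

variable {V : Type*} {X : MarkovChain V}

lemma PathOf.of_concat {π : List V} {y : V} (h : PathOf X (π ++ [y])) : PathOf X π :=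
  fun u v e => h u v (pathEdge_concat_of_pathEdge e)

variable [Fintype V]

/-- Each state has only one successor, and a strongly connected set contains it. Hence the first
candidate is never left. -/
lemma closedSet_of_pmin_eq_one (hX : ∀ x y, X.Edge x y → 1 ≤ X.prob x y) {K : Set V}
    (hK : StronglyConnectedOn X.Edge K) : ClosedSet X K := by
  intro u hu v huv
  obtain ⟨w, hw, -⟩ := Relation.TransGen.head'_iff.1 (hK u hu u hu)
  by_contra hv
  have hne : v ≠ w := by rintro rfl; exact hv hw.2.1
  have := prob_add_prob_le_one X (x := u) hne
  have := hX u v huv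
  have := hX u w hw.2.2
  linarith

lemma mem_candidate_of_pmin_eq_one (hX : ∀ x y, X.Edge x y → 1 ≤ X.prob x y) {π : List V} {y : V}
    (hπ : PathOf X (π ++ [y])) {K : Set V} (hK : candidate π = some K) : y ∈ K := by
  obtain ⟨π', x, rfl, -, -⟩ := exists_concat_of_candidate hK
  have hx : (π' ++ [x]).getLast? = some x := by simp
  exact closedSet_of_pmin_eq_one hX (hπ.of_concat.stronglyConnectedOn hK) x
    (last_mem_candidate hK hx) y (hπ x y (pathEdge_concat.2 (Or.inr ⟨hx, rfl⟩)))

lemma candidateCount_eq_zero_of_pmin_eq_one (hX : ∀ x y, X.Edge x y → 1 ≤ X.prob x y) {π : List V}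
    (hπ : PathOf X π) (hc : candidate π = none) : candidateCount π = 0 := by
  induction π using List.reverseRecOn with
  | nil => exact candidateCount_nil
  | append_singleton π y ih =>
    rw [candidateCount_concat_of_none hc]
    refine ih hπ.of_concat ?_
    rcases hK : candidate π with _ | K
    · rfl
    · have := candidate_concat_of_mem hK (mem_candidate_of_pmin_eq_one hX hπ hK)
      rw [hc] at this
      cases this

end Deterministic

/-! ### The final count -/

set_option maxHeartbeats 800000 in
/-- A budget for the time spent with candidates with which the bound of the theorem is obtained. -/
lemma exists_budget {V : Type*} [Fintype V] (X : MarkovChain V) (good : Set V → Prop)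
    {p α ε : ℝ} (hp0 : 0 < p) (hX : ∀ x y, X.Edge x y → p ≤ X.prob x y) (hp : p = 1 ∨ p ≤ 1 / 2)
    (hα : 1 ≤ α) (hε0 : 0 < ε) (hε1 : ε < 1) (hgood : ∃ K, IsBSCC X.Edge K ∧ good K)
    {n μ : ℕ} (hn : n = Nat.card V) (hμ : μ = maxSCCSize X.Edge) :
    ∃ b : ℕ → ℕ → ℝ, (∀ i, Monotone (b i)) ∧
      (∀ π : List V, 0 ≤ b (candidateCount π) (classCount π)) ∧
      (∀ (π : List V) y K, PathOf X (π ++ [y]) →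
        candidate (π ++ [y]) = some K → candidate π ≠ some K → ¬ (ClosedSet X K ∧ good K) →
        phaseBound p ⌈α * (((candidateCount π + 1 : ℕ) : ℝ) - Real.logb 2 ε)⌉₊ K.ncard +
          b (candidateCount π + 1) (classCount (π ++ [y])) ≤
          b (candidateCount π) (classCount π)) ∧
      1 + n + b 0 n ≤ 2 * n * α * (n - Real.logb 2 ε) * μ * (1 / p) ^ μ := by
  classical
  obtain ⟨G, hG, hGgood⟩ := hgood
  have hne : Nonempty V := ⟨hG.1.1.some⟩
  have hμ1 : 1 ≤ μ := by
    rw [hμ]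
    exact ((Set.ncard_pos (Set.toFinite G)).2 hG.1.1).trans_le
      (ncard_le_maxSCCSize hG.1.1 hG.1.2.prop)
  have hμn : μ ≤ n := by rw [hμ, hn]; exact maxSCCSize_le _
  have hn1 : 1 ≤ n := hμ1.trans hμn
  have hn1' : (1 : ℝ) ≤ n := by exact_mod_cast hn1
  have hμ1' : (1 : ℝ) ≤ μ := by exact_mod_cast hμ1
  have hμn' : (μ : ℝ) ≤ n := by exact_mod_cast hμn
  set l := Real.logb 2 ε with hldef
  have hl : l < 0 := Real.logb_neg (by norm_num) hε0 hε1
  have hp1 : p ≤ 1 := by rcases hp with h | h <;> linarith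
  have hpinv : 1 ≤ 1 / p := by rw [le_div_iff₀ hp0]; linarith
  have hpow : 1 ≤ (1 / p) ^ μ := one_le_pow₀ hpinv
  set M : ℝ := μ * (1 / p) ^ μ with hM
  have hM1 : 1 ≤ M := one_le_mul_of_one_le_of_one_le hμ1' hpow
  set x : ℕ → ℝ := fun j => α * ((j : ℝ) - l) with hxdef
  have hxj : ∀ j : ℕ, (j : ℝ) ≤ x j := by
    intro j
    have hj : (0 : ℝ) ≤ j := Nat.cast_nonneg j
    calc (j : ℝ) ≤ 1 * (j - l) := by linarith
      _ ≤ x j := mul_le_mul_of_nonneg_right hα (by linarith)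
  have hx1 : ∀ j : ℕ, 1 ≤ j → 1 ≤ x j := fun j hj =>
    le_trans (by exact_mod_cast hj) (hxj j)
  have hk : ∀ j : ℕ, 1 ≤ j → (⌈x j⌉₊ : ℝ) ≤ x j + 1 := fun j hj =>
    (Nat.ceil_lt_add_one (by linarith [hx1 j hj])).le
  have hk1 : ∀ j : ℕ, 1 ≤ j → 1 ≤ ⌈x j⌉₊ := fun j hj =>
    Nat.one_le_ceil_iff.2 (by linarith [hx1 j hj])
  have hgoal : 2 * (n : ℝ) * α * (n - l) * μ * (1 / p) ^ μ = 2 * n * x n * M := by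
    simp only [hxdef, hM]; ring
  rw [hgoal]
  have hxn : (n : ℝ) ≤ x n := hxj n
  have hxnM : (n : ℝ) ≤ x n * M := hxn.trans (le_mul_of_one_le_right (by linarith) hM1)
  have hcount : ∀ (π : List V) y K, candidate (π ++ [y]) = some K → candidate π ≠ some K →
      candidateCount π + 1 < 2 * n := by
    intro π y K h1 h2
    have := candidateCount_lt (π ++ [y])
    rw [candidateCount_concat_of_fresh h1 h2, ← hn] at this
    omega
  have hKsize : ∀ (π : List V) K, PathOf X π → candidate π = some K → K.ncard ≤ μ := by
    intro π K hπ hK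
    rw [hμ]
    exact ncard_le_maxSCCSize (candidate_nonempty hK) (hπ.stronglyConnectedOn hK)
  have hKpos : ∀ (π : List V) K, candidate π = some K → 1 ≤ K.ncard := fun π K hK =>
    (Set.ncard_pos (Set.toFinite K)).2 (candidate_nonempty hK)
  by_cases hn2 : n = 1
  · -- every candidate is the good bottom SCC
    refine ⟨fun _ _ => 0, fun _ => monotone_const, fun _ => le_rfl, ?_, ?_⟩
    · intro π y K _ hK _ hng
      have hsub : Subsingleton V := by
        have : Nat.card V = 1 := hn ▸ hn2
        exact (Nat.card_eq_one_iff_unique.1 this).1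
      obtain ⟨v, hv⟩ := candidate_nonempty hK
      obtain ⟨w, hw⟩ := hG.1.1
      have hKG : K = G := (Set.eq_univ_iff_forall.2 fun z => Subsingleton.elim v z ▸ hv).trans
        (Set.eq_univ_iff_forall.2 fun z => Subsingleton.elim w z ▸ hw).symm
      exact absurd ⟨fun _ _ z _ => Subsingleton.elim v z ▸ hv, hKG ▸ hGgood⟩ hng
    · rw [hn2] at hxnM ⊢
      push_cast at *
      linarith
  have hn2' : (2 : ℝ) ≤ n := by exact_mod_cast (by omega : 2 ≤ n)
  rcases hp with rfl | hp
  · -- only one candidate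
    refine ⟨fun i _ => if i = 0 then phaseBound 1 ⌈x 1⌉₊ μ else 0, fun _ => monotone_const,
      fun π => ?_, ?_, ?_⟩
    · beta_reduce
      split_ifs
      · exact phaseBound_nonneg _ _ _
      · exact le_rfl
    · intro π y K hπ hK hne _
      have hc : candidate π = none := by
        rcases hK' : candidate π with _ | K'
        · rfl
        · have h1 := candidate_concat_of_mem hK' (mem_candidate_of_pmin_eq_one hX hπ hK')
          rw [hK] at h1
          rw [hK', h1] at hne
          exact absurd rfl hne
      rw [candidateCount_eq_zero_of_pmin_eq_one hX hπ.of_concat hc]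
      simp only [zero_add, one_ne_zero, if_false, if_true, add_zero]
      exact phaseBound_mono one_pos _ (hKsize _ K hπ hK)
    · simp only [if_true]
      have hMμ : M = μ := by simp [hM]
      rw [hMμ] at hxnM ⊢
      have hmax : max 1 (invGeomSum 1 (μ - 1)) ≤ (n : ℝ) - 1 := by
        rw [invGeomSum_one_left]
        refine max_le (by linarith) ?_
        rw [Nat.cast_sub hμ1, Nat.cast_one]
        linarith
      have hxn1 : x n = x 1 + α * (n - 1) := by simp only [hxdef]; push_cast; ring
      have hx11 := hx1 1 le_rfl
      have hk2 := hk 1 le_rfl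
      have hbound : phaseBound 1 ⌈x 1⌉₊ μ ≤ 1 + 2 * x 1 * μ * (n - 1) := by
        refine max_le ?_ ?_
        · gcongr
          · linarith
        · rw [invGeomSum_one_left]
          have h1 : (μ : ℝ) * 1 ≤ (μ * (n - 1)) * x 1 := by
            have : (μ : ℝ) * 1 ≤ μ * (n - 1) := by gcongr; linarith
            exact this.trans (le_mul_of_one_le_right (by linarith) hx11)
          linarith
      have h1 : (1 : ℝ) ≤ μ * x 1 := one_le_mul_of_one_le_of_one_le hμ1' hx11
      have h2 : (1 : ℝ) ≤ μ * α := one_le_mul_of_one_le_of_one_le hμ1' hα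
      have h3 : 2 * (n : ℝ) * (n - 1) ≤ 2 * n * (n - 1) * (μ * α) :=
        le_mul_of_one_le_right (mul_nonneg (by linarith) (by linarith)) h2
      have h4 : 2 * (n : ℝ) * 1 ≤ 2 * n * (n - 1) := by gcongr; linarith
      rw [hxn1]
      linarith
  have hp2 : 2 ≤ 1 / p := by rw [le_div_iff₀ hp0]; linarith
  have hsplit : ∀ (f : ℕ → ℝ) (π : List V) y K, candidate (π ++ [y]) = some K →
      candidate π ≠ some K → ∑ j ∈ Finset.Ico (candidateCount π + 1) (2 * n), f j =
        f (candidateCount π + 1) + ∑ j ∈ Finset.Ico (candidateCount π + 1 + 1) (2 * n), f j :=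
    fun f π y K h1 h2 => Finset.sum_eq_sum_Ico_succ_bot (hcount π y K h1 h2) f
  have hμ' : μ = 1 ∨ 2 ≤ μ := by omega
  rcases hμ' with hμ' | hμ'
  · -- all candidates are single states
    have hMp : M = 1 / p := by simp [hM, hμ']
    -- Since `M ≥ 2` and `x j ≥ j`, a saving of `j` is possible for each candidate; it offsets the
    -- additive terms.
    have hterm : ∀ j : ℕ, 1 ≤ j → x j + 2 ≤ M * x j + (2 - j) := by
      intro j hj
      have h1 := hxj j
      have h2 := hx1 j hj
      rw [hMp]
      have : 2 * x j ≤ 1 / p * x j := by gcongr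
      linarith
    refine ⟨fun i _ => ∑ j ∈ Finset.Ico (i + 1) (2 * n), (M * x j + (2 - j)),
      fun _ => monotone_const, fun π => ?_, ?_, ?_⟩
    · refine Finset.sum_nonneg fun j hj => ?_
      have hj1 : 1 ≤ j := by have := (Finset.mem_Ico.1 hj).1; omega
      linarith [hterm j hj1, hx1 j hj1]
    · intro π y K hπ hK hne _
      have hK1 : K.ncard = 1 := le_antisymm (hμ' ▸ hKsize _ K hπ hK) (hKpos _ K hK)
      simp only
      rw [hsplit _ π y K hK hne, hK1, phaseBound_one]
      refine add_le_add_left (max_le ?_ ?_) _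
      · linarith [hk (candidateCount π + 1) (by omega), hterm (candidateCount π + 1) (by omega)]
      · set j := candidateCount π + 1
        have h1 := hxj j
        have h2 : (1 : ℝ) ≤ j := by exact_mod_cast (by omega : 1 ≤ j)
        rw [hMp]
        linarith [mul_le_mul_of_nonneg_left h1 (by linarith : 0 ≤ 1 / p),
          mul_nonneg (by linarith : 0 ≤ 1 / p - 1) (by linarith : 0 ≤ (j : ℝ) - 1)]
    · have h1 : ∑ j ∈ Finset.Ico (0 + 1) (2 * n), (M * x j + (2 - (j : ℝ))) =
          (2 * n - 1) * (M * α * (n - l) + 2) - (2 * n - 1) * n := by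
        rw [zero_add, ← sum_Ico_thresholds M 2 α l hn1, ← sum_Ico_id hn1,
          ← Finset.sum_sub_distrib]
        exact Finset.sum_congr rfl fun j _ => by ring
      simp only [h1]
      have h2 : M * α * (n - l) = x n * M := by simp only [hxdef]; ring
      have h3 : 2 * (n : ℝ) ≤ x n * M := by
        rw [hMp, mul_comm (x n)]
        exact mul_le_mul hp2 hxn (by linarith) (by linarith)
      rw [h2]
      linarith [mul_le_mul_of_nonneg_left hn2' (by linarith : (0 : ℝ) ≤ n)]
  · have hM8 : 8 ≤ M := by
      calc (8 : ℝ) = 2 * 2 ^ 2 := by norm_num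
        _ ≤ 2 * (1 / p) ^ 2 := by gcongr
        _ ≤ μ * (1 / p) ^ μ := by
          have h3 : (1 / p) ^ 2 ≤ (1 / p) ^ μ := pow_le_pow_right₀ (by linarith) hμ'
          have h4 : (2 : ℝ) ≤ μ := by exact_mod_cast hμ'
          gcongr
    -- A candidate with at least two states may cost `M` more than `M * x j - 2`, but its birth
    -- merges classes. `M * (N - 1)` pays for the at most `N - 1` mergers to come.
    refine ⟨fun i N => ∑ j ∈ Finset.Ico (i + 1) (2 * n), (M * x j + (-2)) + M * (N - 1),
      fun i N N' h => ?_, fun π => ?_, ?_, ?_⟩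
    · have : (N : ℝ) ≤ N' := by exact_mod_cast h
      have := mul_le_mul_of_nonneg_left this (by linarith : 0 ≤ M)
      simp only
      linarith
    · refine add_nonneg (Finset.sum_nonneg fun j hj => ?_) (mul_nonneg (by linarith) ?_)
      · have hj1 : 1 ≤ j := by have := (Finset.mem_Ico.1 hj).1; omega
        have := mul_le_mul hM8 (hx1 j hj1) zero_le_one (by linarith)
        linarith
      · have : (1 : ℝ) ≤ classCount π := by exact_mod_cast classCount_pos π
        linarith
    · intro π y K hπ hK hne _
      simp only
      rw [hsplit _ π y K hK hne]
      set j := candidateCount π + 1 with hj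
      have hj1 : 1 ≤ j := by omega
      have hN : (classCount (π ++ [y]) : ℝ) ≤ classCount π := by
        exact_mod_cast classCount_concat_le π y
      by_cases hK1 : K.ncard = 1
      · have h1 := phaseBound_one_le hp0 hp (hk j hj1) (hx1 j hj1) hμ'
        have h2 := mul_le_mul_of_nonneg_left hN (by linarith : 0 ≤ M)
        rw [hK1]
        linarith
      · have h1 := phaseBound_le hp0 hp (hk1 j hj1) (hk j hj1) (hx1 j hj1)
          (by have := hKpos _ K hK; omega) (hKsize _ K hπ hK)
        have hlt : classCount (π ++ [y]) < classCount π := by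
          rcases fresh_cases hK hne with h | ⟨rfl, -⟩
          · exact h
          · exact absurd (Set.ncard_singleton y) hK1
        have hN' : (classCount (π ++ [y]) : ℝ) ≤ classCount π - 1 := by
          have : (classCount (π ++ [y]) : ℝ) + 1 ≤ classCount π := by exact_mod_cast hlt
          linarith
        have h2 := mul_le_mul_of_nonneg_left hN' (by linarith : 0 ≤ M)
        linarith
    · simp only [zero_add]
      rw [sum_Ico_thresholds M (-2) α l hn1]
      have h2 : M * α * (n - l) = x n * M := by simp only [hxdef]; ring
      -- The mergers are paid by the last of the `2n` terms `x n * M`; the sum uses `2n - 1` of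
      -- them.
      have h3 : M * n ≤ x n * M := by rw [mul_comm]; gcongr
      rw [h2]
      linarith

end

end BoldMonitor

theorem mainTheorem5 {S Q Ap : Type*} [Fintype S] [Fintype Q]
    (M : BoldMonitor.MarkovChain S) (L : S → Set Ap)
    (φ : Set (ℕ → Set Ap)) (D : BoldMonitor.DRA (Set Ap) Q)
    (hD : ∀ w : ℕ → Set Ap, D.Accepts w ↔ w ∈ φ)
    (pφ : ℝ) (hpφ : pφ = (M.law {ρ | (fun i => L (ρ i)) ∈ φ}).toReal) (hpos : 0 < pφ)
    (n mxsc : ℕ) (hn : n = Fintype.card (S × Q))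
    (hmxsc : mxsc = BoldMonitor.maxSCCSize (BoldMonitor.product M L D).Edge)
    (α ε : ℝ) (hα : max 1 (-1 / Real.logb 2 (1 - M.pmin)) ≤ α) (hε0 : 0 < ε) (hε1 : ε < 1) :
    ∫⁻ ρ, BoldMonitor.stepsToLastReset ρ ∂(BoldMonitor.monitorChain M L D α ε).law ≤
      ENNReal.ofReal (1 / (pφ * (1 - ε)) *
        (2 * n * α * (n - Real.logb 2 ε) * mxsc * (1 / M.pmin) ^ mxsc)) := by
  have hacc : pφ = (M.law {ρ | D.Accepts fun i => L (ρ i)}).toReal := by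
    simp only [hpφ, hD]
  -- Without a good bottom SCC `h` would be 0, and so would the acceptance probability. The count
  -- needs such an SCC for `mxsc ≥ 1` and for chains with a single state.
  have hgood : ∃ K, BoldMonitor.IsBSCC (BoldMonitor.product M L D).Edge K ∧
      BoldMonitor.Good D K := by
    by_contra hno
    obtain ⟨h, -, -, -, -, h0, hle⟩ := BoldMonitor.exists_harmonic_of_accepts M L D
    rw [← hacc] at hle
    simp only [h0 hno, mul_zero, Finset.sum_const_zero] at hle
    linarith
  rw [← Nat.card_eq_fintype_card] at hn
  obtain ⟨b, hb1, hb2, hb3, hb4⟩ := BoldMonitor.exists_budget (BoldMonitor.product M L D)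
    (BoldMonitor.Good D) (BoldMonitor.pmin_pos M)
    (fun x y => BoldMonitor.pmin_le_prob_product M L D) (BoldMonitor.pmin_eq_one_or_le_half M)
    ((le_max_left _ _).trans hα) hε0 hε1 hgood hn hmxsc
  refine (BoldMonitor.lintegral_stepsToLastReset_le_of_budget M L D hα hε0 hε1 hacc hpos b
    hb1 hb2 hb3).trans (ENNReal.ofReal_le_ofReal ?_)
  have hcε : 0 < pφ * (1 - ε) := mul_pos hpos (by linarith)
  rw [← hn, div_eq_mul_inv, mul_comm, ← one_div]
  exact mul_le_mul_of_nonneg_left hb4 (by positivity)
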